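/- Let $\mathsf{N_C},\mathsf{N_R},\mathsf{N_I}$ be countably infinite sets of concept names, role names and individual names. A role is a role name $r$ or an inverse role $r^-$, with $(r^-)^-=r$. A Horn-$\mathcal{ALCHIF}$ TBox (in normal form) is a finite set of concept inclusions of the forms $\top\sqsubseteq A$, $A\sqsubseteq\bot$, $A_1\sqcap A_2\sqsubseteq B$, $A\sqsubseteq\exists r.B$, $A\sqsubseteq\forall r.B$ (with $A,A_1,A_2,B$ concept names and $r$ a role), role inclusions $r\sqsubseteq s$ and functionality assertions $\mathsf{func}(r)$ ($r,s$ roles), in which functional roles have no subroles: if $r\sqsubseteq s\in\mathcal T$ (equivalently, $r^-\sqsubseteq s^-$), then $\mathsf{func}(s),\mathsf{func}(s^-)\notin\mathcal T$. An ABox is a finite set of assertions $A(a)$, $r(a,b)$ with $r$ a role name; $\mathsf{ind}(\mathcal A)$ is the set of its individuals, and for a role name $r$ we write $r^-(a,b)\in\mathcal A$ for $r(b,a)\in\mathcal A$. Semantics is the usual one over non-empty domains, under the standard name assumption: an individual name that belongs to the domain of an interpretation denotes itself, and a model of $\mathcal A$ has $\mathsf{ind}(\mathcal A)$ in its domain.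 An ABox is consistent with $\mathcal T$ if the two have a common model. An ABox, or a conjunctive query (CQ), is tree-shaped if it contains no $r(z,z)$, the undirected graph on its individuals (variables) given by its role assertions (atoms) is a tree, and any two individuals (variables) occur together in at most one role assertion (atom). An interpretation is weakly tree-shaped if no $(d,d)$ belongs to a role and the undirected graph on its domain given by all role edges is a tree (multi-edges allowed); it is finitely branching if every element has only finitely many neighbours in this graph. A 1tCQ is a tree-shaped CQ with exactly one answer variable; $\mathcal T,\mathcal A\models q(a)$ means that $q(a)$ holds in all models of $\mathcal T$ and $\mathcal A$. A signature $\Sigma$ is a set of concept and role names; a $\Sigma$-role is a role whose role name is in $\Sigma$. Given signatures $\Sigma_A,\Sigma_Q$ and TBoxes $\mathcal T_1,\mathcal T_2$: - $\mathcal T_1\models^{\mathrm{RI}}_{\Sigma_A,\Sigma_Q}\mathcal T_2$ means that $\mathcal T_2\models r\sqsubseteq s$ implies $\mathcal T_1\models r\sqsubseteq s$ for every $\Sigma_A$-role $r$ and $\Sigma_Q$-role $s$. - $\mathcal T_1$ $(\Sigma_A,\Sigma_Q)$-1tCQ entails $\mathcal T_2$ if for every $\Sigma_A$-ABox $\mathcal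 A$ consistent with $\mathcal T_1$ and with $\mathcal T_2$, every 1tCQ $q$ over $\Sigma_Q$ and every $a\in\mathsf{ind}(\mathcal A)$, $\mathcal T_2,\mathcal A\models q(a)$ implies $\mathcal T_1,\mathcal A\models q(a)$. - A $\Sigma$-simulation of $\mathcal I$ in $\mathcal J$ is a relation $\sigma\subseteq\Delta^{\mathcal I}\times\Delta^{\mathcal J}$ such that (1) every individual name $a$ in $\Delta^{\mathcal I}$ is also in $\Delta^{\mathcal J}$ and $(a,a)\in\sigma$; (2) if $d\in A^{\mathcal I}$, $A\in\Sigma$ and $(d,e)\in\sigma$, then $e\in A^{\mathcal J}$; (3) if $(d,d')\in r^{\mathcal I}$ with $r$ a $\Sigma$-role and $(d,e)\in\sigma$, then there is $e'$ with $(e,e')\in r^{\mathcal J}$ and $(d',e')\in\sigma$. We write $\mathcal I\preceq_\Sigma\mathcal J$ if one exists. - The universal model $\mathcal I_{\mathcal T,\mathcal A}$, for $\mathcal A$ consistent with $\mathcal T$. A $\mathcal T$-type is a set $t$ of concept names occurring in $\mathcal T$ such that $\mathcal T\models\bigsqcap t\sqsubseteq A$ implies $A\in t$. Write $t\rightsquigarrow_r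 t'$ (resp. $a\rightsquigarrow_r t'$) if $t'$ is a maximal $\mathcal T$-type with $\mathcal T\models\bigsqcap t\sqsubseteq\exists r.\bigsqcap t'$ (resp. $\mathcal T,\mathcal A\models(\exists r.\bigsqcap t')(a)$). The domain is the set of all sequences $a\,r_0t_1\cdots r_{n-1}t_n$, $n\ge0$, with $a\in\mathsf{ind}(\mathcal A)$ such that $a\rightsquigarrow_{r_0}t_1$ and, if $\mathsf{func}(r_0)\in\mathcal T$, there is no $b\in\mathsf{ind}(\mathcal A)$ with $\mathcal T,\mathcal A\models r_0(a,b)$; and, for $1\le i<n$, $t_i\rightsquigarrow_{r_i}t_{i+1}$ and, if $\mathsf{func}(r_i)\in\mathcal T$, $r_{i-1}\ne r_i^-$. An individual $a$ is in the extension of $A$ iff $\mathcal T,\mathcal A\models A(a)$; a longer sequence with last type $t$ is in it iff $\mathcal T\models\bigsqcap t\sqsubseteq A$. The extension of a role name $r$ consists of the pairs $(a,b)$ of individuals with $s(a,b)\in\mathcal A$ and $\mathcal T\models s\sqsubseteq r$ for some role $s$, the pairs $(\pi,\pi st)$ with $\mathcal T\models s\sqsubseteq r$, and the pairs $(\pi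 st,\pi)$ with $\mathcal T\models s^-\sqsubseteq r$. **Theorem.** Let $\mathcal T_1,\mathcal T_2$ be Horn-$\mathcal{ALCHIF}$ TBoxes and $\Sigma_A,\Sigma_Q$ signatures with $\mathcal T_1\models^{\mathrm{RI}}_{\Sigma_A,\Sigma_Q}\mathcal T_2$. Then the following are equivalent: (a) $\mathcal T_1$ $(\Sigma_A,\Sigma_Q)$-1tCQ entails $\mathcal T_2$; (b) $\mathcal I_{\mathcal T_2,\mathcal A}\preceq_{\Sigma_Q}\mathcal I_1$ for every tree-shaped $\Sigma_A$-ABox $\mathcal A$ that is consistent with $\mathcal T_1$ and with $\mathcal T_2$, and every weakly tree-shaped, finitely branching model $\mathcal I_1$ of $\mathcal A$ and $\mathcal T_1$. -/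

import Mathlib

universe u

namespace HornALCHIF

/-- A role is a role name `r` or an inverse role `r⁻`. -/
inductive Role (NR : Type u) : Type u where
  | name (r : NR) : Role NR
  | inv (r : NR) : Role NR

/-- The inverse of a role, with `(r⁻)⁻` identified with `r`. -/
def Role.inverse {NR : Type u} : Role NR → Role NR
  | .name r => .inv r
  | .inv r => .name r

/-- The role name underlying a role. -/
def Role.baseName {NR : Type u} : Role NR → NR
  | .name r => r
  | .inv r => r

/-- Concept inclusions in normal form. -/
inductive CI (NC NR : Type u) : Type u where
  /-- `⊤ ⊑ A` -/
  | top (A : NC) : CI NC NR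
  /-- `A ⊑ ⊥` -/
  | bot (A : NC) : CI NC NR
  /-- `A₁ ⊓ A₂ ⊑ B` -/
  | conj (A₁ A₂ B : NC) : CI NC NR
  /-- `A ⊑ ∃ r. B` -/
  | ex (A : NC) (r : Role NR) (B : NC) : CI NC NR
  /-- `A ⊑ ∀ r. B` -/
  | all (A : NC) (r : Role NR) (B : NC) : CI NC NR

/-- The concept names that occur in a concept inclusion. -/
def CI.conceptNames {NC NR : Type u} : CI NC NR → Set NC
  | .top A => {A}
  | .bot A => {A}
  | .conj A₁ A₂ B => {A₁, A₂, B}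
  | .ex A _ B => {A, B}
  | .all A _ B => {A, B}

/-- A Horn-ALCHIF TBox in normal form: a finite set of concept inclusions, role inclusions
(a pair `(r, s)` stands for `r ⊑ s`) and functionality assertions. -/
structure TBox (NC NR : Type u) : Type u where
  cis : Finset (CI NC NR)
  ris : Finset (Role NR × Role NR)
  fas : Finset (Role NR)

/-- Functional roles have no subroles: if `r ⊑ s` is in the TBox (equivalently, `r⁻ ⊑ s⁻`),
then neither `s` nor `s⁻` is asserted to be functional. -/
def TBox.FunctionalNoSubroles {NC NR : Type u} (T : TBox NC NR) : Prop :=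
  ∀ r s : Role NR, (r, s) ∈ T.ris → s ∉ T.fas ∧ s.inverse ∉ T.fas

/-- An ABox: a finite set of assertions `A(a)` and `r(a,b)`. -/
structure ABox (NC NR NI : Type u) : Type u where
  concepts : Finset (NC × NI)
  roles : Finset (NR × NI × NI)

/-- A signature: a set of concept names and role names. -/
structure Sig (NC NR : Type u) : Type u where
  concepts : Set NC
  roles : Set NR

/-- Interpretations.  An individual name may denote a domain element (`name a = some d`);
distinct names denote distinct elements, so that the named elements can be identified with their
names (standard name assumption).  Names that are not in the domain denote nothing. -/
structure Interp (NC NR NI : Type u) : Type (u + 1) where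
  Dom : Type u
  dom_nonempty : Nonempty Dom
  conc : NC → Set Dom
  role : NR → Dom → Dom → Prop
  name : NI → Option Dom
  name_inj : ∀ a b d, name a = some d → name b = some d → a = b

variable {NC NR NI : Type u}

namespace Interp

/-- The extension of a role. -/
def rel (I : Interp NC NR NI) : Role NR → I.Dom → I.Dom → Prop
  | .name r => fun d e => I.role r d e
  | .inv r => fun d e => I.role r e d

/-- The extension of the conjunction of a set of concept names. -/
def conjExt (I : Interp NC NR NI) (t : Set NC) : Set I.Dom :=
  {d | ∀ A ∈ t, d ∈ I.conc A}

/-- Satisfaction of a concept inclusion in normal form. -/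
def SatCI (I : Interp NC NR NI) : CI NC NR → Prop
  | .top A => ∀ d, d ∈ I.conc A
  | .bot A => ∀ d, d ∉ I.conc A
  | .conj A₁ A₂ B => ∀ d, d ∈ I.conc A₁ → d ∈ I.conc A₂ → d ∈ I.conc B
  | .ex A r B => ∀ d, d ∈ I.conc A → ∃ e, I.rel r d e ∧ e ∈ I.conc B
  | .all A r B => ∀ d, d ∈ I.conc A → ∀ e, I.rel r d e → e ∈ I.conc B

/-- Satisfaction of a role inclusion `r ⊑ s`. -/
def SatRI (I : Interp NC NR NI) (r s : Role NR) : Prop :=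
  ∀ d e, I.rel r d e → I.rel s d e

/-- Satisfaction of a functionality assertion. -/
def SatFA (I : Interp NC NR NI) (r : Role NR) : Prop :=
  ∀ d e e', I.rel r d e → I.rel r d e' → e = e'

/-- `I` is a model of the TBox. -/
def ModelsT (I : Interp NC NR NI) (T : TBox NC NR) : Prop :=
  (∀ c ∈ T.cis, I.SatCI c) ∧ (∀ p ∈ T.ris, I.SatRI p.1 p.2) ∧ (∀ r ∈ T.fas, I.SatFA r)

/-- `I` is a model of the ABox. -/
def ModelsA (I : Interp NC NR NI) (𝒜 : ABox NC NR NI) : Prop :=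
  (∀ A a, (A, a) ∈ 𝒜.concepts → ∃ d, I.name a = some d ∧ d ∈ I.conc A) ∧
  (∀ r a b, (r, a, b) ∈ 𝒜.roles →
    ∃ d e, I.name a = some d ∧ I.name b = some e ∧ I.role r d e)

/-- The undirected graph on the domain whose edges are the role edges. -/
def graph (I : Interp NC NR NI) : SimpleGraph I.Dom :=
  SimpleGraph.fromRel fun d e => ∃ r, I.role r d e

/-- No loops, and the underlying undirected graph is a tree; multi-edges are allowed. -/
def WeaklyTreeShaped (I : Interp NC NR NI) : Prop :=
  (∀ r d, ¬ I.role r d d) ∧ I.graph.IsTree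

/-- Every element is directly connected to finitely many elements only. -/
def FinitelyBranching (I : Interp NC NR NI) : Prop :=
  ∀ d : I.Dom, {e : I.Dom | ∃ r, I.role r d e ∨ I.role r e d}.Finite

/-- `σ` is a `Sg`-simulation of `I` in `J`. -/
def IsSimulation (Sg : Sig NC NR) (I J : Interp NC NR NI) (σ : I.Dom → J.Dom → Prop) : Prop :=
  (∀ a d, I.name a = some d → ∃ e, J.name a = some e ∧ σ d e) ∧
  (∀ A ∈ Sg.concepts, ∀ d e, d ∈ I.conc A → σ d e → e ∈ J.conc A) ∧
  (∀ r : Role NR, r.baseName ∈ Sg.roles → ∀ d d' e, I.rel r d d' → σ d e →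
    ∃ e', J.rel r e e' ∧ σ d' e')

/-- There is a `Sg`-simulation of `I` in `J`. -/
def Simulates (Sg : Sig NC NR) (I J : Interp NC NR NI) : Prop :=
  ∃ σ : I.Dom → J.Dom → Prop, IsSimulation Sg I J σ

end Interp

namespace ABox

/-- The individuals of an ABox. -/
def ind (𝒜 : ABox NC NR NI) : Set NI :=
  {a | (∃ A, (A, a) ∈ 𝒜.concepts) ∨ (∃ r b, (r, a, b) ∈ 𝒜.roles ∨ (r, b, a) ∈ 𝒜.roles)}

/-- `r(a,b) ∈ 𝒜` for a possibly inverse role `r`, where `r⁻(a,b)` stands for `r(b,a)`. -/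
def HasRole (𝒜 : ABox NC NR NI) : Role NR → NI → NI → Prop
  | .name r => fun a b => (r, a, b) ∈ 𝒜.roles
  | .inv r => fun a b => (r, b, a) ∈ 𝒜.roles

/-- The ABox uses only symbols from the signature. -/
def Over (𝒜 : ABox NC NR NI) (Sg : Sig NC NR) : Prop :=
  (∀ p ∈ 𝒜.concepts, p.1 ∈ Sg.concepts) ∧ (∀ p ∈ 𝒜.roles, p.1 ∈ Sg.roles)

/-- The undirected graph of an ABox. -/
def graph (𝒜 : ABox NC NR NI) : SimpleGraph 𝒜.ind :=
  SimpleGraph.fromRel fun a b => ∃ r, (r, (a : NI), (b : NI)) ∈ 𝒜.roles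

/-- No loops, the graph is a tree, and there are no multi-edges. -/
structure TreeShaped (𝒜 : ABox NC NR NI) : Prop where
  no_loop : ∀ r a, (r, a, a) ∉ 𝒜.roles
  isTree : 𝒜.graph.IsTree
  no_multi : ∀ p ∈ 𝒜.roles, ∀ p' ∈ 𝒜.roles,
    s(p.2.1, p.2.2) = s(p'.2.1, p'.2.2) → p = p'

theorem TreeShaped.ind_nonempty {𝒜 : ABox NC NR NI} (h : 𝒜.TreeShaped) : 𝒜.ind.Nonempty :=
  Set.nonempty_coe_sort.mp h.isTree.connected.nonempty

end ABox

/-- A conjunctive query with variables from `ℕ`: `vars` is the set of its variables, `ans` the tuple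
of its answer variables (the other variables are quantified). -/
structure CQ (NC NR : Type u) : Type u where
  vars : Finset ℕ
  ans : List ℕ
  conceptAtoms : Finset (NC × ℕ)
  roleAtoms : Finset (NR × ℕ × ℕ)
  ans_mem : ∀ x ∈ ans, x ∈ vars
  concept_mem : ∀ p ∈ conceptAtoms, p.2 ∈ vars
  role_mem : ∀ p ∈ roleAtoms, p.2.1 ∈ vars ∧ p.2.2 ∈ vars

namespace CQ

/-- The query uses only symbols from the signature. -/
def Over (q : CQ NC NR) (Sg : Sig NC NR) : Prop :=
  (∀ p ∈ q.conceptAtoms, p.1 ∈ Sg.concepts) ∧ (∀ p ∈ q.roleAtoms, p.1 ∈ Sg.roles)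

/-- The undirected graph of a query. -/
def graph (q : CQ NC NR) : SimpleGraph q.vars :=
  SimpleGraph.fromRel fun x y => ∃ r, (r, (x : ℕ), (y : ℕ)) ∈ q.roleAtoms

/-- Tree-shaped queries (tCQs). -/
structure TreeShaped (q : CQ NC NR) : Prop where
  no_loop : ∀ r z, (r, z, z) ∉ q.roleAtoms
  isTree : q.graph.IsTree
  no_multi : ∀ p ∈ q.roleAtoms, ∀ p' ∈ q.roleAtoms,
    s(p.2.1, p.2.2) = s(p'.2.1, p'.2.2) → p = p'

/-- 1tCQs: tree-shaped queries with exactly one answer variable. -/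
def IsOneTCQ (q : CQ NC NR) : Prop :=
  q.TreeShaped ∧ ∃ x, q.ans = [x]

/-- `π` is a match of `q` in `I`. -/
def IsMatch (q : CQ NC NR) (I : Interp NC NR NI) (π : ℕ → I.Dom) : Prop :=
  (∀ A z, (A, z) ∈ q.conceptAtoms → π z ∈ I.conc A) ∧
  (∀ r z z', (r, z, z') ∈ q.roleAtoms → I.role r (π z) (π z'))

/-- `I ⊨ q(a₁,…,aₙ)`. -/
def HoldsIn (q : CQ NC NR) (I : Interp NC NR NI) (as : List NI) : Prop :=
  ∃ π : ℕ → I.Dom, q.IsMatch I π ∧ q.ans.map (fun x => some (π x)) = as.map I.name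

end CQ

namespace TBox

/-- The ABox is consistent with the TBox. -/
def Consistent (T : TBox NC NR) (𝒜 : ABox NC NR NI) : Prop :=
  ∃ I : Interp NC NR NI, I.ModelsT T ∧ I.ModelsA 𝒜

/-- `T, 𝒜 ⊨ q(a₁,…,aₙ)`. -/
def CertainAnswer (T : TBox NC NR) (𝒜 : ABox NC NR NI) (q : CQ NC NR) (as : List NI) : Prop :=
  ∀ I : Interp NC NR NI, I.ModelsT T → I.ModelsA 𝒜 → q.HoldsIn I as

/-- `T₁` `(ΣA, ΣQ)`-1tCQ entails `T₂`. -/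
def OneTCQEntails (NI : Type u) (SA SQ : Sig NC NR) (T₁ T₂ : TBox NC NR) : Prop :=
  ∀ 𝒜 : ABox NC NR NI, 𝒜.Over SA → T₁.Consistent 𝒜 → T₂.Consistent 𝒜 →
    ∀ q : CQ NC NR, q.Over SQ → q.IsOneTCQ → ∀ a ∈ 𝒜.ind,
      T₂.CertainAnswer 𝒜 q [a] → T₁.CertainAnswer 𝒜 q [a]

/-- `T ⊨ r ⊑ s`. -/
def EntailsRI (NI : Type u) (T : TBox NC NR) (r s : Role NR) : Prop :=
  ∀ I : Interp NC NR NI, I.ModelsT T → I.SatRI r s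

/-- There are no `ΣA`-role `r` and `ΣQ`-role `s` with `T₂ ⊨ r ⊑ s` and `T₁ ⊭ r ⊑ s`. -/
def RIEntails (NI : Type u) (SA SQ : Sig NC NR) (T₁ T₂ : TBox NC NR) : Prop :=
  ∀ r s : Role NR, r.baseName ∈ SA.roles → s.baseName ∈ SQ.roles →
    T₂.EntailsRI NI r s → T₁.EntailsRI NI r s

/-- `T ⊨ ⨅ t ⊑ A`. -/
def EntailsConcept (NI : Type u) (T : TBox NC NR) (t : Set NC) (A : NC) : Prop :=
  ∀ I : Interp NC NR NI, I.ModelsT T → ∀ d ∈ I.conjExt t, d ∈ I.conc A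

/-- `T ⊨ ⨅ t ⊑ ∃ r. ⨅ t'`. -/
def EntailsExists (NI : Type u) (T : TBox NC NR) (t : Set NC) (r : Role NR) (t' : Set NC) : Prop :=
  ∀ I : Interp NC NR NI, I.ModelsT T → ∀ d ∈ I.conjExt t, ∃ e, I.rel r d e ∧ e ∈ I.conjExt t'

/-- `T, 𝒜 ⊨ A(a)`. -/
def EntailsConceptAt (T : TBox NC NR) (𝒜 : ABox NC NR NI) (A : NC) (a : NI) : Prop :=
  ∀ I : Interp NC NR NI, I.ModelsT T → I.ModelsA 𝒜 → ∃ d, I.name a = some d ∧ d ∈ I.conc A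

/-- `T, 𝒜 ⊨ r(a,b)`. -/
def EntailsRoleAt (T : TBox NC NR) (𝒜 : ABox NC NR NI) (r : Role NR) (a b : NI) : Prop :=
  ∀ I : Interp NC NR NI, I.ModelsT T → I.ModelsA 𝒜 →
    ∃ d e, I.name a = some d ∧ I.name b = some e ∧ I.rel r d e

/-- `T, 𝒜 ⊨ (∃ r. ⨅ t)(a)`. -/
def EntailsExistsAt (T : TBox NC NR) (𝒜 : ABox NC NR NI) (r : Role NR) (t : Set NC) (a : NI) :
    Prop :=
  ∀ I : Interp NC NR NI, I.ModelsT T → I.ModelsA 𝒜 →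
    ∃ d e, I.name a = some d ∧ I.rel r d e ∧ e ∈ I.conjExt t

/-- `T`-types: sets of concept names occurring in `T` that are closed under entailment. -/
def IsType (NI : Type u) (T : TBox NC NR) (t : Set NC) : Prop :=
  (∀ A ∈ t, ∃ c ∈ T.cis, A ∈ c.conceptNames) ∧ (∀ A, T.EntailsConcept NI t A → A ∈ t)

/-- `t ⇝ᵣ t'`: `t'` is a maximal type with `T ⊨ ⨅ t ⊑ ∃ r. ⨅ t'`. -/
def Arrow (NI : Type u) (T : TBox NC NR) (t : Set NC) (r : Role NR) (t' : Set NC) : Prop :=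
  Maximal (fun t'' => T.IsType NI t'' ∧ T.EntailsExists NI t r t'') t'

/-- `a ⇝ᵣ t`: `t` is a maximal type with `T, 𝒜 ⊨ (∃ r. ⨅ t)(a)`. -/
def ArrowInd (T : TBox NC NR) (𝒜 : ABox NC NR NI) (a : NI) (r : Role NR) (t : Set NC) : Prop :=
  Maximal (fun t' => T.IsType NI t' ∧ T.EntailsExistsAt 𝒜 r t' a) t

/-- `IsPath T 𝒜 a w`: the sequence `a r₀ t₁ ⋯ rₙ₋₁ tₙ` is a path for `𝒜` and `T`, where `w` is the
list `[(rₙ₋₁, tₙ), …, (r₀, t₁)]`, the last step first. -/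
inductive IsPath (T : TBox NC NR) (𝒜 : ABox NC NR NI) : NI → List (Role NR × Set NC) → Prop where
  | root (a : NI) : a ∈ 𝒜.ind → IsPath T 𝒜 a []
  | first (a : NI) (r : Role NR) (t : Set NC) : a ∈ 𝒜.ind → T.ArrowInd 𝒜 a r t →
      (r ∈ T.fas → ¬ ∃ b ∈ 𝒜.ind, T.EntailsRoleAt 𝒜 r a b) → IsPath T 𝒜 a [(r, t)]
  | next (a : NI) (r s : Role NR) (t t' : Set NC) (w : List (Role NR × Set NC)) :
      IsPath T 𝒜 a ((r, t) :: w) → T.Arrow NI t s t' → (s ∈ T.fas → r ≠ s.inverse) →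
      IsPath T 𝒜 a ((s, t') :: (r, t) :: w)

/-- The paths for `𝒜` and `T`. -/
def Path (T : TBox NC NR) (𝒜 : ABox NC NR NI) : Type u :=
  {p : NI × List (Role NR × Set NC) // T.IsPath 𝒜 p.1 p.2}

/-- The extension of a concept name in the universal model. -/
def univConc (T : TBox NC NR) (𝒜 : ABox NC NR NI) (A : NC) (p : T.Path 𝒜) : Prop :=
  match p.1 with
  | (a, []) => T.EntailsConceptAt 𝒜 A a
  | (_, (_, t) :: _) => T.EntailsConcept NI t A

/-- The extension of a role name in the universal model. -/
def univRole (T : TBox NC NR) (𝒜 : ABox NC NR NI) (r : NR) (p q : T.Path 𝒜) : Prop :=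
  (∃ a b s, p.1 = (a, []) ∧ q.1 = (b, []) ∧ 𝒜.HasRole s a b ∧ T.EntailsRI NI s (.name r)) ∨
  (∃ s t, q.1 = (p.1.1, (s, t) :: p.1.2) ∧ T.EntailsRI NI s (.name r)) ∨
  (∃ s t, p.1 = (q.1.1, (s, t) :: q.1.2) ∧ T.EntailsRI NI s.inverse (.name r))

open Classical in
/-- The universal model of `T` and `𝒜`. -/
noncomputable def universalModel (T : TBox NC NR) (𝒜 : ABox NC NR NI) (h : 𝒜.ind.Nonempty) :
    Interp NC NR NI where
  Dom := T.Path 𝒜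
  dom_nonempty := ⟨⟨(h.some, []), IsPath.root _ h.some_mem⟩⟩
  conc A := {p | T.univConc 𝒜 A p}
  role := T.univRole 𝒜
  name a := if ha : a ∈ 𝒜.ind then some ⟨(a, []), IsPath.root a ha⟩ else none
  name_inj := by
    intro a b d ha hb
    split_ifs at ha hb
    have h1 := congrArg (fun p : T.Path 𝒜 => p.1.1) (Option.some.inj ha)
    have h2 := congrArg (fun p : T.Path 𝒜 => p.1.1) (Option.some.inj hb)
    exact h1.trans h2.symm

end TBox

end HornALCHIF

/-! Tree-shaped queries with one answer variable and ELI concepts have the same expressive power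
(`ELI.exists_query`, `CQ.IsOneTCQ.exists_concept`), and ELI concepts are preserved by simulations.
The theorem is therefore about ELI concepts at individuals.

From (a) to (b): the universal model has a simulation in every model of `T₂` and `𝒜`
(`TBox.isSimulation_realizes`), so the ELI concepts true at one of its individuals are certain, and
(a) makes those over `SQ` true in `I₁`. Relate `d` to `e` if `e` satisfies every `SQ`-concept of
`d`. As in the Hennessy–Milner theorem, finite branching makes this a simulation
(`Interp.isSimulation_of_finitelyBranching`).

From (b) to (a): let `T₂` and `𝒜` entail `C` at `a`, and let `I` be a model of `T₁` and `𝒜`. Unravel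
`𝒜` into the tree-shaped ABox of its non-backtracking walks from `a` of length at most `N`, and `I`
into a weakly tree-shaped, finitely branching model of `T₁` and this ABox with a homomorphism to `I`
(`exists_unravelling`). If the unravelled ABox still entails `C` at its root under `T₂`, then `C`
holds at the root of its universal model, which is a model (`TBox.modelsT_universalModel`); the
simulation from (b) and the homomorphism carry `C` to `a` in `I`.

That a finite depth `N` suffices (`TBox.EntailsELIAt.exists_unravel`) rests on a Horn argument. Call
a concept good for `b` if sufficiently deep unravellings entail it at all copies of `b`. Good
concepts are closed under finite local entailment and along role assertions, and any closed
assignment contains all entailed concepts (`TBox.mem_of_entailsELIAt`): products of countermodels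
give each individual an element with exactly its good concepts, up to a finite set of relevant ones,
and these elements are glued along the ABox.

Gluing and unravelling are instances of one construction, `ForestData`: roots joined by given edges,
each the origin of non-backtracking walks in a base model. It preserves functionality because
functional roles have no subroles. -/

namespace HornALCHIF

variable {NC NR NI : Type u}

/-! ### Trees given by a parent function -/

/-- Induction on the rank connects every vertex to the root. Every edge is a bridge: once the edge
from `v` to its parent is deleted, no walk leaves the descendants of `v`, and the parent, having
smaller rank, is not one of them. -/
theorem isTree_of_parent {V : Type*} (G : SimpleGraph V) (root : V) (par : V → V) (rank : V → ℕ)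
    (hrank : ∀ v, v ≠ root → rank (par v) < rank v)
    (hadj : ∀ u v, G.Adj u v ↔ (u ≠ root ∧ v = par u) ∨ (v ≠ root ∧ u = par v)) :
    G.IsTree := by
  have hreach : ∀ n v, rank v = n → G.Reachable v root := by
    intro n
    induction n using Nat.strong_induction_on with
    | _ n ih =>
      intro v hv
      by_cases h : v = root
      · rw [h]
      · exact (SimpleGraph.Adj.reachable ((hadj v (par v)).2 (Or.inl ⟨h, rfl⟩))).trans
          (ih _ (hv ▸ hrank v h) _ rfl)
  have hbridge : ∀ v, v ≠ root → G.IsBridge s(v, par v) := by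
    intro v hv
    let Desc : V → Prop := fun w =>
      Relation.ReflTransGen (fun a b => a ≠ root ∧ b = par a) w v
    have hle : ∀ w, Desc w → rank v ≤ rank w := by
      intro w hw
      refine Relation.ReflTransGen.head_induction_on hw le_rfl ?_
      rintro a b ⟨ha, rfl⟩ - h
      exact h.trans (hrank a ha).le
    rw [SimpleGraph.isBridge_iff]
    rintro ⟨p⟩
    have hwalk : ∀ {a b : V}, (G.deleteEdges {s(v, par v)}).Walk a b → Desc a → Desc b := by
      intro a b p
      induction p with
      | nil => exact id
      | @cons a c b hac p ih =>
        intro ha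
        apply ih
        rw [SimpleGraph.deleteEdges_adj, hadj] at hac
        obtain ⟨⟨har, rfl⟩ | ⟨hcr, rfl⟩, hne⟩ := hac
        · rcases Relation.ReflTransGen.cases_head ha with rfl | ⟨c, ⟨-, rfl⟩, hc⟩
          · exact absurd rfl hne
          · exact hc
        · exact Relation.ReflTransGen.head ⟨hcr, rfl⟩ ha
    have := hle _ (hwalk p Relation.ReflTransGen.refl)
    exact absurd this (not_le.2 (hrank v hv))
  have : Nonempty V := ⟨root⟩
  refine ⟨⟨fun u v => (hreach _ u rfl).trans (hreach _ v rfl).symm⟩, ?_⟩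
  rw [SimpleGraph.isAcyclic_iff_forall_adj_isBridge]
  intro u v huv
  rcases (hadj u v).1 huv with ⟨h, rfl⟩ | ⟨h, rfl⟩
  · exact hbridge u h
  · rw [Sym2.eq_swap]
    exact hbridge v h

/-! ### Roles -/

@[simp] theorem Role.inverse_inverse (r : Role NR) : r.inverse.inverse = r := by
  cases r <;> rfl

instance [Countable NR] : Countable (Role NR) := by
  let f : Role NR → NR ⊕ NR := fun r => match r with
    | .name r => .inl r
    | .inv r => .inr r
  have hf : Function.Injective f := by
    intro r s h
    cases r <;> cases s <;> simp_all [f]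
  exact hf.countable

@[simp] theorem Interp.rel_inverse (I : Interp NC NR NI) (r : Role NR) (d e : I.Dom) :
    I.rel r.inverse d e ↔ I.rel r e d := by
  cases r <;> rfl

@[simp] theorem ABox.hasRole_inverse (𝒜 : ABox NC NR NI) (r : Role NR) (a b : NI) :
    𝒜.HasRole r.inverse a b ↔ 𝒜.HasRole r b a := by
  cases r <;> rfl

theorem ABox.HasRole.left_mem_ind {𝒜 : ABox NC NR NI} {r : Role NR} {a b : NI}
    (h : 𝒜.HasRole r a b) : a ∈ 𝒜.ind := by
  cases r with
  | name r => exact Or.inr ⟨r, b, Or.inl h⟩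
  | inv r => exact Or.inr ⟨r, b, Or.inr h⟩

theorem ABox.HasRole.right_mem_ind {𝒜 : ABox NC NR NI} {r : Role NR} {a b : NI}
    (h : 𝒜.HasRole r a b) : b ∈ 𝒜.ind :=
  ((𝒜.hasRole_inverse r b a).2 h).left_mem_ind

theorem ABox.exists_hasRole {𝒜 : ABox NC NR NI} {a : NI} (ha : a ∈ 𝒜.ind) :
    (∃ A, (A, a) ∈ 𝒜.concepts) ∨ ∃ r b, 𝒜.HasRole r a b := by
  rcases ha with h | ⟨r, b, h | h⟩
  · exact Or.inl h
  · exact Or.inr ⟨.name r, b, h⟩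
  · exact Or.inr ⟨.inv r, b, h⟩

theorem ABox.finite_hasRole (𝒜 : ABox NC NR NI) :
    {p : Role NR × NI × NI | 𝒜.HasRole p.1 p.2.1 p.2.2}.Finite := by
  refine ((𝒜.roles.finite_toSet.image fun p => (Role.name p.1, p.2.1, p.2.2)).union
    (𝒜.roles.finite_toSet.image fun p => (Role.inv p.1, p.2.2, p.2.1))).subset ?_
  rintro ⟨r | r, a, b⟩ h
  · exact Or.inl ⟨(r, a, b), h, rfl⟩
  · exact Or.inr ⟨(r, b, a), h, rfl⟩

theorem Interp.ModelsA.rel_of_hasRole {I : Interp NC NR NI} {𝒜 : ABox NC NR NI}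
    (hI : I.ModelsA 𝒜) {r : Role NR} {a b : NI} (h : 𝒜.HasRole r a b) :
    ∃ d e, I.name a = some d ∧ I.name b = some e ∧ I.rel r d e := by
  cases r with
  | name r => exact hI.2 r a b h
  | inv r =>
    obtain ⟨d, e, hd, he, h⟩ := hI.2 r b a h
    exact ⟨e, d, he, hd, h⟩

theorem Interp.ModelsA.name_of_mem_ind {I : Interp NC NR NI} {𝒜 : ABox NC NR NI}
    (hI : I.ModelsA 𝒜) {a : NI} (ha : a ∈ 𝒜.ind) : ∃ d, I.name a = some d := by
  rcases ABox.exists_hasRole ha with ⟨A, h⟩ | ⟨r, b, h⟩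
  · obtain ⟨d, hd, -⟩ := hI.1 A a h
    exact ⟨d, hd⟩
  · obtain ⟨d, -, hd, -⟩ := hI.rel_of_hasRole h
    exact ⟨d, hd⟩

theorem Interp.ModelsA.exists_naming {I : Interp NC NR NI} {𝒜 : ABox NC NR NI}
    (hI : I.ModelsA 𝒜) : ∃ g : NI → I.Dom, (∀ a ∈ 𝒜.ind, I.name a = some (g a)) ∧
      (∀ A a, (A, a) ∈ 𝒜.concepts → g a ∈ I.conc A) ∧
      (∀ r a b, 𝒜.HasRole r a b → I.rel r (g a) (g b)) ∧ Set.InjOn g 𝒜.ind := by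
  have := I.dom_nonempty
  choose! g hg using fun a (ha : a ∈ 𝒜.ind) => hI.name_of_mem_ind ha
  refine ⟨g, hg, fun A a h => ?_, fun r a b h => ?_, fun a ha b hb h => ?_⟩
  · obtain ⟨d, hd, hA⟩ := hI.1 A a h
    rw [hg a (Or.inl ⟨A, h⟩)] at hd
    rwa [Option.some.inj hd]
  · obtain ⟨d, e, hd, he, hde⟩ := hI.rel_of_hasRole h
    rw [hg a h.left_mem_ind] at hd
    rw [hg b h.right_mem_ind] at he
    rwa [Option.some.inj hd, Option.some.inj he]
  · exact I.name_inj _ _ _ (hg a ha) (h ▸ hg b hb)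

/-! ### ELI concepts -/

/-- ELI concepts: the concept counterparts of tree-shaped queries with one answer variable. -/
inductive ELI (NC NR : Type u) : Type u where
  | top : ELI NC NR
  | atom (A : NC) : ELI NC NR
  | conj (C D : ELI NC NR) : ELI NC NR
  | ex (r : Role NR) (C : ELI NC NR) : ELI NC NR

namespace ELI

/-- The extension of an ELI concept. -/
def ext (I : Interp NC NR NI) : ELI NC NR → Set I.Dom
  | top => Set.univ
  | atom A => I.conc A
  | conj C D => C.ext I ∩ D.ext I
  | ex r C => {d | ∃ e, I.rel r d e ∧ e ∈ C.ext I}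

/-- The concept uses only symbols from the signature. -/
def Over (Sg : Sig NC NR) : ELI NC NR → Prop
  | top => True
  | atom A => A ∈ Sg.concepts
  | conj C D => C.Over Sg ∧ D.Over Sg
  | ex r C => r.baseName ∈ Sg.roles ∧ C.Over Sg

/-- The subconcepts of an ELI concept. -/
def sub : ELI NC NR → Set (ELI NC NR)
  | top => {top}
  | atom A => {atom A}
  | conj C D => insert (conj C D) (C.sub ∪ D.sub)
  | ex r C => insert (ex r C) C.sub

theorem finite_sub (C : ELI NC NR) : C.sub.Finite := by
  induction C with
  | top => exact Set.finite_singleton _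
  | atom A => exact Set.finite_singleton _
  | conj C D hC hD => exact (hC.union hD).insert _
  | ex r C hC => exact hC.insert _

theorem mem_sub_self (C : ELI NC NR) : C ∈ C.sub := by
  cases C <;> simp [sub]

/-- The conjunction of a list of ELI concepts. -/
def bigConj : List (ELI NC NR) → ELI NC NR
  | [] => top
  | C :: l => conj C (bigConj l)

theorem mem_ext_bigConj {I : Interp NC NR NI} {l : List (ELI NC NR)} {d : I.Dom} :
    d ∈ (bigConj l).ext I ↔ ∀ C ∈ l, d ∈ C.ext I := by
  induction l with
  | nil => simp [bigConj, ext]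
  | cons C l ih => simp [bigConj, ext, ih]

theorem over_bigConj {Sg : Sig NC NR} {l : List (ELI NC NR)} (h : ∀ C ∈ l, C.Over Sg) :
    (bigConj l).Over Sg := by
  induction l with
  | nil => trivial
  | cons C l ih =>
    exact ⟨h C (by simp), ih fun D hD => h D (by simp [hD])⟩

theorem mem_ext_of_simulation {Sg : Sig NC NR} {I J : Interp NC NR NI}
    {σ : I.Dom → J.Dom → Prop} (hσ : Interp.IsSimulation Sg I J σ) {C : ELI NC NR}
    (hC : C.Over Sg) {d : I.Dom} {e : J.Dom} (hde : σ d e) (hd : d ∈ C.ext I) : e ∈ C.ext J := by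
  induction C generalizing d e with
  | top => trivial
  | atom A => exact hσ.2.1 A hC d e hd hde
  | conj C D ihC ihD => exact ⟨ihC hC.1 hde hd.1, ihD hC.2 hde hd.2⟩
  | ex r C ih =>
    obtain ⟨d', hr, hd'⟩ := hd
    obtain ⟨e', hr', he'⟩ := hσ.2.2 r hC.1 d d' e hr hde
    exact ⟨e', hr', ih hC.2 he' hd'⟩

theorem mem_ext_of_hom {I J : Interp NC NR NI} (f : I.Dom → J.Dom)
    (hc : ∀ A d, d ∈ I.conc A → f d ∈ J.conc A)
    (hr : ∀ r d e, I.rel r d e → J.rel r (f d) (f e)) {C : ELI NC NR} {d : I.Dom}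
    (hd : d ∈ C.ext I) : f d ∈ C.ext J := by
  induction C generalizing d with
  | top => trivial
  | atom A => exact hc A d hd
  | conj C D ihC ihD => exact ⟨ihC hd.1, ihD hd.2⟩
  | ex r C ih =>
    obtain ⟨e, h, he⟩ := hd
    exact ⟨f e, hr r d e h, ih he⟩

end ELI

/-- Elements of a finitely branching interpretation that satisfy all ELI concepts of the elements
of another one give a simulation. -/
theorem Interp.isSimulation_of_finitelyBranching {Sg : Sig NC NR} {I J : Interp NC NR NI}
    (hJ : J.FinitelyBranching)
    (hname : ∀ a d, I.name a = some d → ∃ e, J.name a = some e ∧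
      ∀ C : ELI NC NR, C.Over Sg → d ∈ C.ext I → e ∈ C.ext J) :
    Interp.IsSimulation Sg I J
      (fun d e => ∀ C : ELI NC NR, C.Over Sg → d ∈ C.ext I → e ∈ C.ext J) := by
  refine ⟨hname, fun A hA d e hd hde => hde (.atom A) hA hd, ?_⟩
  intro r hr d d' e hdd' hde
  by_contra! hcon
  have hfin : {e' | J.rel r e e'}.Finite := by
    refine (hJ e).subset ?_
    intro e' he'
    cases r with
    | name r => exact ⟨r, Or.inl he'⟩
    | inv r => exact ⟨r, Or.inr he'⟩
  -- A concept refuting each successor of `e`; at other elements `top` is only a default.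
  have hcon' : ∀ e', ∃ C : ELI NC NR, J.rel r e e' → C.Over Sg ∧ d' ∈ C.ext I ∧ e' ∉ C.ext J := by
    intro e'
    by_cases h : J.rel r e e'
    · obtain ⟨C, hC⟩ := hcon e' h
      exact ⟨C, fun _ => hC⟩
    · exact ⟨.top, fun h' => absurd h' h⟩
  choose C hC using hcon'
  -- The finitely many refuting concepts fit into one conjunction. Its existential restriction holds
  -- at `d`, hence at `e`, and the successor of `e` it provides contradicts its own refuting
  -- concept.
  let l := hfin.toFinset.toList.map C
  have hl : ∀ D, D ∈ l ↔ ∃ e', J.rel r e e' ∧ C e' = D := by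
    intro D
    simp [l]
  have hov : (ELI.ex r (ELI.bigConj l)).Over Sg := by
    refine ⟨hr, ELI.over_bigConj fun D hD => ?_⟩
    obtain ⟨e', h, rfl⟩ := (hl D).1 hD
    exact (hC e' h).1
  obtain ⟨e', hre, hmem⟩ := hde _ hov ⟨d', hdd', ELI.mem_ext_bigConj.2 fun D hD => by
    obtain ⟨e', h, rfl⟩ := (hl D).1 hD
    exact (hC e' h).2.1⟩
  exact (hC e' hre).2.2 (ELI.mem_ext_bigConj.1 hmem _ ((hl _).2 ⟨e', hre, rfl⟩))

/-! ### Syntactic role inclusions -/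

/-- The role inclusions that follow from those in the TBox by reflexivity, transitivity and
inversion. -/
inductive TBox.Sub (T : TBox NC NR) (r : Role NR) : Role NR → Prop where
  | refl : T.Sub r r
  | step {s s' : Role NR} : T.Sub r s → (s, s') ∈ T.ris → T.Sub r s'
  | stepInv {s s' : Role NR} : T.Sub r s.inverse → (s, s') ∈ T.ris → T.Sub r s'.inverse

namespace TBox.Sub

variable {T : TBox NC NR} {r s : Role NR}

theorem satRI (h : T.Sub r s) {I : Interp NC NR NI} (hI : I.ModelsT T) : I.SatRI r s := by
  induction h with
  | refl => exact fun d e h => h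
  | step _ hs ih => exact fun d e h => hI.2.1 _ hs d e (ih d e h)
  | stepInv _ hs ih =>
    intro d e h
    have := ih d e h
    rw [Interp.rel_inverse] at this ⊢
    exact hI.2.1 _ hs e d this

theorem inverse (h : T.Sub r s) : T.Sub r.inverse s.inverse := by
  induction h with
  | refl => exact .refl
  | step _ hs ih => exact .stepInv ih hs
  | stepInv _ hs ih =>
    rw [Role.inverse_inverse] at ih ⊢
    exact .step ih hs

/-- The last inclusion of a nontrivial derivation would give the functional role, or its inverse, a
subrole. -/
theorem eq_of_mem_fas (hT : T.FunctionalNoSubroles) (h : T.Sub r s) (hs : s ∈ T.fas) :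
    r = s := by
  cases h with
  | refl => rfl
  | step _ h => exact absurd hs (hT _ _ h).1
  | stepInv _ h => exact absurd hs (hT _ _ h).2

end TBox.Sub

/-! ### Forests of walks -/

/-- The last element of a walk that starts at `d`; walks list the last step first. -/
def endpt {R D : Type*} (d : D) : List (R × D) → D
  | [] => d
  | (_, e) :: _ => e

/-- The step `(s, f)` may extend a walk: it does not go back along the last step, and a first step
uses no blocked role. -/
def StepOk {D : Type*} (blocked : Role NR → Prop) (d : D) :
    List (Role NR × D) → Role NR → D → Prop
  | [] => fun s _ => ¬ blocked s
  | (r, _) :: w => fun s f => (s, f) ≠ (r.inverse, endpt d w)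

/-- Non-backtracking walks along the given steps. -/
inductive Walk {D : Type*} (step : D → Role NR → D → Prop) (blocked : Role NR → Prop) (d : D) :
    List (Role NR × D) → Prop
  | nil : Walk step blocked d []
  | cons {w : List (Role NR × D)} {s : Role NR} {f : D} : Walk step blocked d w →
      step (endpt d w) s f → StepOk blocked d w s f → Walk step blocked d ((s, f) :: w)

section Walk

variable {D : Type*} {step : D → Role NR → D → Prop} {blocked : Role NR → Prop} {d : D}

theorem Walk.cons_iff {w : List (Role NR × D)} {s : Role NR} {f : D} :
    Walk step blocked d ((s, f) :: w) ↔
      Walk step blocked d w ∧ step (endpt d w) s f ∧ StepOk blocked d w s f :=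
  ⟨fun h => by cases h with | cons h₁ h₂ h₃ => exact ⟨h₁, h₂, h₃⟩, fun h => .cons h.1 h.2.1 h.2.2⟩

end Walk

/-- Data for a forest model of a TBox: roots related by edges, each of them the origin of walks in
a model of the TBox. -/
structure ForestData (T : TBox NC NR) (NI : Type u) where
  Root : Type u
  edge : Role NR → Root → Root → Prop
  base : Interp NC NR NI
  pos : Root → base.Dom
  step : base.Dom → Role NR → base.Dom → Prop
  nonempty : Nonempty Root
  edge_inverse : ∀ r x y, edge r.inverse x y ↔ edge r y x
  edge_all : ∀ r s x y A B, edge r x y → T.Sub r s → CI.all A s B ∈ T.cis →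
    pos x ∈ base.conc A → pos y ∈ base.conc B
  edge_ex : ∀ r x y A B, edge r x y → r ∈ T.fas → CI.ex A r B ∈ T.cis →
    pos x ∈ base.conc A → pos y ∈ base.conc B
  edge_func : ∀ r x y y', r ∈ T.fas → edge r x y → edge r x y' → y = y'
  base_models : base.ModelsT T
  rel_of_step : ∀ d r e, step d r e → base.rel r d e
  step_ex : ∀ A r B d, CI.ex A r B ∈ T.cis → d ∈ base.conc A →
    ∃ e, step d r e ∧ e ∈ base.conc B

namespace ForestData

variable {T : TBox NC NR} (F : ForestData T NI)

/-- The roles that may not start a walk at a root. -/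
def blocked (x : F.Root) (r : Role NR) : Prop := r ∈ T.fas ∧ ∃ y, F.edge r x y

/-- The nodes of the forest. -/
def Node : Type u :=
  {p : F.Root × List (Role NR × F.base.Dom) // Walk F.step (F.blocked p.1) (F.pos p.1) p.2}

variable {F}

/-- A root as a node. -/
def root (x : F.Root) : F.Node := ⟨(x, []), .nil⟩

/-- The element of the base model at a node. -/
def elt (p : F.Node) : F.base.Dom := endpt (F.pos p.1.1) p.1.2

/-- The role edges of the forest. -/
def edgeRel (r : Role NR) (p q : F.Node) : Prop :=
  (∃ x y s, p = root x ∧ q = root y ∧ F.edge s x y ∧ T.Sub s r) ∨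
  (∃ s e, q.1 = (p.1.1, (s, e) :: p.1.2) ∧ T.Sub s r) ∨
  (∃ s e, p.1 = (q.1.1, (s, e) :: q.1.2) ∧ T.Sub s.inverse r)

theorem edgeRel_inverse_of {r : Role NR} {p q : F.Node} (h : edgeRel r p q) :
    edgeRel r.inverse q p := by
  rcases h with ⟨x, y, s, hp, hq, he, hs⟩ | ⟨s, e, h, hs⟩ | ⟨s, e, h, hs⟩
  · exact Or.inl ⟨y, x, s.inverse, hq, hp, (F.edge_inverse _ _ _).2 he, hs.inverse⟩
  · exact Or.inr (Or.inr ⟨s, e, h, hs.inverse⟩)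
  · exact Or.inr (Or.inl ⟨s, e, h, by simpa using hs.inverse⟩)

variable (F) in
/-- The forest, with the given names. -/
def interp (nm : NI → Option F.Node)
    (hnm : ∀ a b p, nm a = some p → nm b = some p → a = b) : Interp NC NR NI where
  Dom := F.Node
  dom_nonempty := F.nonempty.map root
  conc A := {p | elt p ∈ F.base.conc A}
  role r := edgeRel (.name r)
  name := nm
  name_inj := hnm

variable {nm : NI → Option F.Node} {hnm : ∀ a b p, nm a = some p → nm b = some p → a = b}

theorem rel_interp {r : Role NR} {p q : F.Node} :
    (F.interp nm hnm).rel r p q ↔ edgeRel r p q := by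
  cases r with
  | name r => exact Iff.rfl
  | inv r => exact ⟨edgeRel_inverse_of (r := .name r), edgeRel_inverse_of (r := .inv r)⟩

theorem base_rel_of_cons {p q : F.Node} {s : Role NR} {e : F.base.Dom}
    (h : q.1 = (p.1.1, (s, e) :: p.1.2)) : F.base.rel s (elt p) (elt q) ∧ elt q = e := by
  obtain ⟨⟨x, w⟩, hw⟩ := p
  obtain ⟨q, hq⟩ := q
  dsimp only at h
  subst h
  exact ⟨F.rel_of_step _ _ _ (Walk.cons_iff.1 hq).2.1, rfl⟩

/-- Apart from root edges, `elt` is a homomorphism to the base, as walk steps are base edges and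
`T.Sub` is sound. Root edges need not come from the base: in the proof of `TBox.mem_of_entailsELIAt`
the roots lie in different summands. -/
theorem rel_base_of_edgeRel {r : Role NR} {p q : F.Node} (h : edgeRel r p q) :
    (∃ x y s, p = root x ∧ q = root y ∧ F.edge s x y ∧ T.Sub s r) ∨
      F.base.rel r (elt p) (elt q) := by
  rcases h with h | ⟨s, e, h, hs⟩ | ⟨s, e, h, hs⟩
  · exact Or.inl h
  · exact Or.inr (hs.satRI F.base_models _ _ (base_rel_of_cons h).1)
  · refine Or.inr (hs.satRI F.base_models _ _ ?_)
    rw [Interp.rel_inverse]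
    exact (base_rel_of_cons h).1

/-- When the base witness cannot extend the walk, another node replaces it. A backtracking step
leads to the preceding node, which lies at the same base element; a blocked functional role leads to
an adjacent root, where `edge_ex` provides `B`. -/
theorem exists_edgeRel {A : NC} {r : Role NR} {B : NC} (h : CI.ex A r B ∈ T.cis) {p : F.Node}
    (hp : elt p ∈ F.base.conc A) : ∃ q : F.Node, edgeRel r p q ∧ elt q ∈ F.base.conc B := by
  obtain ⟨e, hst, he⟩ := F.step_ex A r B _ h hp
  obtain ⟨⟨x, w⟩, hw⟩ := p
  by_cases hok : StepOk (F.blocked x) (F.pos x) w r e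
  · exact ⟨⟨(x, (r, e) :: w), .cons hw hst hok⟩, Or.inr (Or.inl ⟨r, e, rfl, .refl⟩), he⟩
  · cases w with
    | nil =>
      obtain ⟨hr, y, hy⟩ := not_not.1 hok
      exact ⟨root y, Or.inl ⟨x, y, r, rfl, rfl, hy, .refl⟩, F.edge_ex r x y A B hy hr h hp⟩
    | cons a w =>
      obtain ⟨s, d⟩ := a
      have heq : (r, e) = (s.inverse, endpt (F.pos x) w) := not_not.1 hok
      rw [Prod.mk.injEq] at heq
      obtain ⟨rfl, rfl⟩ := heq
      exact ⟨⟨(x, w), (Walk.cons_iff.1 hw).1⟩, Or.inr (Or.inr ⟨s, d, rfl, .refl⟩), he⟩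

theorem edgeRel_of_mem_fas (hT : T.FunctionalNoSubroles) {r : Role NR} (hr : r ∈ T.fas)
    {p q : F.Node} (h : edgeRel r p q) :
    (∃ x y, p = root x ∧ q = root y ∧ F.edge r x y) ∨
    (∃ e, q.1 = (p.1.1, (r, e) :: p.1.2)) ∨ (∃ e, p.1 = (q.1.1, (r.inverse, e) :: q.1.2)) := by
  rcases h with ⟨x, y, s, hp, hq, he, hs⟩ | ⟨s, e, h, hs⟩ | ⟨s, e, h, hs⟩
  · obtain rfl := hs.eq_of_mem_fas hT hr
    exact Or.inl ⟨x, y, hp, hq, he⟩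
  · obtain rfl := hs.eq_of_mem_fas hT hr
    exact Or.inr (Or.inl ⟨e, h⟩)
  · obtain rfl := hs.eq_of_mem_fas hT hr
    exact Or.inr (Or.inr ⟨e, by simpa using h⟩)

theorem not_cons_of_edge {r : Role NR} (hr : r ∈ T.fas) {x y : F.Root} {q : F.Node}
    (he : F.edge r x y) {e : F.base.Dom} (h : q.1 = (x, [(r, e)])) : False := by
  obtain ⟨q, hq⟩ := q
  dsimp only at h
  subst h
  exact (Walk.cons_iff.1 hq).2.2 ⟨hr, y, he⟩

/-- Functionality in the base makes the new step end at the element of the node before the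
`r⁻`-step, so it would be backtracking. -/
theorem not_cons_of_cons_inverse {r : Role NR} (hr : r ∈ T.fas) {p q q' : F.Node}
    {e e' : F.base.Dom} (h : p.1 = (q.1.1, (r.inverse, e) :: q.1.2))
    (h' : q'.1 = (p.1.1, (r, e') :: p.1.2)) : False := by
  have h₁ := (base_rel_of_cons h).1
  obtain ⟨h₂, h₃⟩ := base_rel_of_cons h'
  rw [Interp.rel_inverse] at h₁
  have heq := F.base_models.2.2 r hr _ _ _ h₁ h₂
  obtain ⟨p, hp⟩ := p
  obtain ⟨⟨y, v⟩, hv⟩ := q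
  obtain ⟨q', hq'⟩ := q'
  dsimp only at h h'
  subst h h'
  refine (Walk.cons_iff.1 hq').2.2 ?_
  rw [Role.inverse_inverse]
  exact Prod.ext rfl (h₃.symm.trans heq.symm)

/-- Without subroles, an edge for `r` is a root edge, a step labelled `r`, or a step labelled `r⁻`
read backwards. Two forward steps reach the same base element, hence the same node; two backward
ones remove the same last step. Blocking, non-backtracking and the emptiness of walks at roots
exclude the mixed cases. -/
theorem edgeRel_func (hT : T.FunctionalNoSubroles) {r : Role NR} (hr : r ∈ T.fas)
    {p q q' : F.Node} (h : edgeRel r p q) (h' : edgeRel r p q') : q = q' := by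
  rcases edgeRel_of_mem_fas hT hr h with ⟨x, y, rfl, rfl, he⟩ | ⟨e, h⟩ | ⟨e, h⟩ <;>
  rcases edgeRel_of_mem_fas hT hr h' with ⟨x', y', hx, rfl, he'⟩ | ⟨e', h'⟩ | ⟨e', h'⟩
  · obtain rfl : x = x' := congrArg (fun p : F.Node => p.1.1) hx
    rw [F.edge_func r x y y' hr he he']
  · exact (not_cons_of_edge hr he h').elim
  · exact absurd (congrArg Prod.snd h') (by simp [root])
  · subst hx
    exact (not_cons_of_edge hr he' h).elim
  · have h₁ := base_rel_of_cons h
    have h₂ := base_rel_of_cons h'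
    obtain rfl : e = e' := by
      rw [← h₁.2, ← h₂.2]
      exact F.base_models.2.2 r hr _ _ _ h₁.1 h₂.1
    exact Subtype.ext (h.trans h'.symm)
  · exact (not_cons_of_cons_inverse hr h' h).elim
  · subst hx
    exact absurd (congrArg Prod.snd h) (by simp [root])
  · exact (not_cons_of_cons_inverse hr h h').elim
  · have := h.symm.trans h'
    simp only [Prod.mk.injEq, List.cons.injEq] at this
    exact Subtype.ext (Prod.ext this.1 this.2.2)

theorem modelsT_interp (hT : T.FunctionalNoSubroles) : (F.interp nm hnm).ModelsT T := by
  refine ⟨?_, ?_, ?_⟩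
  · intro c hc
    have hb := F.base_models.1 c hc
    cases c with
    | top A => exact fun p => hb _
    | bot A => exact fun p => hb _
    | conj A₁ A₂ B => exact fun p => hb _
    | ex A r B =>
      intro p hp
      obtain ⟨q, hq, hB⟩ := exists_edgeRel hc hp
      exact ⟨q, rel_interp.2 hq, hB⟩
    | all A r B =>
      intro p hp q hq
      rcases rel_base_of_edgeRel (rel_interp.1 hq) with ⟨x, y, s, rfl, rfl, he, hs⟩ | h
      · exact F.edge_all s r x y A B he hs hc hp
      · exact hb _ hp _ h
  · rintro ⟨r, s⟩ hrs p q h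
    refine rel_interp.2 ?_
    rcases rel_interp.1 h with ⟨x, y, s, hp, hq, he, hs⟩ | ⟨s, e, h, hs⟩ | ⟨s, e, h, hs⟩
    · exact Or.inl ⟨x, y, s, hp, hq, he, .step hs hrs⟩
    · exact Or.inr (Or.inl ⟨s, e, h, .step hs hrs⟩)
    · exact Or.inr (Or.inr ⟨s, e, h, .step hs hrs⟩)
  · intro r hr p q q' h h'
    exact edgeRel_func hT hr (rel_interp.1 h) (rel_interp.1 h')

/-! #### Forests with a single root and no edges between roots -/

/-- The node before the last step. -/
def parent (p : F.Node) : F.Node :=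
  ⟨(p.1.1, p.1.2.tail), by
    obtain ⟨⟨x, _ | ⟨⟨s, e⟩, w⟩⟩, hw⟩ := p
    · exact .nil
    · exact (Walk.cons_iff.1 hw).1⟩

theorem eq_parent_of_cons {p q : F.Node} {a : Role NR × F.base.Dom}
    (h : q.1 = (p.1.1, a :: p.1.2)) : p = parent q := by
  refine Subtype.ext ?_
  simp [parent, h]

theorem exists_role_of_cons {p q : F.Node} {s : Role NR} {e : F.base.Dom}
    (h : q.1 = (p.1.1, (s, e) :: p.1.2)) :
    ∃ r, edgeRel (.name r) p q ∨ edgeRel (.name r) q p := by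
  have : edgeRel s p q := Or.inr (Or.inl ⟨s, e, h, .refl⟩)
  cases s with
  | name r => exact ⟨r, Or.inl this⟩
  | inv r => exact ⟨r, Or.inr (edgeRel_inverse_of this)⟩

theorem weaklyTreeShaped_interp (hedge : ∀ r x y, ¬ F.edge r x y) (x : F.Root)
    (hx : ∀ y, y = x) : (F.interp nm hnm).WeaklyTreeShaped := by
  have hcases : ∀ (r : Role NR) (p q : F.Node), edgeRel r p q →
      (∃ a, q.1 = (p.1.1, a :: p.1.2)) ∨ (∃ a, p.1 = (q.1.1, a :: q.1.2)) := by
    rintro r p q (⟨x, y, s, -, -, he, -⟩ | ⟨s, e, h, -⟩ | ⟨s, e, h, -⟩)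
    · exact (hedge _ _ _ he).elim
    · exact Or.inl ⟨_, h⟩
    · exact Or.inr ⟨_, h⟩
  have hloop : ∀ (p : F.Node) (a : Role NR × F.base.Dom), p.1 ≠ (p.1.1, a :: p.1.2) := by
    intro p a h
    simpa using congrArg (fun p : F.Root × List (Role NR × F.base.Dom) => p.2.length) h
  have hne : ∀ p : F.Node, p ≠ root x → ∃ a, p.1 = ((parent p).1.1, a :: (parent p).1.2) := by
    rintro ⟨⟨y, _ | ⟨a, w⟩⟩, hw⟩ hp
    · exact (hp (Subtype.ext (Prod.ext (hx y) rfl))).elim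
    · exact ⟨a, rfl⟩
  have hroot : ∀ (p q : F.Node) (a : Role NR × F.base.Dom), p.1 = (q.1.1, a :: q.1.2) →
      p ≠ root x := by
    rintro p q a h rfl
    exact absurd (congrArg Prod.snd h) (by simp [root])
  refine ⟨fun r p h => ?_, ?_⟩
  · rcases hcases (.name r) p p h with ⟨a, h⟩ | ⟨a, h⟩ <;> exact hloop p a h
  · refine isTree_of_parent (V := F.Node) _ (root x) parent (fun p => p.1.2.length) ?_ ?_
    · intro p hp
      obtain ⟨a, ha⟩ := hne p hp
      have := congrArg (fun p : F.Root × List (Role NR × F.base.Dom) => p.2.length) ha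
      simp only [List.length_cons] at this
      omega
    · intro p q
      have hadj : (F.interp nm hnm).graph.Adj p q ↔ p ≠ q ∧
          ((∃ r, edgeRel (.name r) p q) ∨ (∃ r, edgeRel (.name r) q p)) :=
        SimpleGraph.fromRel_adj _ _ _
      rw [hadj]
      constructor
      · rintro ⟨-, ⟨r, h⟩ | ⟨r, h⟩⟩
        · rcases hcases _ _ _ h with ⟨a, h⟩ | ⟨a, h⟩
          · exact Or.inr ⟨hroot _ _ _ h, eq_parent_of_cons h⟩
          · exact Or.inl ⟨hroot _ _ _ h, eq_parent_of_cons h⟩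
        · rcases hcases _ _ _ h with ⟨a, h⟩ | ⟨a, h⟩
          · exact Or.inl ⟨hroot _ _ _ h, eq_parent_of_cons h⟩
          · exact Or.inr ⟨hroot _ _ _ h, eq_parent_of_cons h⟩
      · rintro (⟨hp, rfl⟩ | ⟨hq, rfl⟩)
        · obtain ⟨a, ha⟩ := hne p hp
          obtain ⟨r, hr⟩ := exists_role_of_cons ha
          refine ⟨fun h => ?_, hr.elim (fun h => Or.inr ⟨r, h⟩) (fun h => Or.inl ⟨r, h⟩)⟩
          rw [← h] at ha
          exact hloop _ _ ha
        · obtain ⟨a, ha⟩ := hne q hq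
          obtain ⟨r, hr⟩ := exists_role_of_cons ha
          refine ⟨fun h => ?_, hr.elim (fun h => Or.inl ⟨r, h⟩) (fun h => Or.inr ⟨r, h⟩)⟩
          rw [h] at ha
          exact hloop _ _ ha

theorem finitelyBranching_interp (hedge : ∀ r x y, ¬ F.edge r x y)
    (hstep : ∀ d, {a : Role NR × F.base.Dom | F.step d a.1 a.2}.Finite) :
    (F.interp nm hnm).FinitelyBranching := by
  intro p
  have hcases : ∀ (r : Role NR) (q : F.Node), edgeRel r p q →
      (∃ a, F.step (elt p) a.1 a.2 ∧ q.1 = (p.1.1, a :: p.1.2)) ∨ q = parent p := by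
    rintro r q (⟨x, y, s, -, -, he, -⟩ | ⟨s, e, h, -⟩ | ⟨s, e, h, -⟩)
    · exact (hedge _ _ _ he).elim
    · refine Or.inl ⟨(s, e), ?_, h⟩
      obtain ⟨q, hq⟩ := q
      dsimp only at h
      subst h
      exact (Walk.cons_iff.1 hq).2.1
    · exact Or.inr (eq_parent_of_cons h)
  have hfin : (Subtype.val ⁻¹' ((fun a => (p.1.1, a :: p.1.2)) ''
      {a : Role NR × F.base.Dom | F.step (elt p) a.1 a.2}) : Set F.Node).Finite :=
    Set.Finite.preimage Subtype.val_injective.injOn ((hstep (elt p)).image _)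
  refine (hfin.insert (parent p)).subset ?_
  rintro q ⟨r, hq⟩
  have : (∃ a, F.step (elt p) a.1 a.2 ∧ q.1 = (p.1.1, a :: p.1.2)) ∨ q = parent p := by
    rcases hq with h | h
    · exact hcases (.name r) q h
    · exact hcases (.inv r) q (edgeRel_inverse_of h)
  rcases this with ⟨a, ha, h⟩ | h
  · exact Or.inr ⟨a, ha, h.symm⟩
  · exact Or.inl h

end ForestData

/-! ### Unravellings and ABox forests -/

/-- The unravelling of a model at an element, along given steps. -/
def ForestData.ofModel {T : TBox NC NR} {I : Interp NC NR NI} (hI : I.ModelsT T) (d : I.Dom)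
    (step : I.Dom → Role NR → I.Dom → Prop) (hrel : ∀ d r e, step d r e → I.rel r d e)
    (hex : ∀ A r B d, CI.ex A r B ∈ T.cis → d ∈ I.conc A → ∃ e, step d r e ∧ e ∈ I.conc B) :
    ForestData T NI where
  Root := PUnit
  edge _ _ _ := False
  base := I
  pos _ := d
  step := step
  nonempty := ⟨⟨⟩⟩
  edge_inverse _ _ _ := Iff.rfl
  edge_all _ _ _ _ _ _ h := h.elim
  edge_ex _ _ _ _ _ h := h.elim
  edge_func _ _ _ _ _ h := h.elim
  base_models := hI
  rel_of_step := hrel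
  step_ex := hex

open Classical in
/-- The individuals of an ABox as roots of a forest. -/
noncomputable def ForestData.rootName {T : TBox NC NR} (F : ForestData T NI) {𝒜 : ABox NC NR NI}
    (ρ : 𝒜.ind → F.Root) (a : NI) : Option F.Node :=
  if h : a ∈ 𝒜.ind then some (root (ρ ⟨a, h⟩)) else none

theorem ForestData.rootName_of_mem {T : TBox NC NR} (F : ForestData T NI) {𝒜 : ABox NC NR NI}
    (ρ : 𝒜.ind → F.Root) {a : NI} (h : a ∈ 𝒜.ind) :
    F.rootName ρ a = some (root (ρ ⟨a, h⟩)) :=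
  dif_pos h

theorem ForestData.rootName_inj {T : TBox NC NR} (F : ForestData T NI) {𝒜 : ABox NC NR NI}
    {ρ : 𝒜.ind → F.Root} (hρ : Function.Injective ρ) (a b : NI) (p : F.Node)
    (ha : F.rootName ρ a = some p) (hb : F.rootName ρ b = some p) : a = b := by
  unfold rootName at ha hb
  split_ifs at ha hb
  have h := (Option.some.inj ha).trans (Option.some.inj hb).symm
  exact congrArg Subtype.val (hρ (congrArg (fun p : F.Node => p.1.1) h))

theorem ForestData.modelsA_rootName {T : TBox NC NR} (F : ForestData T NI) {𝒜 : ABox NC NR NI}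
    {ρ : 𝒜.ind → F.Root} (hρ : Function.Injective ρ)
    (hc : ∀ A (a : 𝒜.ind), (A, (a : NI)) ∈ 𝒜.concepts → F.pos (ρ a) ∈ F.base.conc A)
    (hr : ∀ r (a b : 𝒜.ind), 𝒜.HasRole r a b → F.edge r (ρ a) (ρ b)) :
    (F.interp (F.rootName ρ) (F.rootName_inj hρ)).ModelsA 𝒜 := by
  refine ⟨fun A a h => ?_, fun r a b h => ?_⟩
  · have ha : a ∈ 𝒜.ind := Or.inl ⟨A, h⟩
    exact ⟨_, F.rootName_of_mem ρ ha, hc A ⟨a, ha⟩ h⟩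
  · have hab : 𝒜.HasRole (.name r) a b := h
    exact ⟨_, _, F.rootName_of_mem ρ hab.left_mem_ind, F.rootName_of_mem ρ hab.right_mem_ind,
      Or.inl ⟨_, _, _, rfl, rfl,
        hr (.name r) ⟨a, hab.left_mem_ind⟩ ⟨b, hab.right_mem_ind⟩ hab, .refl⟩⟩

/-- The forest of unravellings of a common model of a TBox and an ABox at the individuals. -/
def ForestData.ofABox {T : TBox NC NR} {𝒜 : ABox NC NR NI} (hne : 𝒜.ind.Nonempty)
    {I : Interp NC NR NI} (hI : I.ModelsT T) (pos : 𝒜.ind → I.Dom)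
    (hpos : ∀ r (a b : 𝒜.ind), 𝒜.HasRole r a b → I.rel r (pos a) (pos b))
    (hinj : Function.Injective pos) : ForestData T NI where
  Root := 𝒜.ind
  edge r a b := 𝒜.HasRole r a b
  base := I
  pos := pos
  step d r e := I.rel r d e
  nonempty := hne.to_subtype
  edge_inverse r a b := 𝒜.hasRole_inverse r a b
  edge_all r s a b A B h hs hc hA := hI.1 _ hc _ hA _ (hs.satRI hI _ _ (hpos r a b h))
  edge_ex r a b A B h hr hc hA := by
    obtain ⟨e, he, hB⟩ := hI.1 _ hc _ hA
    rwa [hI.2.2 r hr _ _ _ (hpos r a b h) he]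
  edge_func r a b b' hr h h' := hinj (hI.2.2 r hr _ _ _ (hpos r a b h) (hpos r a b' h'))
  base_models := hI
  rel_of_step _ _ _ h := h
  step_ex A r B d hc hd := hI.1 _ hc d hd

namespace TBox

variable {T : TBox NC NR} {𝒜 : ABox NC NR NI}

/-- In the unravelling at the source of an `s`-edge, roles hold only through `T.Sub`, and no
nontrivial derivation ends in a functional role. The edge is needed because a role that is empty in
all models is included in every role. -/
theorem eq_of_entailsRI_of_mem_fas (hT : T.FunctionalNoSubroles) {r s : Role NR}
    (hr : r ∈ T.fas) (h : T.EntailsRI NI s r) {I : Interp NC NR NI} (hI : I.ModelsT T)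
    {d e : I.Dom} (hde : I.rel s d e) : s = r := by
  let F : ForestData T NI := .ofModel hI d (fun d r e => I.rel r d e) (fun _ _ _ h => h)
    (fun A r B d hc hd => hI.1 _ hc d hd)
  have hM := F.modelsT_interp (nm := fun _ => none) (hnm := by simp) hT
  let p : F.Node := F.root ⟨⟩
  let q : F.Node := ⟨(⟨⟩, [(s, e)]), .cons .nil hde fun h => h.2.elim fun _ h => h⟩
  have hpq : ForestData.edgeRel s p q := Or.inr (Or.inl ⟨s, e, rfl, .refl⟩)
  have := ForestData.rel_interp.1 (h _ hM p q (ForestData.rel_interp.2 hpq))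
  rcases ForestData.edgeRel_of_mem_fas hT hr this with ⟨x, y, -, -, he⟩ | ⟨e', h⟩ | ⟨e', h⟩
  · exact he.elim
  · have := congrArg Prod.snd h
    simp only [q, List.cons.injEq] at this
    exact congrArg Prod.fst this.1
  · exact absurd (congrArg Prod.snd h) (by simp [p, ForestData.root])

/-- In the forest over the ABox, an edge between individuals stems from an assertion by `T.Sub`,
which is trivial for functional roles. -/
theorem hasRole_of_entailsRoleAt (hT : T.FunctionalNoSubroles) (hc : T.Consistent 𝒜)
    {r : Role NR} (hr : r ∈ T.fas) {a b : NI} (ha : a ∈ 𝒜.ind)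
    (h : T.EntailsRoleAt 𝒜 r a b) : 𝒜.HasRole r a b := by
  obtain ⟨I, hI, hA⟩ := hc
  obtain ⟨g, hg, hgc, hgr, hginj⟩ := hA.exists_naming
  let F : ForestData T NI := .ofABox (𝒜 := 𝒜) ⟨a, ha⟩ hI (fun a => g a)
    (fun r a b h => hgr r a b h) (fun a b h => Subtype.ext (hginj a.2 b.2 h))
  have hinj : Function.Injective (id : 𝒜.ind → F.Root) := fun _ _ h => h
  have hM := F.modelsA_rootName hinj (fun A a h => hgc A a h) (fun r a b h => h)
  obtain ⟨p, q, hp, hq, hpq⟩ := h _ (F.modelsT_interp hT) hM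
  have hb : b ∈ 𝒜.ind := by
    by_contra hb
    have : F.rootName id b = none := dif_neg hb
    exact absurd (this.symm.trans hq) (by simp)
  obtain rfl := Option.some.inj ((F.rootName_of_mem (𝒜 := 𝒜) id ha).symm.trans hp)
  obtain rfl := Option.some.inj ((F.rootName_of_mem (𝒜 := 𝒜) id hb).symm.trans hq)
  rcases ForestData.edgeRel_of_mem_fas hT hr (ForestData.rel_interp.1 hpq) with
    ⟨x, y, hx, hy, he⟩ | ⟨e', h⟩ | ⟨e', h⟩
  · have hx := congrArg (fun p : F.Node => p.1.1) hx
    have hy := congrArg (fun p : F.Node => p.1.1) hy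
    dsimp only [ForestData.root, id] at hx hy
    subst hx hy
    exact he
  · exact absurd (congrArg Prod.snd h) (by simp [ForestData.root])
  · exact absurd (congrArg Prod.snd h) (by simp [ForestData.root])

/-! ### Types -/

/-- The concept names that occur in a TBox. -/
def names (T : TBox NC NR) : Set NC := {A | ∃ c ∈ T.cis, A ∈ c.conceptNames}

theorem finite_names (T : TBox NC NR) : T.names.Finite := by
  have : T.names = ⋃ c ∈ (T.cis : Set (CI NC NR)), c.conceptNames := by
    ext A
    simp [names]
  rw [this]
  refine T.cis.finite_toSet.biUnion fun c _ => ?_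
  cases c <;> simp [CI.conceptNames]

/-- Removing a concept name that does not occur in a TBox preserves models. -/
theorem exists_model_notMem {A : NC} (hA : A ∉ T.names) {I : Interp NC NR NI}
    (hI : I.ModelsT T) {d : I.Dom} {t : Set NC} (ht : A ∉ t) (hd : d ∈ I.conjExt t) :
    ∃ J : Interp NC NR NI, J.ModelsT T ∧ ∃ e ∈ J.conjExt t, e ∉ J.conc A := by
  let J : Interp NC NR NI := { I with conc := fun B => {d | d ∈ I.conc B ∧ B ≠ A} }
  have hrel : ∀ r d e, J.rel r d e ↔ I.rel r d e := by
    intro r d e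
    cases r <;> rfl
  refine ⟨J, ⟨?_, ?_, ?_⟩, d, fun B hB => ⟨hd B hB, fun h => ht (h ▸ hB)⟩, fun h => h.2 rfl⟩
  · intro c hc
    have hn : ∀ B ∈ c.conceptNames, B ≠ A := fun B hB h => hA ⟨c, hc, h ▸ hB⟩
    have hb := hI.1 c hc
    cases c with
    | top B => exact fun d => ⟨hb d, hn B rfl⟩
    | bot B => exact fun d h => hb d h.1
    | conj B₁ B₂ B =>
      exact fun d h₁ h₂ => ⟨hb d h₁.1 h₂.1, hn B (by simp [CI.conceptNames])⟩
    | ex B₁ r B =>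
      intro d h
      obtain ⟨e, hr, he⟩ := hb d h.1
      exact ⟨e, (hrel r d e).2 hr, he, hn B (by simp [CI.conceptNames])⟩
    | all B₁ r B =>
      intro d h e hr
      exact ⟨hb d h.1 e ((hrel r d e).1 hr), hn B (by simp [CI.conceptNames])⟩
  · intro p hp d e h
    rw [hrel] at h ⊢
    exact hI.2.1 p hp d e h
  · intro r hr d e e' h h'
    rw [hrel] at h h'
    exact hI.2.2 r hr d e e' h h'

/-- The closure of a set of concept names under entailment. -/
def cl (NI : Type u) (T : TBox NC NR) (t : Set NC) : Set NC := {A | T.EntailsConcept NI t A}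

theorem subset_cl (t : Set NC) : t ⊆ T.cl NI t := fun A hA _ _ _ hd => hd A hA

theorem mem_conjExt_cl {t : Set NC} {I : Interp NC NR NI} (hI : I.ModelsT T) {d : I.Dom}
    (hd : d ∈ I.conjExt t) : d ∈ I.conjExt (T.cl NI t) :=
  fun _ hA => hA I hI d hd

/-- A name outside `T` can be emptied in a model that realizes `t`, so the closure stays within the
names of `T`. Satisfiability matters: the closure of an unsatisfiable set consists of all concept
names. -/
theorem isType_cl {t : Set NC} (ht : t ⊆ T.names) {I : Interp NC NR NI} (hI : I.ModelsT T)
    {d : I.Dom} (hd : d ∈ I.conjExt t) : T.IsType NI (T.cl NI t) := by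
  refine ⟨fun A hA => ?_, fun A hA J hJ e he => hA J hJ e (mem_conjExt_cl hJ he)⟩
  by_contra hn
  obtain ⟨J, hJ, e, he, hne⟩ := exists_model_notMem hn hI (fun h => hn (ht h)) hd
  exact hne (hA J hJ e he)

/-- An unsatisfiable type would be closed under all concept names, including one that does not occur
in the finite set `T`. -/
theorem IsType.exists_model [Infinite NC] {t : Set NC} (ht : T.IsType NI t) :
    ∃ I : Interp NC NR NI, I.ModelsT T ∧ ∃ d, d ∈ I.conjExt t := by
  obtain ⟨A, hA⟩ := T.finite_names.exists_notMem
  by_contra! hcon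
  exact hA (ht.1 A (ht.2 A fun I hI d hd => absurd hd (hcon I hI d)))

theorem exists_maximal_type {P : Set NC → Prop} {t : Set NC} (ht : T.IsType NI t) (hP : P t) :
    ∃ t', t ⊆ t' ∧ Maximal (fun t'' => T.IsType NI t'' ∧ P t'') t' := by
  have hfin : {t'' | T.IsType NI t'' ∧ P t''}.Finite :=
    T.finite_names.finite_subsets.subset fun t'' h => fun A hA => h.1.1 A hA
  exact hfin.exists_le_maximal ⟨ht, hP⟩

end TBox

/-! ### The universal model -/

namespace TBox

variable {T : TBox NC NR} {𝒜 : ABox NC NR NI}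

/-- `d` is an element of a model that satisfies what the last entry of a path requires. -/
def Local (T : TBox NC NR) (𝒜 : ABox NC NR NI) (p : NI × List (Role NR × Set NC))
    (I : Interp NC NR NI) (d : I.Dom) : Prop :=
  I.ModelsT T ∧
    match p with
    | (a, []) => I.ModelsA 𝒜 ∧ I.name a = some d
    | (_, (_, t) :: _) => d ∈ I.conjExt t

/-- All elements that satisfy the requirements of `p` have an `s`-successor in `t`. -/
def LocalExists (T : TBox NC NR) (𝒜 : ABox NC NR NI) (p : NI × List (Role NR × Set NC))
    (s : Role NR) (t : Set NC) : Prop :=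
  ∀ (I : Interp NC NR NI) (d : I.Dom), T.Local 𝒜 p I d → ∃ e, I.rel s d e ∧ e ∈ I.conjExt t

/-- A functional role may not lead from `p` to a successor if it leads to an individual or back. -/
def LocalOk (T : TBox NC NR) (𝒜 : ABox NC NR NI) (p : NI × List (Role NR × Set NC))
    (s : Role NR) : Prop :=
  s ∈ T.fas →
    match p with
    | (a, []) => ¬ ∃ b ∈ 𝒜.ind, T.EntailsRoleAt 𝒜 s a b
    | (_, (r, _) :: _) => r ≠ s.inverse

theorem IsPath.mem_ind {a : NI} {w : List (Role NR × Set NC)} (h : T.IsPath 𝒜 a w) :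
    a ∈ 𝒜.ind := by
  induction h with
  | root h => exact h
  | first r t h => exact h
  | next r s t t' w _ _ _ ih => exact ih

theorem entailsExistsAt_iff {a : NI} (ha : a ∈ 𝒜.ind) {s : Role NR} {t : Set NC} :
    T.EntailsExistsAt 𝒜 s t a ↔ T.LocalExists 𝒜 (a, []) s t := by
  constructor
  · rintro h I d ⟨hT, hA, hd⟩
    obtain ⟨d', e, hd', h⟩ := h I hT hA
    obtain rfl := Option.some.inj (hd.symm.trans hd')
    exact ⟨e, h⟩
  · intro h I hT hA
    obtain ⟨d, hd⟩ := hA.name_of_mem_ind ha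
    obtain ⟨e, h⟩ := h I d ⟨hT, hA, hd⟩
    exact ⟨d, e, hd, h⟩

theorem entailsExists_iff {a : NI} {r s : Role NR} {t t' : Set NC}
    {w : List (Role NR × Set NC)} :
    T.EntailsExists NI t s t' ↔ T.LocalExists 𝒜 (a, (r, t) :: w) s t' :=
  ⟨fun h I d hd => h I hd.1 d hd.2, fun h I hI d hd => h I d ⟨hI, hd⟩⟩

/-- This uniform condition removes the distinction between steps from individuals and steps from
types in the arguments about the universal model. -/
theorem isPath_cons_iff {a : NI} {w : List (Role NR × Set NC)} {s : Role NR} {t : Set NC} :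
    T.IsPath 𝒜 a ((s, t) :: w) ↔ T.IsPath 𝒜 a w ∧
      Maximal (fun t' => T.IsType NI t' ∧ T.LocalExists 𝒜 (a, w) s t') t ∧
      T.LocalOk 𝒜 (a, w) s := by
  constructor
  · intro h
    cases h with
    | first _ _ ha h hok =>
      refine ⟨.root a ha, ?_, hok⟩
      simpa only [ArrowInd, entailsExistsAt_iff ha] using h
    | next r _ t' _ w hp h hok =>
      refine ⟨hp, ?_, hok⟩
      simpa only [Arrow, entailsExists_iff (𝒜 := 𝒜) (a := a) (r := r) (w := w)] using h
  · rintro ⟨hp, h, hok⟩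
    cases w with
    | nil =>
      refine .first a s t hp.mem_ind ?_ hok
      simpa only [ArrowInd, entailsExistsAt_iff hp.mem_ind] using h
    | cons x w =>
      obtain ⟨r, t'⟩ := x
      refine .next a r s t' t w hp ?_ hok
      simpa only [Arrow, entailsExists_iff (𝒜 := 𝒜) (a := a) (r := r) (w := w)] using h

theorem univConc_iff {A : NC} {p : T.Path 𝒜} :
    T.univConc 𝒜 A p ↔
      ∀ (I : Interp NC NR NI) (d : I.Dom), T.Local 𝒜 p.1 I d → d ∈ I.conc A := by
  obtain ⟨⟨a, _ | ⟨⟨r, t⟩, w⟩⟩, hp⟩ := p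
  · constructor
    · rintro h I d ⟨hT, hA, hd⟩
      obtain ⟨d', hd', h⟩ := h I hT hA
      obtain rfl := Option.some.inj (hd.symm.trans hd')
      exact h
    · intro h I hT hA
      obtain ⟨d, hd⟩ := hA.name_of_mem_ind hp.mem_ind
      exact ⟨d, hd, h I d ⟨hT, hA, hd⟩⟩
  · exact ⟨fun h I d hd => h I hd.1 d hd.2, fun h I hI d hd => h I d ⟨hI, hd⟩⟩

theorem exists_local [Infinite NC] (hc : T.Consistent 𝒜) (p : T.Path 𝒜) :
    ∃ (I : Interp NC NR NI) (d : I.Dom), T.Local 𝒜 p.1 I d := by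
  obtain ⟨⟨a, _ | ⟨⟨r, t⟩, w⟩⟩, hp⟩ := p
  · obtain ⟨I, hI, hA⟩ := hc
    obtain ⟨d, hd⟩ := hA.name_of_mem_ind hp.mem_ind
    exact ⟨I, d, hI, hA, hd⟩
  · obtain ⟨-, h, -⟩ := isPath_cons_iff.1 hp
    obtain ⟨I, hI, d, hd⟩ := h.prop.1.exists_model
    exact ⟨I, d, hI, hd⟩

/-- The extension of a role in the universal model. -/
def univRel (T : TBox NC NR) (𝒜 : ABox NC NR NI) (r : Role NR) (p q : T.Path 𝒜) : Prop :=
  (∃ a b s, p.1 = (a, []) ∧ q.1 = (b, []) ∧ 𝒜.HasRole s a b ∧ T.EntailsRI NI s r) ∨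
  (∃ s t, q.1 = (p.1.1, (s, t) :: p.1.2) ∧ T.EntailsRI NI s r) ∨
  (∃ s t, p.1 = (q.1.1, (s, t) :: q.1.2) ∧ T.EntailsRI NI s.inverse r)

theorem EntailsRI.inverse {r s : Role NR} (h : T.EntailsRI NI r s) :
    T.EntailsRI NI r.inverse s.inverse := by
  intro I hI d e
  rw [Interp.rel_inverse, Interp.rel_inverse]
  exact h I hI e d

theorem univRel_inverse_of {r : Role NR} {p q : T.Path 𝒜} (h : T.univRel 𝒜 r p q) :
    T.univRel 𝒜 r.inverse q p := by
  rcases h with ⟨x, y, s, hp, hq, he, hs⟩ | ⟨s, e, h, hs⟩ | ⟨s, e, h, hs⟩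
  · exact Or.inl ⟨y, x, s.inverse, hq, hp, (𝒜.hasRole_inverse _ _ _).2 he, hs.inverse⟩
  · exact Or.inr (Or.inr ⟨s, e, h, hs.inverse⟩)
  · exact Or.inr (Or.inl ⟨s, e, h, by simpa using hs.inverse⟩)

theorem rel_universalModel {h : 𝒜.ind.Nonempty} {r : Role NR} {p q : T.Path 𝒜} :
    (T.universalModel 𝒜 h).rel r p q ↔ T.univRel 𝒜 r p q := by
  cases r with
  | name r => exact Iff.rfl
  | inv r => exact ⟨univRel_inverse_of (r := .name r), univRel_inverse_of (r := .inv r)⟩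

theorem maximal_of_cons {p q : T.Path 𝒜} {s : Role NR} {t : Set NC}
    (h : q.1 = (p.1.1, (s, t) :: p.1.2)) :
    Maximal (fun t' => T.IsType NI t' ∧ T.LocalExists 𝒜 p.1 s t') t ∧ T.LocalOk 𝒜 p.1 s := by
  obtain ⟨q, hq⟩ := q
  dsimp only at h
  subst h
  exact (isPath_cons_iff.1 hq).2

theorem local_of_cons {p q : T.Path 𝒜} {s : Role NR} {t : Set NC}
    (h : q.1 = (p.1.1, (s, t) :: p.1.2)) {I : Interp NC NR NI} {d : I.Dom} :
    T.Local 𝒜 q.1 I d ↔ I.ModelsT T ∧ d ∈ I.conjExt t := by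
  obtain ⟨q, hq⟩ := q
  dsimp only at h
  subst h
  exact Iff.rfl

theorem exists_local_of_cons {p q : T.Path 𝒜} {s : Role NR} {t : Set NC}
    (h : q.1 = (p.1.1, (s, t) :: p.1.2)) {I : Interp NC NR NI} {d : I.Dom}
    (hd : T.Local 𝒜 p.1 I d) : ∃ e, I.rel s d e ∧ T.Local 𝒜 q.1 I e := by
  obtain ⟨e, he, ht⟩ := (maximal_of_cons h).1.prop.2 I d hd
  exact ⟨e, he, (local_of_cons h).2 ⟨hd.1, ht⟩⟩

/-- A set of concept names that holds at some successor of all elements for `p`, and contains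
the maximal type `t`, is contained in `t`. -/
theorem subset_of_localExists [Infinite NC] (hc : T.Consistent 𝒜) {p : T.Path 𝒜}
    {s : Role NR} {t t' : Set NC}
    (ht : Maximal (fun t' => T.IsType NI t' ∧ T.LocalExists 𝒜 p.1 s t') t)
    (hn : t' ⊆ T.names) (htt' : t ⊆ t') (h : T.LocalExists 𝒜 p.1 s t') : t' ⊆ t := by
  obtain ⟨I, d, hd⟩ := exists_local hc p
  obtain ⟨e, -, he⟩ := h I d hd
  refine (subset_cl (NI := NI) (T := T) t').trans
    (ht.le_of_ge ⟨isType_cl hn hd.1 he, ?_⟩ (htt'.trans (subset_cl _)))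
  intro J d hd
  obtain ⟨e, hr, he⟩ := h J d hd
  exact ⟨e, hr, mem_conjExt_cl hd.1 he⟩

/-- If the path may be extended by `r`, a maximal type above the closure of `B` is the witness.
Otherwise `r` is functional and leads to an individual or back to the preceding path; functionality
forces `B` there in every model, hence in the universal model. -/
theorem exists_univRel [Infinite NC] (hT : T.FunctionalNoSubroles) (hc : T.Consistent 𝒜)
    {A : NC} {r : Role NR} {B : NC} (h : CI.ex A r B ∈ T.cis) {p : T.Path 𝒜}
    (hp : T.univConc 𝒜 A p) : ∃ q, T.univRel 𝒜 r p q ∧ T.univConc 𝒜 B q := by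
  rw [univConc_iff] at hp
  have hB : ∀ (I : Interp NC NR NI) (d : I.Dom), T.Local 𝒜 p.1 I d →
      ∃ e, I.rel r d e ∧ e ∈ I.conc B := fun I d hd => hd.1.1 _ h d (hp I d hd)
  by_cases hok : T.LocalOk 𝒜 p.1 r
  · obtain ⟨I, d, hd⟩ := exists_local hc p
    obtain ⟨e, -, he⟩ := hB I d hd
    have hty : T.IsType NI (T.cl NI {B}) := isType_cl (I := I) (d := e)
      (by rintro _ rfl; exact ⟨_, h, by simp [CI.conceptNames]⟩) hd.1
      (by rintro _ rfl; exact he)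
    have hex : T.LocalExists 𝒜 p.1 r (T.cl NI {B}) := by
      intro I d hd
      obtain ⟨e, hr, he⟩ := hB I d hd
      exact ⟨e, hr, mem_conjExt_cl hd.1 (by rintro _ rfl; exact he)⟩
    obtain ⟨t, ht, hmax⟩ := exists_maximal_type hty hex
    let q : T.Path 𝒜 := ⟨(p.1.1, (r, t) :: p.1.2), isPath_cons_iff.2 ⟨p.2, hmax, hok⟩⟩
    refine ⟨q, Or.inr (Or.inl ⟨r, t, rfl, fun _ _ _ _ h => h⟩), univConc_iff.2 ?_⟩
    intro I d hd
    exact ((local_of_cons (p := p) (q := q) rfl).1 hd).2 B (ht (subset_cl _ rfl))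
  · obtain ⟨hr, hok⟩ := Classical.not_imp.1 hok
    obtain ⟨⟨a, _ | ⟨⟨s, t⟩, w⟩⟩, hw⟩ := p
    · obtain ⟨b, hb, hab⟩ := not_not.1 hok
      refine ⟨⟨(b, []), .root b hb⟩, Or.inl ⟨a, b, r, rfl, rfl,
        hasRole_of_entailsRoleAt hT hc hr hw.mem_ind hab, fun _ _ _ _ h => h⟩, ?_⟩
      intro I hI hA
      obtain ⟨d, e, hd, he, hde⟩ := hab I hI hA
      obtain ⟨e', he', hB⟩ := hB I d ⟨hI, hA, hd⟩
      exact ⟨e, he, by rwa [hI.2.2 r hr _ _ _ hde he']⟩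
    · obtain rfl : s = r.inverse := not_not.1 hok
      let q : T.Path 𝒜 := ⟨(a, w), (isPath_cons_iff.1 hw).1⟩
      refine ⟨q, Or.inr (Or.inr ⟨r.inverse, t, rfl, ?_⟩), univConc_iff.2 ?_⟩
      · rw [Role.inverse_inverse]
        exact fun _ _ _ _ h => h
      · intro I d hd
        obtain ⟨e, he, hloc⟩ := exists_local_of_cons (p := q)
          (q := ⟨(a, (r.inverse, t) :: w), hw⟩) rfl hd
        obtain ⟨d', hd', hB⟩ := hB I e hloc
        rw [Interp.rel_inverse] at he
        rwa [hd.1.2.2 r hr _ _ _ he hd']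

/-- Along a forward step, `B` may be added to the type of the successor, so by maximality it is
already there. Along a backward step, every element that meets the requirements of `q` has a
successor meeting those of `p`, and the restriction at that successor yields `B`. -/
theorem univConc_of_all [Infinite NC] (hc : T.Consistent 𝒜) {A : NC} {r : Role NR} {B : NC}
    (h : CI.all A r B ∈ T.cis) {p q : T.Path 𝒜} (hp : T.univConc 𝒜 A p)
    (hpq : T.univRel 𝒜 r p q) : T.univConc 𝒜 B q := by
  rcases hpq with ⟨a, b, s, hpa, hqb, hs, hsr⟩ | ⟨s, t, hq, hsr⟩ | ⟨s, t, hq, hsr⟩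
  · rw [univConc_iff] at hp ⊢
    rw [hpa] at hp
    rw [hqb]
    rintro I e ⟨hI, hA, he⟩
    obtain ⟨d, e', hd, he', hde⟩ := hA.rel_of_hasRole hs
    obtain rfl := Option.some.inj (he.symm.trans he')
    exact hI.1 _ h d (hp I d ⟨hI, hA, hd⟩) e (hsr I hI _ _ hde)
  · rw [univConc_iff] at hp ⊢
    have hmax := (maximal_of_cons hq).1
    have hsub : insert B t ⊆ t := by
      refine subset_of_localExists hc hmax ?_ (Set.subset_insert _ _) ?_
      · rintro C (rfl | hC)
        · exact ⟨_, h, by simp [CI.conceptNames]⟩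
        · exact hmax.prop.1.1 C hC
      · intro I d hd
        obtain ⟨e, he, ht⟩ := hmax.prop.2 I d hd
        refine ⟨e, he, ?_⟩
        rintro C (rfl | hC)
        · exact hd.1.1 _ h d (hp I d hd) e (hsr I hd.1 _ _ he)
        · exact ht C hC
    intro I e he
    exact ((local_of_cons hq).1 he).2 B (hsub (Set.mem_insert _ _))
  · rw [univConc_iff] at hp ⊢
    intro I d hd
    obtain ⟨e, he, hloc⟩ := exists_local_of_cons hq hd
    exact hd.1.1 _ h e (hp I e hloc) d
      (hsr I hd.1 _ _ ((Interp.rel_inverse _ _ _ _).2 he))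

theorem univRel_of_mem_fas [Infinite NC] (hT : T.FunctionalNoSubroles) (hc : T.Consistent 𝒜)
    {r : Role NR} (hr : r ∈ T.fas) {p q : T.Path 𝒜} (h : T.univRel 𝒜 r p q) :
    (∃ a b, p.1 = (a, []) ∧ q.1 = (b, []) ∧ 𝒜.HasRole r a b) ∨
    (∃ t, q.1 = (p.1.1, (r, t) :: p.1.2)) ∨
    (∃ t, p.1 = (q.1.1, (r.inverse, t) :: q.1.2)) := by
  rcases h with ⟨a, b, s, hp, hq, he, hs⟩ | ⟨s, t, h, hs⟩ | ⟨s, t, h, hs⟩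
  · obtain ⟨I, hI, hA⟩ := hc
    obtain ⟨d, e, -, -, hde⟩ := hA.rel_of_hasRole he
    obtain rfl := eq_of_entailsRI_of_mem_fas hT hr hs hI hde
    exact Or.inl ⟨a, b, hp, hq, he⟩
  · obtain ⟨I, d, hd⟩ := exists_local hc p
    obtain ⟨e, he, -⟩ := exists_local_of_cons h hd
    obtain rfl := eq_of_entailsRI_of_mem_fas hT hr hs hd.1 he
    exact Or.inr (Or.inl ⟨t, h⟩)
  · obtain ⟨I, d, hd⟩ := exists_local hc q
    obtain ⟨e, he, -⟩ := exists_local_of_cons h hd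
    obtain rfl := eq_of_entailsRI_of_mem_fas hT hr hs hd.1 ((Interp.rel_inverse _ _ _ _).2 he)
    exact Or.inr (Or.inr ⟨t, by simpa using h⟩)

/-- By functionality the types of two forward successors hold at a common element, so their union is
realized and maximality makes them equal. Two individuals are identified in a common model of `T`
and `𝒜`; the mixed cases contradict `LocalOk` or the shape of the paths. -/
theorem univRel_func [Infinite NC] (hT : T.FunctionalNoSubroles) (hc : T.Consistent 𝒜)
    {r : Role NR} (hr : r ∈ T.fas) {p q q' : T.Path 𝒜} (h : T.univRel 𝒜 r p q)
    (h' : T.univRel 𝒜 r p q') : q = q' := by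
  have key₁ : ∀ {p q q' : T.Path 𝒜} {a b t}, p.1 = (a, []) → q.1 = (b, []) → 𝒜.HasRole r a b →
      q'.1 = (p.1.1, (r, t) :: p.1.2) → False := by
    intro p q q' a b t hp hq hab h
    have hok := (maximal_of_cons h).2 hr
    rw [hp] at hok
    exact hok ⟨b, hab.right_mem_ind, fun I _ hA => hA.rel_of_hasRole hab⟩
  have key₂ : ∀ {p q q' : T.Path 𝒜} {t t'}, p.1 = (q.1.1, (r.inverse, t) :: q.1.2) →
      q'.1 = (p.1.1, (r, t') :: p.1.2) → False := by
    intro p q q' t t' hp h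
    have hok := (maximal_of_cons h).2 hr
    rw [hp] at hok
    exact hok rfl
  rcases univRel_of_mem_fas hT hc hr h with ⟨a, b, hp, hq, hab⟩ | ⟨t, h⟩ | ⟨t, h⟩ <;>
  rcases univRel_of_mem_fas hT hc hr h' with ⟨a', b', hp', hq', hab'⟩ | ⟨t', h'⟩ | ⟨t', h'⟩
  · obtain rfl : a = a' := congrArg Prod.fst (hp.symm.trans hp')
    obtain ⟨I, hI, hA⟩ := hc
    obtain ⟨d, e, hd, he, hde⟩ := hA.rel_of_hasRole hab
    obtain ⟨d', e', hd', he', hde'⟩ := hA.rel_of_hasRole hab'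
    obtain rfl := Option.some.inj (hd.symm.trans hd')
    obtain rfl := hI.2.2 r hr _ _ _ hde hde'
    obtain rfl := I.name_inj _ _ _ he he'
    exact Subtype.ext (hq.trans hq'.symm)
  · exact (key₁ hp hq hab h').elim
  · exact absurd (congrArg Prod.snd (hp.symm.trans h')) (by simp)
  · exact (key₁ hp' hq' hab' h).elim
  · have h₁ := (maximal_of_cons h).1
    have h₂ := (maximal_of_cons h').1
    have hex : T.LocalExists 𝒜 p.1 r (t ∪ t') := by
      intro I d hd
      obtain ⟨e, he, ht⟩ := h₁.prop.2 I d hd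
      obtain ⟨e', he', ht'⟩ := h₂.prop.2 I d hd
      obtain rfl := hd.1.2.2 r hr _ _ _ he he'
      exact ⟨e, he, fun A hA => hA.elim (ht A) (ht' A)⟩
    have hn : t ∪ t' ⊆ T.names := Set.union_subset h₁.prop.1.1 h₂.prop.1.1
    obtain rfl : t = t' := (Set.subset_union_left.trans
      (subset_of_localExists hc h₂ hn Set.subset_union_right hex)).antisymm
      (Set.subset_union_right.trans
        (subset_of_localExists hc h₁ hn Set.subset_union_left hex))
    exact Subtype.ext (h.trans h'.symm)
  · exact (key₂ h' h).elim
  · exact absurd (congrArg Prod.snd (hp'.symm.trans h)) (by simp)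
  · exact (key₂ h h').elim
  · have := h.symm.trans h'
    simp only [Prod.mk.injEq, List.cons.injEq] at this
    exact Subtype.ext (Prod.ext this.1 this.2.2)

theorem modelsT_universalModel [Infinite NC] (hT : T.FunctionalNoSubroles)
    (hc : T.Consistent 𝒜) (h : 𝒜.ind.Nonempty) : (T.universalModel 𝒜 h).ModelsT T := by
  refine ⟨?_, ?_, ?_⟩
  · intro c hcT
    cases c with
    | top A => exact fun p => univConc_iff.2 fun I d hd => hd.1.1 _ hcT d
    | bot A =>
      intro p hp
      obtain ⟨I, d, hd⟩ := exists_local hc p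
      exact hd.1.1 _ hcT d (univConc_iff.1 hp I d hd)
    | conj A₁ A₂ B =>
      exact fun p h₁ h₂ => univConc_iff.2 fun I d hd =>
        hd.1.1 _ hcT d (univConc_iff.1 h₁ I d hd) (univConc_iff.1 h₂ I d hd)
    | ex A r B =>
      intro p hp
      obtain ⟨q, hq, hB⟩ := exists_univRel hT hc hcT hp
      exact ⟨q, rel_universalModel.2 hq, hB⟩
    | all A r B => exact fun p hp q hq => univConc_of_all hc hcT hp (rel_universalModel.1 hq)
  · rintro ⟨r, r'⟩ hrs p q hpq
    have htr : ∀ s, T.EntailsRI NI s r → T.EntailsRI NI s r' :=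
      fun s hs I hI d e hde => hI.2.1 _ hrs _ _ (hs I hI d e hde)
    refine rel_universalModel.2 ?_
    rcases rel_universalModel.1 hpq with ⟨x, y, s, hp, hq, he, hs⟩ | ⟨s, e, h, hs⟩ | ⟨s, e, h, hs⟩
    · exact Or.inl ⟨x, y, s, hp, hq, he, htr _ hs⟩
    · exact Or.inr (Or.inl ⟨s, e, h, htr _ hs⟩)
    · exact Or.inr (Or.inr ⟨s, e, h, htr _ hs⟩)
  · intro r hr p q q' h h'
    exact univRel_func hT hc hr (rel_universalModel.1 h) (rel_universalModel.1 h')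

/-! ### The universal model satisfies the ABox and has a simulation in every model -/

theorem name_universalModel (h : 𝒜.ind.Nonempty) {a : NI} (ha : a ∈ 𝒜.ind) :
    (T.universalModel 𝒜 h).name a = some ⟨(a, []), .root a ha⟩ :=
  dif_pos ha

theorem modelsA_universalModel (h : 𝒜.ind.Nonempty) : (T.universalModel 𝒜 h).ModelsA 𝒜 := by
  refine ⟨fun A a hA => ?_, fun r a b hr => ?_⟩
  · exact ⟨_, name_universalModel h (Or.inl ⟨A, hA⟩), fun I _ hIA => hIA.1 A a hA⟩
  · have hab : 𝒜.HasRole (.name r) a b := hr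
    exact ⟨_, _, name_universalModel h hab.left_mem_ind, name_universalModel h hab.right_mem_ind,
      Or.inl ⟨a, b, .name r, rfl, rfl, hab, fun _ _ _ _ h => h⟩⟩

/-- The elements of a model that realize a path together with all of its prefixes. -/
def Realizes (J : Interp NC NR NI) (a : NI) : List (Role NR × Set NC) → J.Dom → Prop
  | [], e => J.name a = some e
  | (s, t) :: w, e => e ∈ J.conjExt t ∧ ∃ e', Realizes J a w e' ∧ J.rel s e' e

theorem Realizes.local {J : Interp NC NR NI} (hT : J.ModelsT T) (hA : J.ModelsA 𝒜) {a : NI}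
    {w : List (Role NR × Set NC)} {e : J.Dom} (h : Realizes J a w e) : T.Local 𝒜 (a, w) J e := by
  cases w with
  | nil => exact ⟨hT, hA, h⟩
  | cons x w => exact ⟨hT, h.1⟩

theorem Realizes.exists_rel {J : Interp NC NR NI} (hT : J.ModelsT T) (hA : J.ModelsA 𝒜)
    {r : Role NR} {p q : T.Path 𝒜} (hpq : T.univRel 𝒜 r p q) {e : J.Dom}
    (he : Realizes J p.1.1 p.1.2 e) : ∃ e', J.rel r e e' ∧ Realizes J q.1.1 q.1.2 e' := by
  rcases hpq with ⟨a, b, s, hp, hq, hab, hs⟩ | ⟨s, t, hq, hs⟩ | ⟨s, t, hp, hs⟩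
  · rw [hp] at he
    rw [hq]
    obtain ⟨d, e', hd, he', hde⟩ := hA.rel_of_hasRole hab
    obtain rfl := Option.some.inj (he.symm.trans hd)
    exact ⟨e', hs J hT _ _ hde, he'⟩
  · obtain ⟨e', he', hloc⟩ := exists_local_of_cons hq (he.local hT hA)
    refine ⟨e', hs J hT _ _ he', ?_⟩
    rw [hq]
    exact ⟨((local_of_cons hq).1 hloc).2, e, he, he'⟩
  · rw [hp] at he
    obtain ⟨-, e', he', hr⟩ := he
    exact ⟨e', hs J hT _ _ ((Interp.rel_inverse _ _ _ _).2 hr), he'⟩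

/-- Forward steps are entailed, so every model follows them. Realizing all prefixes along with a
path is what allows edges to be followed backwards. -/
theorem isSimulation_realizes (h : 𝒜.ind.Nonempty) {J : Interp NC NR NI} (hT : J.ModelsT T)
    (hA : J.ModelsA 𝒜) (Sg : Sig NC NR) :
    Interp.IsSimulation Sg (T.universalModel 𝒜 h) J
      (fun (p : T.Path 𝒜) e => Realizes J p.1.1 p.1.2 e) := by
  refine ⟨fun a p hp => ?_, fun A _ p e hp he => ?_, fun r _ p q e hpq he => ?_⟩
  · have ha : a ∈ 𝒜.ind := by
      by_contra ha
      exact absurd ((dif_neg ha : (T.universalModel 𝒜 h).name a = none).symm.trans hp) (by simp)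
    obtain rfl := Option.some.inj ((name_universalModel h ha).symm.trans hp)
    obtain ⟨d, hd⟩ := hA.name_of_mem_ind ha
    exact ⟨d, hd, hd⟩
  · exact univConc_iff.1 hp J e (he.local hT hA)
  · exact he.exists_rel hT hA (rel_universalModel.1 hpq)

end TBox

/-! ### Products and disjoint sums of models -/

/-- The product of a family of interpretations, without names. -/
def Interp.prod {ι : Type u} (M : ι → Interp NC NR NI) : Interp NC NR NI where
  Dom := ∀ i, (M i).Dom
  dom_nonempty := ⟨fun i => (M i).dom_nonempty.some⟩
  conc A := {d | ∀ i, d i ∈ (M i).conc A}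
  role r d e := ∀ i, (M i).role r (d i) (e i)
  name _ := none
  name_inj := by simp

theorem Interp.rel_prod {ι : Type u} {M : ι → Interp NC NR NI} {r : Role NR}
    {d e : ∀ i, (M i).Dom} : (Interp.prod M).rel r d e ↔ ∀ i, (M i).rel r (d i) (e i) := by
  cases r <;> rfl

/-- This is where the Horn form enters: no inclusion is disjunctive, so witnesses can be chosen
coordinatewise. The empty product would violate `A ⊑ ⊥`. -/
theorem Interp.modelsT_prod {ι : Type u} [Nonempty ι] {M : ι → Interp NC NR NI}
    {T : TBox NC NR} (h : ∀ i, (M i).ModelsT T) : (Interp.prod M).ModelsT T := by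
  refine ⟨?_, ?_, ?_⟩
  · intro c hc
    have hb := fun i => (h i).1 c hc
    cases c with
    | top A => exact fun d i => hb i (d i)
    | bot A =>
      intro d hd
      obtain ⟨i⟩ := ‹Nonempty ι›
      exact hb i (d i) (hd i)
    | conj A₁ A₂ B => exact fun d h₁ h₂ i => hb i (d i) (h₁ i) (h₂ i)
    | ex A r B =>
      intro d hd
      choose e he using fun i => hb i (d i) (hd i)
      exact ⟨e, rel_prod.2 fun i => (he i).1, fun i => (he i).2⟩
    | all A r B => exact fun d hd e hr i => hb i (d i) (hd i) (e i) (rel_prod.1 hr i)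
  · exact fun p hp d e hr => rel_prod.2 fun i => (h i).2.1 p hp _ _ (rel_prod.1 hr i)
  · intro r hr d e e' h₁ h₂
    funext i
    exact (h i).2.2 r hr _ _ _ (rel_prod.1 h₁ i) (rel_prod.1 h₂ i)

theorem ELI.mem_ext_prod {ι : Type u} {M : ι → Interp NC NR NI} {C : ELI NC NR}
    {d : ∀ i, (M i).Dom} : d ∈ C.ext (Interp.prod M) ↔ ∀ i, d i ∈ C.ext (M i) := by
  induction C generalizing d with
  | top => exact ⟨fun _ _ => trivial, fun _ => trivial⟩
  | atom A => rfl
  | conj C D hC hD => exact (and_congr hC hD).trans forall_and.symm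
  | ex r C ih =>
    constructor
    · rintro ⟨e, hr, he⟩ i
      exact ⟨e i, Interp.rel_prod.1 hr i, ih.1 he i⟩
    · intro h
      choose e he using h
      exact ⟨e, Interp.rel_prod.2 fun i => (he i).1, ih.2 fun i => (he i).2⟩

/-- The disjoint sum of a family of interpretations, without names. -/
def Interp.sum {ι : Type u} [Nonempty ι] (M : ι → Interp NC NR NI) : Interp NC NR NI where
  Dom := Σ i, (M i).Dom
  dom_nonempty := ⟨⟨Classical.arbitrary ι, (M _).dom_nonempty.some⟩⟩
  conc A := {d | d.2 ∈ (M d.1).conc A}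
  role r d e := ∃ i d' e', d = ⟨i, d'⟩ ∧ e = ⟨i, e'⟩ ∧ (M i).role r d' e'
  name _ := none
  name_inj := by simp

section Sum

variable {ι : Type u} [Nonempty ι] {M : ι → Interp NC NR NI}

theorem Interp.rel_sum {r : Role NR} {d e : Σ i, (M i).Dom} : (Interp.sum M).rel r d e ↔
    ∃ i d' e', d = ⟨i, d'⟩ ∧ e = ⟨i, e'⟩ ∧ (M i).rel r d' e' := by
  cases r with
  | name r => rfl
  | inv r =>
    constructor <;> rintro ⟨i, d', e', h₁, h₂, h⟩ <;> exact ⟨i, e', d', h₂, h₁, h⟩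

theorem Interp.exists_of_rel_sum {r : Role NR} {i : ι} {d : (M i).Dom} {e : Σ i, (M i).Dom}
    (h : (Interp.sum M).rel r (⟨i, d⟩ : Σ i, (M i).Dom) e) :
    ∃ e', e = ⟨i, e'⟩ ∧ (M i).rel r d e' := by
  obtain ⟨j, d', e', h₁, rfl, h⟩ := rel_sum.1 h
  cases h₁
  exact ⟨e', rfl, h⟩

theorem Interp.modelsT_sum {T : TBox NC NR} (h : ∀ i, (M i).ModelsT T) :
    (Interp.sum M).ModelsT T := by
  refine ⟨?_, ?_, ?_⟩
  · intro c hc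
    have hb := fun i => (h i).1 c hc
    cases c with
    | top A => exact fun d => hb d.1 d.2
    | bot A => exact fun d hd => hb d.1 d.2 hd
    | conj A₁ A₂ B => exact fun d h₁ h₂ => hb d.1 d.2 h₁ h₂
    | ex A r B =>
      rintro ⟨i, d⟩ hd
      obtain ⟨e, hr, he⟩ := hb i d hd
      exact ⟨(⟨i, e⟩ : Σ i, (M i).Dom), rel_sum.2 ⟨i, d, e, rfl, rfl, hr⟩, he⟩
    | all A r B =>
      rintro ⟨i, d⟩ hd e hr
      obtain ⟨e, rfl, hr'⟩ := exists_of_rel_sum hr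
      exact hb i d hd e hr'
  · rintro p hp ⟨i, d⟩ e hr
    obtain ⟨e, rfl, hr'⟩ := exists_of_rel_sum hr
    exact rel_sum.2 ⟨i, d, e, rfl, rfl, (h i).2.1 p hp _ _ hr'⟩
  · rintro r hr ⟨i, d⟩ e e' h₁ h₂
    obtain ⟨e, rfl, h₃⟩ := exists_of_rel_sum h₁
    obtain ⟨e', rfl, h₄⟩ := exists_of_rel_sum h₂
    rw [(h i).2.2 r hr _ _ _ h₃ h₄]

theorem ELI.mem_ext_sum {C : ELI NC NR} {i : ι} {d : (M i).Dom} :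
    (⟨i, d⟩ : Σ i, (M i).Dom) ∈ C.ext (Interp.sum M) ↔ d ∈ C.ext (M i) := by
  induction C generalizing d with
  | top => exact Iff.rfl
  | atom A => exact Iff.rfl
  | conj C D hC hD => exact and_congr hC hD
  | ex r C ih =>
    constructor
    · rintro ⟨e, hr, he⟩
      obtain ⟨e, rfl, hr'⟩ := Interp.exists_of_rel_sum hr
      exact ⟨e, hr', ih.1 he⟩
    · rintro ⟨e, hr, he⟩
      exact ⟨(⟨i, e⟩ : Σ i, (M i).Dom), Interp.rel_sum.2 ⟨i, d, e, rfl, rfl, hr⟩, ih.2 he⟩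

end Sum

/-- The ELI concept follows from a set of ELI concepts. -/
def TBox.EntailsELI (NI : Type u) (T : TBox NC NR) (t : Set (ELI NC NR)) (B : ELI NC NR) : Prop :=
  ∀ I : Interp NC NR NI, I.ModelsT T → ∀ d, (∀ C ∈ t, d ∈ C.ext I) → d ∈ B.ext I

/-- There is a model with an element whose ELI concepts are exactly those that follow from a
satisfiable set. -/
theorem TBox.exists_exact_model {T : TBox NC NR} {t : Set (ELI NC NR)}
    (ht : ∃ I : Interp NC NR NI, I.ModelsT T ∧ ∃ d, ∀ C ∈ t, d ∈ C.ext I) :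
    ∃ I : Interp NC NR NI, I.ModelsT T ∧ ∃ d, ∀ C, d ∈ C.ext I ↔ T.EntailsELI NI t C := by
  obtain ⟨I₀, hI₀, d₀, hd₀⟩ := ht
  have hex : ∀ B : {B : ELI NC NR // ¬ T.EntailsELI NI t B}, ∃ I : Interp NC NR NI,
      I.ModelsT T ∧ ∃ d, (∀ C ∈ t, d ∈ C.ext I) ∧ d ∉ B.1.ext I := by
    rintro ⟨B, hB⟩
    unfold EntailsELI at hB
    push Not at hB
    obtain ⟨I, hI, d, hd, hB⟩ := hB
    exact ⟨I, hI, d, hd, hB⟩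
  choose M hM e he heB using hex
  -- The index `none` carries the given model, so the product is over a non-empty family even if
  -- every concept is entailed.
  let N : Option {B : ELI NC NR // ¬ T.EntailsELI NI t B} → Interp NC NR NI :=
    fun o => o.elim I₀ M
  have hN : ∀ o, (N o).ModelsT T := by
    rintro (_ | B)
    · exact hI₀
    · exact hM B
  let d : ∀ o, (N o).Dom := fun o => match o with
    | none => d₀
    | some B => e B
  have hNt : (Interp.prod N).ModelsT T := Interp.modelsT_prod hN
  refine ⟨Interp.prod N, hNt, d, fun C => ⟨fun h => ?_, fun h => h _ hNt d ?_⟩⟩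
  · by_contra hC
    exact heB ⟨C, hC⟩ (ELI.mem_ext_prod.1 h (some ⟨C, hC⟩))
  · intro C hC
    refine ELI.mem_ext_prod.2 ?_
    rintro (_ | B)
    · exact hd₀ C hC
    · exact he B C hC

/-! ### Completeness of local reasoning -/

theorem ELI.conj_mem_sub {C D E : ELI NC NR} (h : conj C D ∈ E.sub) : C ∈ E.sub ∧ D ∈ E.sub := by
  induction E with
  | top => simp [sub] at h
  | atom A => simp [sub] at h
  | conj C' D' hC hD =>
    simp only [sub, Set.mem_insert_iff, conj.injEq, Set.mem_union] at h ⊢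
    rcases h with ⟨rfl, rfl⟩ | h | h
    · exact ⟨Or.inr (Or.inl (mem_sub_self _)), Or.inr (Or.inr (mem_sub_self _))⟩
    · exact ⟨Or.inr (Or.inl (hC h).1), Or.inr (Or.inl (hC h).2)⟩
    · exact ⟨Or.inr (Or.inr (hD h).1), Or.inr (Or.inr (hD h).2)⟩
  | ex r C' hC =>
    simp only [sub, Set.mem_insert_iff, reduceCtorEq, false_or] at h
    exact ⟨Or.inr (hC h).1, Or.inr (hC h).2⟩

theorem ELI.ex_mem_sub {r : Role NR} {C E : ELI NC NR} (h : ex r C ∈ E.sub) : C ∈ E.sub := by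
  induction E with
  | top => simp [sub] at h
  | atom A => simp [sub] at h
  | conj C' D' hC hD =>
    simp only [sub, Set.mem_insert_iff, reduceCtorEq, false_or, Set.mem_union] at h ⊢
    exact Or.inr (h.imp hC hD)
  | ex r C' hC =>
    simp only [sub, Set.mem_insert_iff, ex.injEq] at h ⊢
    rcases h with ⟨rfl, rfl⟩ | h
    · exact Or.inr (mem_sub_self _)
    · exact Or.inr (hC h)

/-- The ELI concept holds at the individual in all models of the TBox and the ABox. -/
def TBox.EntailsELIAt (T : TBox NC NR) (𝒜 : ABox NC NR NI) (C : ELI NC NR) (a : NI) : Prop :=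
  ∀ I : Interp NC NR NI, I.ModelsT T → I.ModelsA 𝒜 → ∃ d, I.name a = some d ∧ d ∈ C.ext I

/-- An assignment of sets of ELI concepts to individuals that is closed under entailment at one
individual and along role assertions contains all concepts entailed by the ABox. -/
theorem TBox.mem_of_entailsELIAt {T : TBox NC NR} (hT : T.FunctionalNoSubroles)
    {𝒜 : ABox NC NR NI} (hc : T.Consistent 𝒜) (D : NI → Set (ELI NC NR))
    (hsat : ∀ a ∈ 𝒜.ind, ∃ I : Interp NC NR NI, I.ModelsT T ∧ ∃ d, ∀ C ∈ D a, d ∈ C.ext I)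
    (hconc : ∀ A a, (A, a) ∈ 𝒜.concepts → ELI.atom A ∈ D a)
    (hloc : ∀ a ∈ 𝒜.ind, ∀ t ⊆ D a, t.Finite → ∀ B, T.EntailsELI NI t B → B ∈ D a)
    (hedge : ∀ r a b C B, 𝒜.HasRole r a b → C ∈ D a →
      (∀ I : Interp NC NR NI, I.ModelsT T → ∀ d e, I.rel r d e → d ∈ C.ext I → e ∈ B.ext I) →
      B ∈ D b)
    {C₀ : ELI NC NR} {a : NI} (ha : a ∈ 𝒜.ind) (hC₀ : T.EntailsELIAt 𝒜 C₀ a) : C₀ ∈ D a := by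
  -- All concepts relevant to `T`, `𝒜` and `C₀`. Finiteness of `S` is what makes `hloc`, stated for
  -- finite sets only, applicable.
  let S : Set (ELI NC NR) :=
    ELI.atom '' T.names ∪ (fun p => ELI.atom p.1) '' (𝒜.concepts : Set (NC × NI)) ∪ C₀.sub
  have hS : S.Finite := ((T.finite_names.image _).union (𝒜.concepts.finite_toSet.image _)).union
    C₀.finite_sub
  have hne : Nonempty 𝒜.ind := ⟨⟨a, ha⟩⟩
  have hex : ∀ x : 𝒜.ind, ∃ I : Interp NC NR NI, I.ModelsT T ∧ ∃ d, ∀ C ∈ S,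
      d ∈ C.ext I ↔ C ∈ D x := by
    intro x
    obtain ⟨I, hI, d, hd⟩ := hsat x x.2
    obtain ⟨J, hJ, e, he⟩ := TBox.exists_exact_model (t := S ∩ D x)
      ⟨I, hI, d, fun C hC => hd C hC.2⟩
    refine ⟨J, hJ, e, fun C hC => ?_⟩
    rw [he]
    exact ⟨hloc x x.2 _ Set.inter_subset_right (hS.inter_of_left _) C,
      fun h _ _ _ hd => hd C ⟨hC, h⟩⟩
  choose M hM e he using hex
  -- The disjoint sum collects the exact models of all individuals into the single base model of the
  -- forest.
  let I := Interp.sum M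
  have hI : I.ModelsT T := Interp.modelsT_sum hM
  let pos : 𝒜.ind → I.Dom := fun x => (⟨x, e x⟩ : Σ i, (M i).Dom)
  have hpos : ∀ x, ∀ C ∈ S, pos x ∈ C.ext I ↔ C ∈ D x :=
    fun x C hC => ELI.mem_ext_sum.trans (he x C hC)
  have hatom : ∀ x, ∀ A ∈ T.names, pos x ∈ I.conc A ↔ ELI.atom A ∈ D x :=
    fun x A hA => hpos x (.atom A) (Or.inl (Or.inl ⟨A, hA, rfl⟩))
  let F : ForestData T NI :=
    { Root := 𝒜.ind
      edge := fun r a b => 𝒜.HasRole r a b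
      base := I
      pos := pos
      step := fun d r e => I.rel r d e
      nonempty := hne
      edge_inverse := fun r a b => 𝒜.hasRole_inverse r a b
      edge_all := by
        intro r s x y A B h hs hcT hA
        rw [hatom x A ⟨_, hcT, by simp [CI.conceptNames]⟩] at hA
        rw [hatom y B ⟨_, hcT, by simp [CI.conceptNames]⟩]
        exact hedge r x y _ _ h hA fun J hJ d e hde hd => hJ.1 _ hcT d hd e (hs.satRI hJ d e hde)
      edge_ex := by
        intro r x y A B h hr hcT hA
        rw [hatom x A ⟨_, hcT, by simp [CI.conceptNames]⟩] at hA
        rw [hatom y B ⟨_, hcT, by simp [CI.conceptNames]⟩]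
        refine hedge r x y _ _ h hA fun J hJ d e hde hd => ?_
        obtain ⟨e', he', hB⟩ := hJ.1 _ hcT d hd
        rwa [← hJ.2.2 r hr _ _ _ hde he'] at hB
      -- A common model of `T` and `𝒜` identifies the two successors, and distinct individuals
      -- denote distinct elements.
      edge_func := by
        intro r x y y' hr h h'
        obtain ⟨J, hJ, hA⟩ := hc
        obtain ⟨g, -, -, hg, hinj⟩ := hA.exists_naming
        exact Subtype.ext (hinj y.2 y'.2 (hJ.2.2 r hr _ _ _ (hg _ _ _ h) (hg _ _ _ h')))
      base_models := hI
      rel_of_step := fun _ _ _ h => h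
      step_ex := fun A r B d hcT hd => hI.1 _ hcT d hd }
  have hinj : Function.Injective (id : 𝒜.ind → F.Root) := fun _ _ h => h
  have hMA := F.modelsA_rootName hinj
    (fun A x h => (hpos x (.atom A) (Or.inl (Or.inr ⟨_, h, rfl⟩))).2 (hconc A x h))
    (fun r a b h => h)
  -- Gluing adds no concept from `C₀.sub`: the only new edges join roots, and closure of `D` under
  -- `hedge` accounts for them.
  have htruth : ∀ C ∈ C₀.sub, ∀ p : F.Node,
      p ∈ C.ext (F.interp (F.rootName id) (F.rootName_inj hinj)) → ForestData.elt p ∈ C.ext I := by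
    intro C
    induction C with
    | top => exact fun _ _ _ => trivial
    | atom A => exact fun _ p hp => hp
    | conj C D ihC ihD =>
      exact fun h p hp => ⟨ihC (ELI.conj_mem_sub h).1 p hp.1, ihD (ELI.conj_mem_sub h).2 p hp.2⟩
    | ex r C ih =>
      rintro h p ⟨q, hpq, hq⟩
      have hq := ih (ELI.ex_mem_sub h) q hq
      rcases ForestData.rel_base_of_edgeRel (ForestData.rel_interp.1 hpq) with
        ⟨x, y, s, rfl, rfl, hs, hsr⟩ | hr
      · have hy := (hpos y C (Or.inr (ELI.ex_mem_sub h))).1 hq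
        refine (hpos x (.ex r C) (Or.inr h)).2 ?_
        -- Along `s⁻` from `y` to `x`, the concept `C` at `y` entails `∃ r. C` at `x`.
        refine hedge s.inverse y x C _ ((𝒜.hasRole_inverse _ _ _).2 hs) hy ?_
        intro J hJ d e hde hd
        exact ⟨d, hsr.satRI hJ _ _ ((Interp.rel_inverse _ _ _ _).1 hde), hd⟩
      · exact ⟨_, hr, hq⟩
  obtain ⟨p, hp, hpC⟩ := hC₀ _ (F.modelsT_interp hT) hMA
  obtain rfl := Option.some.inj ((F.rootName_of_mem (𝒜 := 𝒜) id ha).symm.trans hp)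
  exact (hpos ⟨a, ha⟩ C₀ (Or.inr C₀.mem_sub_self)).1 (htruth C₀ C₀.mem_sub_self _ hpC)

/-! ### Unravelled ABoxes -/

/-- The role assertion `s(a,b)` for a possibly inverse role `s`. -/
def Role.assertion {X : Type*} : Role NR → X → X → NR × X × X
  | .name r, a, b => (r, a, b)
  | .inv r, a, b => (r, b, a)

theorem Role.assertion_cases {X : Type*} (s : Role NR) (a b : X) :
    s.assertion a b = (s.baseName, a, b) ∨ s.assertion a b = (s.baseName, b, a) := by
  cases s
  · exact Or.inl rfl
  · exact Or.inr rfl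

theorem Role.sym2_assertion {X : Type*} (s : Role NR) (a b : X) :
    s((s.assertion a b).2.1, (s.assertion a b).2.2) = s(a, b) := by
  cases s
  · rfl
  · exact Sym2.eq_swap

namespace ABox

variable {𝒜 : ABox NC NR NI}

theorem hasRole_iff {s : Role NR} {a b : NI} : 𝒜.HasRole s a b ↔ s.assertion a b ∈ 𝒜.roles := by
  cases s <;> rfl

/-- The non-backtracking walks in an ABox. -/
def IsWalk (𝒜 : ABox NC NR NI) (c : NI) (w : List (Role NR × NI)) : Prop :=
  HornALCHIF.Walk (fun a r b => 𝒜.HasRole r a b) (fun _ => False) c w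

theorem IsWalk.endpt_mem_ind {c : NI} (hc : c ∈ 𝒜.ind) {w : List (Role NR × NI)}
    (hw : 𝒜.IsWalk c w) : endpt c w ∈ 𝒜.ind := by
  cases hw with
  | nil => exact hc
  | cons _ h _ => exact HasRole.right_mem_ind h

theorem finite_walks (𝒜 : ABox NC NR NI) (c : NI) (N : ℕ) :
    {w | 𝒜.IsWalk c w ∧ w.length ≤ N}.Finite := by
  induction N with
  | zero =>
    refine (Set.finite_singleton []).subset ?_
    rintro w ⟨-, hw⟩
    exact List.length_eq_zero_iff.1 (Nat.le_zero.1 hw)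
  | succ N ih =>
    refine ((Set.Finite.image2 (fun (p : Role NR × NI × NI) w => (p.1, p.2.2) :: w)
      𝒜.finite_hasRole ih).insert []).subset ?_
    rintro w ⟨hw, hlen⟩
    cases hw with
    | nil => exact Or.inl rfl
    | @cons w s f hw h _ =>
      refine Or.inr ⟨(s, endpt c w, f), h, w, ⟨hw, ?_⟩, rfl⟩
      simpa using hlen

variable {ν : List (Role NR × NI) → NI} {c : NI} {N : ℕ}

theorem finite_unravel_concepts (𝒜 : ABox NC NR NI) (ν : List (Role NR × NI) → NI) (c : NI)
    (N : ℕ) : {p : NC × NI | ∃ w, (𝒜.IsWalk c w ∧ w.length ≤ N) ∧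
      (p.1, endpt c w) ∈ 𝒜.concepts ∧ p.2 = ν w}.Finite := by
  refine (Set.Finite.image2 (fun (p : NC × NI) w => (p.1, ν w)) 𝒜.concepts.finite_toSet
    (𝒜.finite_walks c N)).subset ?_
  rintro ⟨A, i⟩ ⟨w, hw, hA, rfl⟩
  exact ⟨_, hA, w, hw, rfl⟩

theorem finite_unravel_roles (𝒜 : ABox NC NR NI) (ν : List (Role NR × NI) → NI) (c : NI)
    (N : ℕ) : {p : NR × NI × NI | ∃ s f w, (𝒜.IsWalk c ((s, f) :: w) ∧ w.length < N) ∧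
      p = s.assertion (ν w) (ν ((s, f) :: w))}.Finite := by
  refine (Set.Finite.image2 (fun (p : Role NR × NI × NI) w =>
    p.1.assertion (ν w) (ν ((p.1, p.2.2) :: w))) 𝒜.finite_hasRole (𝒜.finite_walks c N)).subset ?_
  rintro p ⟨s, f, w, ⟨hw, hN⟩, rfl⟩
  obtain ⟨hw, h, -⟩ := Walk.cons_iff.1 hw
  exact ⟨(s, endpt c w, f), h, w, ⟨hw, hN.le⟩, rfl⟩

/-- The ABox of the walks of length at most `N` that start at `c`, named by `ν`. -/
noncomputable def unravel (𝒜 : ABox NC NR NI) (ν : List (Role NR × NI) → NI) (c : NI) (N : ℕ) :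
    ABox NC NR NI where
  concepts := (𝒜.finite_unravel_concepts ν c N).toFinset
  roles := (𝒜.finite_unravel_roles ν c N).toFinset

theorem mem_unravel_concepts {A : NC} {i : NI} : (A, i) ∈ (𝒜.unravel ν c N).concepts ↔
    ∃ w, (𝒜.IsWalk c w ∧ w.length ≤ N) ∧ (A, endpt c w) ∈ 𝒜.concepts ∧ i = ν w := by
  simp [unravel]

theorem mem_unravel_roles {p : NR × NI × NI} : p ∈ (𝒜.unravel ν c N).roles ↔
    ∃ s f w, (𝒜.IsWalk c ((s, f) :: w) ∧ w.length < N) ∧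
      p = s.assertion (ν w) (ν ((s, f) :: w)) := by
  simp [unravel]

theorem hasRole_unravel {w : List (Role NR × NI)} {s : Role NR} {f : NI}
    (h : 𝒜.IsWalk c ((s, f) :: w)) (hN : w.length < N) :
    (𝒜.unravel ν c N).HasRole s (ν w) (ν ((s, f) :: w)) :=
  hasRole_iff.2 (mem_unravel_roles.2 ⟨s, f, w, ⟨h, hN⟩, rfl⟩)

theorem over_unravel {Sg : Sig NC NR} (h : 𝒜.Over Sg) : (𝒜.unravel ν c N).Over Sg := by
  constructor
  · rintro ⟨A, i⟩ hp
    obtain ⟨w, -, hA, -⟩ := mem_unravel_concepts.1 hp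
    exact h.1 (A, endpt c w) hA
  · intro p hp
    obtain ⟨s, f, w, ⟨hw, -⟩, rfl⟩ := mem_unravel_roles.1 hp
    have hs := h.2 _ (hasRole_iff.1 (Walk.cons_iff.1 hw).2.1)
    rcases s with r | r <;> exact hs

/-- Depth at least one is needed for the root: without concept assertions, `c` occurs in the ABox
only through role assertions. -/
theorem mem_ind_unravel (hc : c ∈ 𝒜.ind) (hN : 1 ≤ N) {i : NI} :
    i ∈ (𝒜.unravel ν c N).ind ↔ ∃ w, (𝒜.IsWalk c w ∧ w.length ≤ N) ∧ i = ν w := by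
  constructor
  · intro hi
    rcases exists_hasRole hi with ⟨A, h⟩ | ⟨r, j, h⟩
    · obtain ⟨w, hw, -, hi⟩ := mem_unravel_concepts.1 h
      exact ⟨w, hw, hi⟩
    · have key : ∃ p ∈ (𝒜.unravel ν c N).roles, i = p.2.1 ∨ i = p.2.2 := by
        cases r with
        | name r => exact ⟨_, h, Or.inl rfl⟩
        | inv r => exact ⟨_, h, Or.inr rfl⟩
      obtain ⟨p, hp, hi⟩ := key
      obtain ⟨s, f, w, ⟨hw, hlen⟩, rfl⟩ := mem_unravel_roles.1 hp
      have : i = ν w ∨ i = ν ((s, f) :: w) := by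
        rcases s.assertion_cases (ν w) (ν ((s, f) :: w)) with h | h <;> rw [h] at hi
        · exact hi
        · exact hi.symm
      rcases this with rfl | rfl
      · exact ⟨w, ⟨(Walk.cons_iff.1 hw).1, hlen.le⟩, rfl⟩
      · exact ⟨_, ⟨hw, hlen⟩, rfl⟩
  · rintro ⟨w, ⟨hw, hlen⟩, rfl⟩
    cases hw with
    | nil =>
      rcases exists_hasRole hc with ⟨A, h⟩ | ⟨r, b, h⟩
      · exact Or.inl ⟨A, mem_unravel_concepts.2 ⟨[], ⟨.nil, hlen⟩, h, rfl⟩⟩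
      · exact (hasRole_unravel (.cons .nil h not_false) hN).left_mem_ind
    | cons hw h hok => exact (hasRole_unravel (.cons hw h hok) hlen).right_mem_ind

theorem treeShaped_unravel (hν : Function.Injective ν) (hc : c ∈ 𝒜.ind) (hN : 1 ≤ N) :
    (𝒜.unravel ν c N).TreeShaped := by
  have hlen : ∀ (w : List (Role NR × NI)) a, ν w ≠ ν (a :: w) := by
    intro w a h
    simpa using congrArg List.length (hν h)
  refine ⟨fun r a h => ?_, ?_, ?_⟩
  · obtain ⟨s, f, w, -, h⟩ := mem_unravel_roles.1 h
    rcases s.assertion_cases (ν w) (ν ((s, f) :: w)) with h' | h' <;> rw [h'] at h <;>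
      simp only [Prod.mk.injEq] at h
    · exact hlen w _ (h.2.1.symm.trans h.2.2)
    · exact hlen w _ (h.2.2.symm.trans h.2.1)
  · have hind : ∀ i : (𝒜.unravel ν c N).ind, ∃ w, (𝒜.IsWalk c w ∧ w.length ≤ N) ∧ i = ν w :=
      fun i => (mem_ind_unravel hc hN).1 i.2
    choose W hW hWi using hind
    have hWν : ∀ w (h : ν w ∈ (𝒜.unravel ν c N).ind), W ⟨ν w, h⟩ = w :=
      fun w h => (hν (hWi ⟨ν w, h⟩)).symm
    have htail : ∀ i, 𝒜.IsWalk c (W i).tail ∧ (W i).tail.length ≤ N := by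
      intro i
      obtain ⟨h, hl⟩ := hW i
      refine ⟨?_, by rw [List.length_tail]; omega⟩
      cases h' : W i with
      | nil => exact .nil
      | cons x w => rw [h'] at h; exact (Walk.cons_iff.1 h).1
    let par : (𝒜.unravel ν c N).ind → (𝒜.unravel ν c N).ind := fun i =>
      ⟨ν (W i).tail, (mem_ind_unravel hc hN).2 ⟨_, htail i, rfl⟩⟩
    let root : (𝒜.unravel ν c N).ind :=
      ⟨ν [], (mem_ind_unravel hc hN).2 ⟨[], ⟨.nil, by simp⟩, rfl⟩⟩
    have hroot : ∀ i, i ≠ root ↔ W i ≠ [] := by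
      intro i
      refine not_congr ⟨fun h => by rw [h]; exact hWν _ _, fun h => Subtype.ext ?_⟩
      rw [hWi i, h]
    refine isTree_of_parent _ root par (fun i => (W i).length) ?_ ?_
    · intro i hi
      change (W ⟨ν (W i).tail, _⟩).length < _
      rw [hWν, List.length_tail]
      have := List.length_pos_iff.2 ((hroot i).1 hi)
      omega
    · have hedge : ∀ i j : (𝒜.unravel ν c N).ind,
          (∃ r, (r, (i : NI), (j : NI)) ∈ (𝒜.unravel ν c N).roles ∨
            (r, (j : NI), (i : NI)) ∈ (𝒜.unravel ν c N).roles) ↔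
          (i ≠ root ∧ j = par i) ∨ (j ≠ root ∧ i = par j) := by
        have h₁ : ∀ i j : (𝒜.unravel ν c N).ind, ∀ r,
            (r, (i : NI), (j : NI)) ∈ (𝒜.unravel ν c N).roles →
            (i ≠ root ∧ j = par i) ∨ (j ≠ root ∧ i = par j) := by
          rintro ⟨i, hi⟩ ⟨j, hj⟩ r h
          obtain ⟨s, f, w, -, h⟩ := mem_unravel_roles.1 h
          rcases s.assertion_cases (ν w) (ν ((s, f) :: w)) with h' | h' <;> rw [h'] at h <;>
            simp only [Prod.mk.injEq] at h <;> obtain ⟨-, rfl, rfl⟩ := h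
          · refine Or.inr ⟨(hroot _).2 (by rw [hWν]; simp), Subtype.ext ?_⟩
            simp [par, hWν]
          · refine Or.inl ⟨(hroot _).2 (by rw [hWν]; simp), Subtype.ext ?_⟩
            simp [par, hWν]
        have h₂ : ∀ i : (𝒜.unravel ν c N).ind, i ≠ root →
            ∃ r, (r, (i : NI), (par i : NI)) ∈ (𝒜.unravel ν c N).roles ∨
              (r, (par i : NI), (i : NI)) ∈ (𝒜.unravel ν c N).roles := by
          intro i hi
          have hi := (hroot i).1 hi
          obtain ⟨hw, hl⟩ := hW i
          have hii := hWi i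
          cases hWi' : W i with
          | nil => exact absurd hWi' hi
          | cons x w =>
            obtain ⟨s, f⟩ := x
            rw [hWi'] at hw hl hii
            have := hasRole_iff.1 (hasRole_unravel (ν := ν) hw (Nat.lt_of_succ_le hl))
            have hpar : (par i : NI) = ν w := by simp [par, hWi']
            rw [hpar, hii]
            rcases s.assertion_cases (ν w) (ν ((s, f) :: w)) with h' | h' <;> rw [h'] at this
            · exact ⟨_, Or.inr this⟩
            · exact ⟨_, Or.inl this⟩
        intro i j
        constructor
        · rintro ⟨r, h | h⟩
          · exact h₁ i j r h
          · exact (h₁ j i r h).symm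
        · rintro (⟨hi, rfl⟩ | ⟨hj, rfl⟩)
          · exact h₂ i hi
          · obtain ⟨r, h⟩ := h₂ j hj
            exact ⟨r, h.symm⟩
      intro i j
      rw [← hedge]
      refine (SimpleGraph.fromRel_adj _ _ _).trans ?_
      rw [← exists_or, and_iff_right_iff_imp, hedge]
      have hpar : ∀ i, i ≠ root → i ≠ par i := by
        intro i hi h
        have h := congrArg W h
        rw [hWν] at h
        have := List.length_pos_iff.2 ((hroot i).1 hi)
        have := congrArg List.length h
        rw [List.length_tail] at this
        omega
      rintro (⟨hi, rfl⟩ | ⟨hj, rfl⟩)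
      · exact hpar i hi
      · exact (hpar j hj).symm
  -- The longer of the two walks joined by an assertion has its role as the last label, so the pair
  -- of individuals determines the assertion; the swapped pairing contradicts the lengths. Parallel
  -- assertions of `𝒜` lead to different walks.
  · intro p hp p' hp' h
    obtain ⟨s, f, w, -, rfl⟩ := mem_unravel_roles.1 hp
    obtain ⟨s', f', w', -, rfl⟩ := mem_unravel_roles.1 hp'
    rw [Role.sym2_assertion, Role.sym2_assertion, Sym2.eq_iff] at h
    rcases h with ⟨h₁, h₂⟩ | ⟨h₁, h₂⟩
    · have h₁ := hν h₁
      have h₂ := hν h₂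
      simp only [List.cons.injEq, Prod.mk.injEq] at h₂
      obtain ⟨⟨rfl, rfl⟩, rfl⟩ := h₂
      rfl
    · have h₁ := congrArg List.length (hν h₁)
      have h₂ := congrArg List.length (hν h₂)
      simp only [List.length_cons] at h₁ h₂
      omega

end ABox

/-! ### Unravelled models -/

/-- Every model of a TBox has, for each role edge in a set `E` with finitely many edges at each
element, finitely many steps at each element that contain `E` and witness the existential
restrictions. -/
theorem Interp.ModelsT.exists_step {T : TBox NC NR} {I : Interp NC NR NI} (hI : I.ModelsT T)
    (E : I.Dom → Role NR → I.Dom → Prop) (hE : ∀ d r e, E d r e → I.rel r d e)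
    (hfin : ∀ d, {a : Role NR × I.Dom | E d a.1 a.2}.Finite) :
    ∃ step : I.Dom → Role NR → I.Dom → Prop,
      (∀ d r e, E d r e → step d r e) ∧ (∀ d r e, step d r e → I.rel r d e) ∧
      (∀ A r B d, CI.ex A r B ∈ T.cis → d ∈ I.conc A → ∃ e, step d r e ∧ e ∈ I.conc B) ∧
      ∀ d, {a : Role NR × I.Dom | step d a.1 a.2}.Finite := by
  -- One fixed witness for each inclusion and element keeps the number of steps finite.
  have hex : ∀ A r B d, ∃ e, CI.ex A r B ∈ T.cis → d ∈ I.conc A → I.rel r d e ∧ e ∈ I.conc B := by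
    intro A r B d
    by_cases h : CI.ex A r B ∈ T.cis ∧ d ∈ I.conc A
    · obtain ⟨e, he⟩ := hI.1 _ h.1 d h.2
      exact ⟨e, fun _ _ => he⟩
    · exact ⟨d, fun h₁ h₂ => absurd ⟨h₁, h₂⟩ h⟩
  choose wit hwit using hex
  refine ⟨fun d r e => E d r e ∨ ∃ A B, CI.ex A r B ∈ T.cis ∧ d ∈ I.conc A ∧ e = wit A r B d,
    fun d r e h => Or.inl h, ?_, ?_, ?_⟩
  · rintro d r e (h | ⟨A, B, hc, hd, rfl⟩)
    · exact hE d r e h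
    · exact (hwit A r B d hc hd).1
  · intro A r B d hc hd
    exact ⟨_, Or.inr ⟨A, B, hc, hd, rfl⟩, (hwit A r B d hc hd).2⟩
  · intro d
    have hT : {a : Role NR × I.Dom | ∃ A B, CI.ex A a.1 B ∈ T.cis ∧ a.2 = wit A a.1 B d}.Finite := by
      have : {x : NC × Role NR × NC | CI.ex x.1 x.2.1 x.2.2 ∈ T.cis}.Finite := by
        refine T.cis.finite_toSet.preimage (f := fun x : NC × Role NR × NC =>
          CI.ex x.1 x.2.1 x.2.2) ?_
        rintro ⟨A, r, B⟩ - ⟨A', r', B'⟩ - h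
        simpa using h
      refine (this.image fun x => (x.2.1, wit x.1 x.2.1 x.2.2 d)).subset ?_
      rintro ⟨r, e⟩ ⟨A, B, h, he⟩
      exact ⟨(A, r, B), h, Prod.ext rfl he.symm⟩
    refine ((hfin d).union hT).subset ?_
    rintro a (h | ⟨A, B, h, -, ha⟩)
    · exact Or.inl h
    · exact Or.inr ⟨A, B, h, ha⟩

theorem endpt_map {R D D' : Type*} (g : D → D') (c : D) (w : List (R × D)) :
    endpt (g c) (w.map (Prod.map id g)) = g (endpt c w) := by
  cases w <;> rfl

/-- Injectivity of `g` on the individuals keeps the image non-backtracking: a step that turns back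
in the image already did so in the ABox. -/
theorem ABox.IsWalk.map {𝒜 : ABox NC NR NI} {c : NI} (hc : c ∈ 𝒜.ind) {D : Type*} {g : NI → D}
    (hg : Set.InjOn g 𝒜.ind) {step : D → Role NR → D → Prop}
    (hstep : ∀ r a b, 𝒜.HasRole r a b → step (g a) r (g b)) {blocked : Role NR → Prop}
    (hb : ∀ r, ¬ blocked r) {w : List (Role NR × NI)} (hw : 𝒜.IsWalk c w) :
    Walk step blocked (g c) (w.map (Prod.map id g)) := by
  induction hw with
  | nil => exact .nil
  | @cons w s f hw h hok ih =>
    refine .cons ih ?_ ?_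
    · rw [endpt_map]
      exact hstep _ _ _ h
    · cases w with
      | nil => exact hb s
      | cons x w =>
        obtain ⟨r, e⟩ := x
        intro heq
        change (s, g f) = (r.inverse, endpt (g c) (w.map (Prod.map id g))) at heq
        rw [endpt_map, Prod.mk.injEq] at heq
        refine hok (Prod.ext heq.1 (hg h.right_mem_ind ?_ heq.2))
        exact ABox.IsWalk.endpt_mem_ind hc (Walk.cons_iff.1 hw).1

theorem ABox.IsWalk.map_inj {𝒜 : ABox NC NR NI} {c : NI} {D : Type*} {g : NI → D}
    (hg : Set.InjOn g 𝒜.ind) {w w' : List (Role NR × NI)} (hw : 𝒜.IsWalk c w)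
    (hw' : 𝒜.IsWalk c w') (h : w.map (Prod.map id g) = w'.map (Prod.map id g)) : w = w' := by
  induction hw generalizing w' with
  | nil => exact (List.map_eq_nil_iff.1 h.symm).symm
  | @cons w s f hw hs hok ih =>
    cases hw' with
    | nil => simp at h
    | @cons w' s' f' hw' hs' hok' =>
      simp only [List.map_cons, List.cons.injEq, Prod.map_apply, id_eq, Prod.mk.injEq] at h
      obtain ⟨⟨rfl, hf⟩, h⟩ := h
      rw [ih hw' h, hg hs.right_mem_ind hs'.right_mem_ind hf]

open Classical in
/-- A model of a TBox and an ABox has a weakly tree-shaped and finitely branching unravelling that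
is a model of the unravelled ABoxes and maps homomorphically to it. -/
theorem exists_unravelling {T : TBox NC NR} (hT : T.FunctionalNoSubroles) {𝒜 : ABox NC NR NI}
    {I : Interp NC NR NI} (hI : I.ModelsT T) (hA : I.ModelsA 𝒜)
    {ν : List (Role NR × NI) → NI} (hν : Function.Injective ν) {c : NI} (hc : c ∈ 𝒜.ind) :
    ∃ J : Interp NC NR NI, J.ModelsT T ∧ J.WeaklyTreeShaped ∧ J.FinitelyBranching ∧
      (∀ N, J.ModelsA (𝒜.unravel ν c N)) ∧
      ∃ f : J.Dom → I.Dom, (∀ (C : ELI NC NR) d, d ∈ C.ext J → f d ∈ C.ext I) ∧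
        ∀ w, 𝒜.IsWalk c w → ∃ d, J.name (ν w) = some d ∧ I.name (endpt c w) = some (f d) := by
  obtain ⟨g, hg, hgc, hgr, hinj⟩ := hA.exists_naming
  -- Steps include the images of all role assertions, so the walks of the ABox become nodes of the
  -- unravelled model.
  obtain ⟨step, hEs, hrel, hex, hfin⟩ := hI.exists_step
    (fun d r e => ∃ a b, 𝒜.HasRole r a b ∧ g a = d ∧ g b = e)
    (by rintro d r e ⟨a, b, h, rfl, rfl⟩; exact hgr r a b h)
    (fun d => (𝒜.finite_hasRole.image fun p => (p.1, g p.2.2)).subset (by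
      rintro ⟨r, e⟩ ⟨a, b, h, -, he⟩
      exact ⟨(r, a, b), h, Prod.ext rfl he⟩))
  let F : ForestData T NI := .ofModel hI (g c) step hrel hex
  have hedge : ∀ r x y, ¬ F.edge r x y := fun _ _ _ h => h
  have hstep : ∀ r a b, 𝒜.HasRole r a b → F.step (g a) r (g b) :=
    fun r a b h => hEs _ _ _ ⟨a, b, h, rfl, rfl⟩
  let node : ∀ w, 𝒜.IsWalk c w → F.Node := fun w hw =>
    ⟨(⟨⟩, w.map (Prod.map id g)), hw.map hc hinj hstep fun r h => h.2.elim fun _ h => h⟩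
  -- Each walk name denotes the image of its walk; all other names denote nothing.
  let nm : NI → Option F.Node := fun i =>
    if h : ∃ w, 𝒜.IsWalk c w ∧ ν w = i then some (node h.choose h.choose_spec.1) else none
  have hnm : ∀ w (hw : 𝒜.IsWalk c w), nm (ν w) = some (node w hw) := by
    intro w hw
    have h : ∃ w', 𝒜.IsWalk c w' ∧ ν w' = ν w := ⟨w, hw, rfl⟩
    have heq : h.choose = w := hν h.choose_spec.2
    refine (dif_pos h).trans (congrArg some (Subtype.ext ?_))
    simp only [node, heq]
  have hinjnm : ∀ a b p, nm a = some p → nm b = some p → a = b := by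
    intro a b p ha hb
    have hex : ∀ a, nm a = some p → ∃ w, ∃ hw : 𝒜.IsWalk c w, ν w = a ∧ node w hw = p := by
      intro a ha
      by_cases h : ∃ w, 𝒜.IsWalk c w ∧ ν w = a
      · obtain ⟨w, hw, rfl⟩ := h
        exact ⟨w, hw, rfl, Option.some.inj ((hnm w hw).symm.trans ha)⟩
      · exact absurd ((dif_neg h : nm a = none).symm.trans ha) (by simp)
    obtain ⟨w, hw, rfl, rfl⟩ := hex a ha
    obtain ⟨w', hw', rfl, h⟩ := hex b hb
    rw [hw'.map_inj hinj hw (congrArg (fun p : F.Node => p.1.2) h)]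
  have helt : ∀ w (hw : 𝒜.IsWalk c w), ForestData.elt (node w hw) = g (endpt c w) :=
    fun w hw => endpt_map g c w
  refine ⟨F.interp nm hinjnm, F.modelsT_interp hT,
    ForestData.weaklyTreeShaped_interp hedge ⟨⟩ (fun _ => rfl),
    ForestData.finitelyBranching_interp hedge hfin, ?_, ForestData.elt, ?_, ?_⟩
  · intro N
    refine ⟨fun A i h => ?_, fun r a b h => ?_⟩
    · obtain ⟨w, ⟨hw, -⟩, hA, rfl⟩ := ABox.mem_unravel_concepts.1 h
      refine ⟨_, hnm w hw, ?_⟩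
      change ForestData.elt (node w hw) ∈ I.conc A
      rw [helt w hw]
      exact hgc A _ hA
    · obtain ⟨s, f, w, ⟨hw, -⟩, h⟩ := ABox.mem_unravel_roles.1 h
      have hw' := (Walk.cons_iff.1 hw).1
      have hr : ForestData.edgeRel s (node w hw') (node _ hw) :=
        Or.inr (Or.inl ⟨s, g f, rfl, .refl⟩)
      cases s with
      | name s =>
        simp only [Role.assertion, Prod.mk.injEq] at h
        obtain ⟨rfl, rfl, rfl⟩ := h
        exact ⟨_, _, hnm w hw', hnm _ hw, hr⟩
      | inv s =>
        simp only [Role.assertion, Prod.mk.injEq] at h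
        obtain ⟨rfl, rfl, rfl⟩ := h
        exact ⟨_, _, hnm _ hw, hnm w hw', ForestData.edgeRel_inverse_of hr⟩
  · intro C d hd
    refine ELI.mem_ext_of_hom (J := I) ForestData.elt (fun A d hd => hd) (fun r d e h => ?_) hd
    rcases ForestData.rel_base_of_edgeRel (ForestData.rel_interp.1 h) with ⟨x, y, s, -, -, h, -⟩ | h
    · exact (hedge _ _ _ h).elim
    · exact h
  · intro w hw
    refine ⟨node w hw, hnm w hw, ?_⟩
    rw [helt w hw]
    exact hg _ (hw.endpt_mem_ind hc)

/-- An ELI concept entailed at an individual is entailed at the root of a sufficiently deep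
unravelling of the ABox. -/
theorem TBox.EntailsELIAt.exists_unravel {T : TBox NC NR} (hT : T.FunctionalNoSubroles)
    {𝒜 : ABox NC NR NI} (hc : T.Consistent 𝒜) {ν : List (Role NR × NI) → NI}
    (hν : Function.Injective ν) {C : ELI NC NR} {a : NI} (ha : a ∈ 𝒜.ind)
    (h : T.EntailsELIAt 𝒜 C a) : ∃ n, ∀ N, n ≤ N → T.EntailsELIAt (𝒜.unravel ν a N) C (ν []) := by
  -- The number `n` counts the levels of the unravelling needed below the copy `w` of `b`. All
  -- starting points `c` are considered because some `b` may be unreachable from `a`: with `c = a`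
  -- only, the condition there would be vacuous and `D b` unsatisfiable.
  let D : NI → Set (ELI NC NR) := fun b => {B | ∃ n, ∀ c ∈ 𝒜.ind, ∀ N w, 𝒜.IsWalk c w →
    endpt c w = b → w.length + n ≤ N → T.EntailsELIAt (𝒜.unravel ν c N) B (ν w)}
  have key : C ∈ D a := by
    refine T.mem_of_entailsELIAt hT hc D ?_ ?_ ?_ ?_ ha h
    · intro b hb
      obtain ⟨I, hI, hA⟩ := hc
      obtain ⟨J, hJ, -, -, hJA, f, -, hf⟩ := exists_unravelling hT hI hA hν hb
      obtain ⟨d, hd, -⟩ := hf [] .nil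
      refine ⟨J, hJ, d, fun B hB => ?_⟩
      obtain ⟨n, hn⟩ := hB
      obtain ⟨d', hd', hB⟩ := hn b hb n [] .nil rfl (by simp) J hJ (hJA n)
      obtain rfl := Option.some.inj (hd.symm.trans hd')
      exact hB
    · intro A b hA
      refine ⟨0, fun c hc N w hw hb hN J hJ hJA => hJA.1 A (ν w) ?_⟩
      exact ABox.mem_unravel_concepts.2 ⟨w, ⟨hw, hN⟩, hb ▸ hA, rfl⟩
    · intro b hb t ht hfin B hB
      have ht' : ∀ B ∈ t, ∃ n, ∀ c ∈ 𝒜.ind, ∀ N w, 𝒜.IsWalk c w → endpt c w = b →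
          w.length + n ≤ N → T.EntailsELIAt (𝒜.unravel ν c N) B (ν w) := fun B hB => ht hB
      choose! n hn using ht'
      -- The extra level ensures that `ν w` is an individual of the unravelled ABox, even if `t` is
      -- empty.
      refine ⟨hfin.toFinset.sup n + 1, fun c hc N w hw hwb hN J hJ hJA => ?_⟩
      have hle : ∀ C ∈ t, w.length + n C ≤ N := fun C hC => by
        have := Finset.le_sup (f := n) (hfin.mem_toFinset.2 hC)
        omega
      obtain ⟨d, hd⟩ := hJA.name_of_mem_ind
        ((ABox.mem_ind_unravel hc (by omega)).2 ⟨w, ⟨hw, by omega⟩, rfl⟩)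
      refine ⟨d, hd, hB J hJ d fun C hC => ?_⟩
      obtain ⟨d', hd', hC⟩ := hn C hC c hc N w hw hwb (hle C hC) J hJ hJA
      obtain rfl := Option.some.inj (hd.symm.trans hd')
      exact hC
    · rintro r b b' C B hr ⟨n, hn⟩ hB
      -- A copy of `b` next to `w` is obtained by extending `w` by one step or, if that would
      -- backtrack, by dropping its last step. The neighbour is at most one level deeper.
      refine ⟨n + 1, fun c hc N w hw hwb hN J hJ hJA => ?_⟩
      have hex : ∃ w', 𝒜.IsWalk c w' ∧ endpt c w' = b ∧ w'.length + n ≤ N ∧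
          (𝒜.unravel ν c N).HasRole r (ν w') (ν w) := by
        have hr' : 𝒜.HasRole r.inverse (endpt c w) b := by
          rw [hwb, ABox.hasRole_inverse]
          exact hr
        by_cases hok : StepOk (fun _ => False) c w r.inverse b
        · refine ⟨(r.inverse, b) :: w, .cons hw hr' hok, rfl, by simp only [List.length_cons]; omega,
            ?_⟩
          rw [← ABox.hasRole_inverse]
          exact ABox.hasRole_unravel (.cons hw hr' hok) (by omega)
        · cases w with
          | nil => exact absurd not_false hok
          | cons x w =>
            obtain ⟨s, f⟩ := x
            have heq : (r.inverse, b) = (s.inverse, endpt c w) := not_not.1 hok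
            rw [Prod.mk.injEq] at heq
            obtain rfl : r = s := by
              rw [← r.inverse_inverse, heq.1, s.inverse_inverse]
            simp only [List.length_cons] at hN
            exact ⟨w, (Walk.cons_iff.1 hw).1, heq.2.symm, by omega,
              ABox.hasRole_unravel hw (by omega)⟩
      obtain ⟨w', hw', hb, hlen, hrel⟩ := hex
      obtain ⟨d, hd, hC⟩ := hn c hc N w' hw' hb hlen J hJ hJA
      obtain ⟨d', e, hd', he, hde⟩ := hJA.rel_of_hasRole hrel
      obtain rfl := Option.some.inj (hd.symm.trans hd')
      exact ⟨e, he, hB J hJ d e hde hC⟩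
  obtain ⟨n, hn⟩ := key
  exact ⟨n, fun N hN => hn a ha N [] .nil rfl (by simpa using hN)⟩

/-! ### From ELI concepts to tree-shaped queries -/

/-- Data for a tree-shaped query with variables `0, …, n` and answer variable `0`, in which each
variable other than `0` is linked to a smaller one, its parent. -/
structure QueryTree (NC NR : Type u) : Type u where
  n : ℕ
  par : ℕ → ℕ
  lab : ℕ → Role NR
  atoms : Finset (NC × ℕ)
  par_lt : ∀ i, 1 ≤ i → i ≤ n → par i < i
  atoms_le : ∀ p ∈ atoms, p.2 ≤ n

namespace QueryTree

/-- The conditions on matches of the query. -/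
def Matches (Q : QueryTree NC NR) (I : Interp NC NR NI) (π : ℕ → I.Dom) : Prop :=
  (∀ A z, (A, z) ∈ Q.atoms → π z ∈ I.conc A) ∧
  (∀ i, 1 ≤ i → i ≤ Q.n → I.rel (Q.lab i) (π (Q.par i)) (π i))

/-- The query uses only symbols from the signature. -/
def Over (Q : QueryTree NC NR) (Sg : Sig NC NR) : Prop :=
  (∀ p ∈ Q.atoms, p.1 ∈ Sg.concepts) ∧ ∀ i, 1 ≤ i → i ≤ Q.n → (Q.lab i).baseName ∈ Sg.roles

/-- A conjunction treats its parts in turn at the same variable, and `∃ r. C` adds `Q.n + 1` as a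
fresh child of `v`. Extended matches keep their values on the old variables, which allows the
extensions to be chained. -/
theorem exists_extend (NI : Type u) {Sg : Sig NC NR} (C : ELI NC NR) (hC : C.Over Sg)
    (Q : QueryTree NC NR) (hQ : Q.Over Sg) (v : ℕ) (hv : v ≤ Q.n) :
    ∃ Q' : QueryTree NC NR, Q'.Over Sg ∧ Q.n ≤ Q'.n ∧ ∀ I : Interp NC NR NI,
      (∀ π, Q'.Matches I π → Q.Matches I π ∧ π v ∈ C.ext I) ∧
      (∀ π, Q.Matches I π → π v ∈ C.ext I → ∃ π', (∀ i ≤ Q.n, π' i = π i) ∧ Q'.Matches I π') := by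
  classical
  induction C generalizing Q v with
  | top => exact ⟨Q, hQ, le_rfl, fun I => ⟨fun π h => ⟨h, trivial⟩, fun π h _ => ⟨π, by simp, h⟩⟩⟩
  | atom A =>
    refine ⟨{ Q with
      atoms := insert (A, v) Q.atoms
      atoms_le := fun p hp => ?_ }, ⟨fun p hp => ?_, hQ.2⟩, le_rfl, fun I => ⟨?_, ?_⟩⟩
    · rcases Finset.mem_insert.1 hp with rfl | hp
      · exact hv
      · exact Q.atoms_le p hp
    · rcases Finset.mem_insert.1 hp with rfl | hp
      · exact hC
      · exact hQ.1 p hp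
    · intro π h
      exact ⟨⟨fun B z hB => h.1 B z (Finset.mem_insert_of_mem hB), h.2⟩,
        h.1 A v (Finset.mem_insert_self _ _)⟩
    · intro π h hA
      refine ⟨π, fun _ _ => rfl, fun B z hB => ?_, h.2⟩
      rcases Finset.mem_insert.1 hB with hB | hB
      · obtain ⟨rfl, rfl⟩ := Prod.mk.inj hB
        exact hA
      · exact h.1 B z hB
  | conj C D ihC ihD =>
    obtain ⟨Q₁, hQ₁, hn₁, h₁⟩ := ihC hC.1 Q hQ v hv
    obtain ⟨Q₂, hQ₂, hn₂, h₂⟩ := ihD hC.2 Q₁ hQ₁ v (hv.trans hn₁)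
    refine ⟨Q₂, hQ₂, hn₁.trans hn₂, fun I => ⟨fun π h => ?_, fun π h hd => ?_⟩⟩
    · obtain ⟨h, hD⟩ := (h₂ I).1 π h
      obtain ⟨h, hC⟩ := (h₁ I).1 π h
      exact ⟨h, hC, hD⟩
    · obtain ⟨π₁, he₁, hm₁⟩ := (h₁ I).2 π h hd.1
      obtain ⟨π₂, he₂, hm₂⟩ := (h₂ I).2 π₁ hm₁ (by rw [he₁ v hv]; exact hd.2)
      exact ⟨π₂, fun i hi => (he₂ i (hi.trans hn₁)).trans (he₁ i hi), hm₂⟩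
  | ex r C ih =>
    let Q₁ : QueryTree NC NR :=
      { n := Q.n + 1
        par := Function.update Q.par (Q.n + 1) v
        lab := Function.update Q.lab (Q.n + 1) r
        atoms := Q.atoms
        par_lt := by
          intro i h₁ hi
          rcases Nat.le_succ_iff.1 hi with hi | rfl
          · rw [Function.update_of_ne (by omega)]
            exact Q.par_lt i h₁ hi
          · rw [Function.update_self]
            omega
        atoms_le := fun p hp => (Q.atoms_le p hp).trans (Nat.le_succ _) }
    have hQ₁ : Q₁.Over Sg := by
      refine ⟨hQ.1, fun i h₁ hi => ?_⟩
      change (Function.update Q.lab (Q.n + 1) r i).baseName ∈ _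
      rcases Nat.le_succ_iff.1 hi with hi | rfl
      · rw [Function.update_of_ne (by omega)]
        exact hQ.2 i h₁ hi
      · rw [Function.update_self]
        exact hC.1
    have hm : ∀ (I : Interp NC NR NI) π, Q₁.Matches I π ↔
        Q.Matches I π ∧ I.rel r (π v) (π (Q.n + 1)) := by
      intro I π
      constructor
      · intro h
        refine ⟨⟨h.1, fun i h₁ hi => ?_⟩, ?_⟩
        · have := h.2 i h₁ (hi.trans (Nat.le_succ _))
          simpa [Q₁, Function.update_of_ne (show i ≠ Q.n + 1 by omega)] using this
        · simpa [Q₁] using h.2 (Q.n + 1) (by omega) le_rfl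
      · rintro ⟨h, hr⟩
        refine ⟨h.1, fun i h₁ hi => ?_⟩
        rcases Nat.le_succ_iff.1 hi with hi | rfl
        · simpa [Q₁, Function.update_of_ne (show i ≠ Q.n + 1 by omega)] using h.2 i h₁ hi
        · simpa [Q₁] using hr
    obtain ⟨Q₂, hQ₂, hn₂, h₂⟩ := ih hC.2 Q₁ hQ₁ (Q.n + 1) le_rfl
    refine ⟨Q₂, hQ₂, (Nat.le_succ _).trans hn₂, fun I => ⟨fun π h => ?_, fun π h hd => ?_⟩⟩
    · obtain ⟨h, hC⟩ := (h₂ I).1 π h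
      obtain ⟨h, hr⟩ := (hm I π).1 h
      exact ⟨h, _, hr, hC⟩
    · obtain ⟨e, hr, he⟩ := hd
      have hup : ∀ i ≤ Q.n, Function.update π (Q.n + 1) e i = π i :=
        fun i hi => Function.update_of_ne (by omega) _ _
      have hself : Function.update π (Q.n + 1) e (Q.n + 1) = e := Function.update_self _ _ _
      have h₁ : Q₁.Matches I (Function.update π (Q.n + 1) e) := by
        refine (hm I _).2 ⟨⟨fun A z hA => ?_, fun i h₁ hi => ?_⟩, ?_⟩
        · rw [hup z (Q.atoms_le _ hA)]
          exact h.1 A z hA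
        · rw [hup i hi, hup _ ((Q.par_lt i h₁ hi).le.trans hi)]
          exact h.2 i h₁ hi
        · rw [hup v hv, hself]
          exact hr
      obtain ⟨π₂, he₂, hm₂⟩ := (h₂ I).2 _ h₁ (by rw [hself]; exact he)
      exact ⟨π₂, fun i hi => (he₂ i (hi.trans (Nat.le_succ _))).trans (hup i hi), hm₂⟩

open Classical in
/-- The query given by the data. -/
noncomputable def toCQ (Q : QueryTree NC NR) : CQ NC NR where
  vars := Finset.range (Q.n + 1)
  ans := [0]
  conceptAtoms := Q.atoms
  roleAtoms := (Finset.Icc 1 Q.n).image fun i => (Q.lab i).assertion (Q.par i) i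
  ans_mem := by simp
  concept_mem p hp := by simpa [Nat.lt_succ_iff] using Q.atoms_le p hp
  role_mem := by
    intro p hp
    obtain ⟨i, hi, rfl⟩ := Finset.mem_image.1 hp
    rw [Finset.mem_Icc] at hi
    have := Q.par_lt i hi.1 hi.2
    simp only [Finset.mem_range]
    rcases (Q.lab i).assertion_cases (Q.par i) i with h | h <;> rw [h] <;> dsimp only <;> omega

theorem mem_roleAtoms {Q : QueryTree NC NR} {p : NR × ℕ × ℕ} :
    p ∈ Q.toCQ.roleAtoms ↔ ∃ i, (1 ≤ i ∧ i ≤ Q.n) ∧ (Q.lab i).assertion (Q.par i) i = p := by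
  simp [toCQ]

theorem isMatch_toCQ {Q : QueryTree NC NR} {I : Interp NC NR NI} {π : ℕ → I.Dom} :
    Q.toCQ.IsMatch I π ↔ Q.Matches I π := by
  refine and_congr Iff.rfl ⟨fun h i h₁ hi => ?_, fun h r z z' hr => ?_⟩
  · cases hl : Q.lab i with
    | name r => exact h r _ _ (mem_roleAtoms.2 ⟨i, ⟨h₁, hi⟩, by rw [hl]; rfl⟩)
    | inv r => exact h r _ _ (mem_roleAtoms.2 ⟨i, ⟨h₁, hi⟩, by rw [hl]; rfl⟩)
  · obtain ⟨i, ⟨h₁, hi⟩, heq⟩ := mem_roleAtoms.1 hr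
    have := h i h₁ hi
    cases hl : Q.lab i <;> rw [hl] at this heq <;>
      simp only [Role.assertion, Prod.mk.injEq] at heq <;> obtain ⟨rfl, rfl, rfl⟩ := heq <;>
      exact this

theorem over_toCQ {Q : QueryTree NC NR} {Sg : Sig NC NR} (h : Q.Over Sg) : Q.toCQ.Over Sg := by
  refine ⟨h.1, fun p hp => ?_⟩
  obtain ⟨i, ⟨h₁, hi⟩, rfl⟩ := mem_roleAtoms.1 hp
  have := h.2 i h₁ hi
  rcases (Q.lab i).assertion_cases (Q.par i) i with h | h <;> rw [h] <;> exact this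

/-- Parents are smaller, so the variables form a tree with root `0`, and the larger end of an edge
determines its atom. -/
theorem isOneTCQ_toCQ (Q : QueryTree NC NR) : Q.toCQ.IsOneTCQ := by
  refine ⟨⟨fun r z h => ?_, ?_, fun p hp p' hp' h => ?_⟩, 0, rfl⟩
  · obtain ⟨i, ⟨h₁, hi⟩, heq⟩ := mem_roleAtoms.1 h
    have := Q.par_lt i h₁ hi
    rcases (Q.lab i).assertion_cases (Q.par i) i with h' | h' <;> rw [h'] at heq <;>
      simp only [Prod.mk.injEq] at heq <;> omega
  · have hle : ∀ v : Q.toCQ.vars, (v : ℕ) ≤ Q.n := fun v =>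
      Nat.lt_succ_iff.1 (Finset.mem_range.1 v.2)
    have hmem : ∀ {i}, i ≤ Q.n → i ∈ Q.toCQ.vars := fun hi =>
      Finset.mem_range.2 (Nat.lt_succ_iff.2 hi)
    let par : Q.toCQ.vars → Q.toCQ.vars := fun v =>
      if h : 1 ≤ (v : ℕ) then ⟨Q.par v, hmem ((Q.par_lt v h (hle v)).le.trans (hle v))⟩ else v
    have hpar : ∀ v : Q.toCQ.vars, 1 ≤ (v : ℕ) → (par v : ℕ) = Q.par v := by
      intro v h
      simp only [par, dif_pos h]
    let root : Q.toCQ.vars := ⟨0, hmem (Nat.zero_le _)⟩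
    have hroot : ∀ v, v ≠ root ↔ 1 ≤ (v : ℕ) := by
      intro v
      rw [Nat.one_le_iff_ne_zero]
      exact not_congr Subtype.ext_iff
    have hedge : ∀ u v : Q.toCQ.vars, (∃ r, (r, (u : ℕ), (v : ℕ)) ∈ Q.toCQ.roleAtoms ∨
        (r, (v : ℕ), (u : ℕ)) ∈ Q.toCQ.roleAtoms) ↔
        (u ≠ root ∧ v = par u) ∨ (v ≠ root ∧ u = par v) := by
      have h₁ : ∀ u v : Q.toCQ.vars, ∀ r, (r, (u : ℕ), (v : ℕ)) ∈ Q.toCQ.roleAtoms →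
          (u ≠ root ∧ v = par u) ∨ (v ≠ root ∧ u = par v) := by
        intro u v r h
        obtain ⟨i, ⟨h₁, hi⟩, heq⟩ := mem_roleAtoms.1 h
        rcases (Q.lab i).assertion_cases (Q.par i) i with h' | h' <;> rw [h'] at heq <;>
          simp only [Prod.mk.injEq] at heq <;> obtain ⟨-, h₂, h₃⟩ := heq
        · subst h₃
          exact Or.inr ⟨(hroot v).2 h₁, Subtype.ext (h₂.symm.trans (hpar v h₁).symm)⟩
        · subst h₂
          exact Or.inl ⟨(hroot u).2 h₁, Subtype.ext (h₃.symm.trans (hpar u h₁).symm)⟩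
      have h₂ : ∀ v : Q.toCQ.vars, v ≠ root →
          ∃ r, (r, (v : ℕ), (par v : ℕ)) ∈ Q.toCQ.roleAtoms ∨
            (r, (par v : ℕ), (v : ℕ)) ∈ Q.toCQ.roleAtoms := by
        intro v hv
        have hv := (hroot v).1 hv
        have : (Q.lab v).assertion (Q.par v) (v : ℕ) ∈ Q.toCQ.roleAtoms :=
          mem_roleAtoms.2 ⟨v, ⟨hv, hle v⟩, rfl⟩
        rw [hpar v hv]
        rcases (Q.lab v).assertion_cases (Q.par v) (v : ℕ) with h' | h' <;> rw [h'] at this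
        · exact ⟨_, Or.inr this⟩
        · exact ⟨_, Or.inl this⟩
      intro u v
      constructor
      · rintro ⟨r, h | h⟩
        · exact h₁ u v r h
        · exact (h₁ v u r h).symm
      · rintro (⟨hu, rfl⟩ | ⟨hv, rfl⟩)
        · exact h₂ u hu
        · obtain ⟨r, h⟩ := h₂ v hv
          exact ⟨r, h.symm⟩
    have hlt : ∀ v, v ≠ root → (par v : ℕ) < v := by
      intro v hv
      have hv := (hroot v).1 hv
      rw [hpar v hv]
      exact Q.par_lt v hv (hle v)
    refine isTree_of_parent _ root par (fun v => (v : ℕ)) hlt fun u v => ?_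
    rw [← hedge]
    refine (SimpleGraph.fromRel_adj _ _ _).trans ?_
    rw [← exists_or, and_iff_right_iff_imp, hedge]
    rintro (⟨hu, rfl⟩ | ⟨hv, rfl⟩) h
    · exact (hlt u hu).ne (congrArg Subtype.val h).symm
    · exact (hlt v hv).ne (congrArg Subtype.val h)
  · obtain ⟨i, ⟨h₁, hi⟩, rfl⟩ := mem_roleAtoms.1 hp
    obtain ⟨j, ⟨h₁', hj⟩, rfl⟩ := mem_roleAtoms.1 hp'
    rw [Role.sym2_assertion, Role.sym2_assertion, Sym2.eq_iff] at h
    have := Q.par_lt i h₁ hi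
    have := Q.par_lt j h₁' hj
    obtain rfl : i = j := by omega
    rfl

end QueryTree

/-- Every ELI concept is equivalent to a tree-shaped query with one answer variable. -/
theorem ELI.exists_query (NI : Type u) [Nonempty NR] {Sg : Sig NC NR} (C : ELI NC NR)
    (hC : C.Over Sg) :
    ∃ q : CQ NC NR, q.Over Sg ∧ q.IsOneTCQ ∧ ∀ (I : Interp NC NR NI) (a : NI),
      q.HoldsIn I [a] ↔ ∃ d, I.name a = some d ∧ d ∈ C.ext I := by
  let Q₀ : QueryTree NC NR :=
    { n := 0
      par := id
      -- An arbitrary default: a query with the single variable `0` uses no label.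
      lab := fun _ => .name (Classical.arbitrary NR)
      atoms := ∅
      par_lt := by omega
      atoms_le := by simp }
  obtain ⟨Q, hQ, -, h⟩ := Q₀.exists_extend NI C hC
    ⟨by simp [Q₀], fun i h₁ hi => absurd hi (by simp only [Q₀]; omega)⟩ 0 le_rfl
  refine ⟨Q.toCQ, Q.over_toCQ hQ, Q.isOneTCQ_toCQ, fun I a => ⟨?_, ?_⟩⟩
  · rintro ⟨π, hπ, hans⟩
    have : some (π 0) = I.name a := by simpa [QueryTree.toCQ] using hans
    exact ⟨π 0, this.symm, ((h I).1 π (QueryTree.isMatch_toCQ.1 hπ)).2⟩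
  · rintro ⟨d, hd, hC⟩
    obtain ⟨π, hπ, hm⟩ := (h I).2 (fun _ => d)
      ⟨by simp [Q₀], fun i h₁ hi => absurd hi (by simp only [Q₀]; omega)⟩ hC
    refine ⟨π, QueryTree.isMatch_toCQ.2 hm, ?_⟩
    simp [QueryTree.toCQ, hπ 0 le_rfl, hd]

/-! ### From tree-shaped queries to ELI concepts -/

/-- Shortest paths to `u` and `u'`, each extended by its edge to `v`, are both shortest and hence
paths from `x` to `v`. A tree has only one such path. -/
theorem eq_of_adj_of_dist_of_isTree {V : Type*} {G : SimpleGraph V}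
    (hG : G.IsTree) {x u u' v : V} (h : G.Adj u v) (h' : G.Adj u' v)
    (hd : G.dist x v = G.dist x u + 1) (hd' : G.dist x v = G.dist x u' + 1) : u = u' := by
  obtain ⟨p, hp, hpl⟩ := hG.connected.exists_path_of_dist x u
  obtain ⟨p', hp', hpl'⟩ := hG.connected.exists_path_of_dist x u'
  have h₁ : (p.concat h).IsPath := SimpleGraph.Walk.isPath_of_length_eq_dist _ (by
    rw [SimpleGraph.Walk.length_concat, hpl, hd])
  have h₂ : (p'.concat h').IsPath := SimpleGraph.Walk.isPath_of_length_eq_dist _ (by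
    rw [SimpleGraph.Walk.length_concat, hpl', hd'])
  have := congrArg SimpleGraph.Walk.penultimate
    (congrArg Subtype.val ((hG.isAcyclic.subsingleton_path x v).elim ⟨_, h₁⟩ ⟨_, h₂⟩))
  simpa using this

theorem exists_adj_dist_eq_of_connected {V : Type*} {G : SimpleGraph V}
    (hG : G.Connected) {x v : V} {k : ℕ} (hv : G.dist x v = k + 1) :
    ∃ u, G.Adj u v ∧ G.dist x u = k := by
  obtain ⟨p, hp, hpl⟩ := hG.exists_path_of_dist x v
  have hnil : ¬ p.Nil := by
    rw [← SimpleGraph.Walk.length_eq_zero_iff]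
    omega
  refine ⟨p.penultimate, p.adj_penultimate hnil, ?_⟩
  have h₁ : G.dist x p.penultimate ≤ k := by
    refine (SimpleGraph.dist_le p.dropLast).trans ?_
    have := congrArg SimpleGraph.Walk.length (p.concat_dropLast (p.adj_penultimate hnil))
    rw [SimpleGraph.Walk.length_concat] at this
    omega
  have h₂ := (p.adj_penultimate hnil).diff_dist_adj (u := x)
  omega

namespace CQ

variable (q : CQ NC NR) (ρ : ℕ → ℕ)

/-- The ELI concept that describes the matches at `v` of the part of the query of depth less than
`n` below `v`, where `ρ` is the distance from the root. -/
noncomputable def concept : ℕ → ℕ → ELI NC NR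
  | 0, _ => .top
  | n + 1, v => open Classical in
    .conj (.bigConj ((q.conceptAtoms.filter fun p => p.2 = v).toList.map fun p => .atom p.1))
      (.conj
        (.bigConj ((q.roleAtoms.filter fun p => p.2.1 = v ∧ ρ p.2.2 = ρ v + 1).toList.map
          fun p => .ex (.name p.1) (concept n p.2.2)))
        (.bigConj ((q.roleAtoms.filter fun p => p.2.2 = v ∧ ρ p.2.1 = ρ v + 1).toList.map
          fun p => .ex (.inv p.1) (concept n p.2.1))))

theorem mem_ext_concept_succ {n v : ℕ} {I : Interp NC NR NI} {d : I.Dom} :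
    d ∈ (q.concept ρ (n + 1) v).ext I ↔
      (∀ A, (A, v) ∈ q.conceptAtoms → d ∈ I.conc A) ∧
      (∀ r z, (r, v, z) ∈ q.roleAtoms → ρ z = ρ v + 1 →
        ∃ e, I.role r d e ∧ e ∈ (q.concept ρ n z).ext I) ∧
      (∀ r z, (r, z, v) ∈ q.roleAtoms → ρ z = ρ v + 1 →
        ∃ e, I.role r e d ∧ e ∈ (q.concept ρ n z).ext I) := by
  classical
  refine and_congr ?_ (and_congr ?_ ?_) <;> rw [ELI.mem_ext_bigConj]
  · simp only [List.mem_map, Finset.mem_toList, Finset.mem_filter]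
    constructor
    · exact fun h A hA => h (.atom A) ⟨(A, v), ⟨hA, rfl⟩, rfl⟩
    · rintro h C ⟨⟨A, z⟩, ⟨hA, rfl⟩, rfl⟩
      exact h A hA
  · simp only [List.mem_map, Finset.mem_toList, Finset.mem_filter]
    constructor
    · exact fun h r z hr hz => h _ ⟨(r, v, z), ⟨hr, rfl, hz⟩, rfl⟩
    · rintro h C ⟨⟨r, y, z⟩, ⟨hr, rfl, hz⟩, rfl⟩
      exact h r z hr hz
  · simp only [List.mem_map, Finset.mem_toList, Finset.mem_filter]
    constructor
    · exact fun h r z hr hz => h _ ⟨(r, z, v), ⟨hr, rfl, hz⟩, rfl⟩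
    · rintro h C ⟨⟨r, z, y⟩, ⟨hr, rfl, hz⟩, rfl⟩
      exact h r z hr hz

variable {q ρ}

theorem over_concept {Sg : Sig NC NR} (hq : q.Over Sg) (n v : ℕ) :
    (q.concept ρ n v).Over Sg := by
  classical
  induction n generalizing v with
  | zero => trivial
  | succ n ih =>
    refine ⟨ELI.over_bigConj ?_, ELI.over_bigConj ?_, ELI.over_bigConj ?_⟩ <;>
      simp only [List.mem_map, Finset.mem_toList, Finset.mem_filter]
    · rintro C ⟨p, ⟨hp, -⟩, rfl⟩
      exact hq.1 p hp
    · rintro C ⟨p, ⟨hp, -⟩, rfl⟩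
      exact ⟨hq.2 p hp, ih _⟩
    · rintro C ⟨p, ⟨hp, -⟩, rfl⟩
      exact ⟨hq.2 p hp, ih _⟩

theorem IsMatch.mem_ext_concept {I : Interp NC NR NI} {π : ℕ → I.Dom} (h : q.IsMatch I π)
    (n v : ℕ) : π v ∈ (q.concept ρ n v).ext I := by
  induction n generalizing v with
  | zero => trivial
  | succ n ih =>
    exact (q.mem_ext_concept_succ ρ).2 ⟨fun A hA => h.1 A v hA,
      fun r z hr _ => ⟨π z, h.2 r v z hr, ih z⟩, fun r z hr _ => ⟨π z, h.2 r z v hr, ih z⟩⟩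

/-- Matches of a query whose variables have ranks such that role atoms link variables of
consecutive ranks, and each variable of rank `k + 1` is linked to a variable of rank `k` by exactly
one role atom. -/
theorem exists_isMatch {x : ℕ} {K : ℕ} (hx : ∀ v ∈ q.vars, ρ v = 0 → v = x)
    (hK : ∀ v ∈ q.vars, ρ v < K)
    (hatom : ∀ r y z, (r, y, z) ∈ q.roleAtoms → ρ y = ρ z + 1 ∨ ρ z = ρ y + 1)
    (hpar : ∀ v ∈ q.vars, ∀ k, ρ v = k + 1 → ∃ p ∈ q.roleAtoms,
      (p.2.1 = v ∧ ρ p.2.2 = k ∨ p.2.2 = v ∧ ρ p.2.1 = k) ∧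
      ∀ p' ∈ q.roleAtoms, (p'.2.1 = v ∧ ρ p'.2.2 = k ∨ p'.2.2 = v ∧ ρ p'.2.1 = k) → p' = p)
    {I : Interp NC NR NI} {d : I.Dom} (hd : d ∈ (q.concept ρ K x).ext I) (hρx : ρ x = 0) :
    ∃ π, q.IsMatch I π ∧ π x = d := by
  have key : ∀ k, k < K → ∃ π : ℕ → I.Dom, π x = d ∧
      (∀ v ∈ q.vars, ρ v ≤ k → π v ∈ (q.concept ρ (K - ρ v) v).ext I) ∧
      (∀ r y z, (r, y, z) ∈ q.roleAtoms → ρ y ≤ k → ρ z ≤ k → I.role r (π y) (π z)) := by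
    intro k
    induction k with
    | zero =>
      intro _
      refine ⟨fun _ => d, rfl, fun v hv h => ?_, fun r y z h hy hz => ?_⟩
      · have h0 := Nat.le_zero.1 h
        rw [h0, hx v hv h0]
        exact hd
      · have := hatom r y z h
        omega
    | succ k ih =>
      intro hk
      obtain ⟨π, hπx, hπ, hr⟩ := ih (by omega)
      -- Since `v` has a unique atom towards rank `k`, the witness that the concept at its parent
      -- provides for this atom meets all constraints from smaller ranks.
      have hex : ∀ v, ∃ e, v ∈ q.vars → ρ v = k + 1 → e ∈ (q.concept ρ (K - ρ v) v).ext I ∧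
          ∀ p ∈ q.roleAtoms, (p.2.1 = v ∧ ρ p.2.2 = k → I.role p.1 e (π p.2.2)) ∧
            (p.2.2 = v ∧ ρ p.2.1 = k → I.role p.1 (π p.2.1) e) := by
        intro v
        by_cases hv : v ∈ q.vars ∧ ρ v = k + 1
        swap
        · exact ⟨d, fun h h' => absurd ⟨h, h'⟩ hv⟩
        obtain ⟨hv, hvk⟩ := hv
        obtain ⟨⟨r, y, z⟩, hp, hlink, huniq⟩ := hpar v hv k hvk
        have hKk : K - k = (K - ρ v) + 1 := by omega
        rcases hlink with ⟨rfl, hz⟩ | ⟨rfl, hy⟩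
        · dsimp only at hz hvk hKk ⊢
          have hmem := hπ z (q.role_mem _ hp).2 hz.le
          rw [hz, hKk] at hmem
          obtain ⟨e, he, hC⟩ := ((q.mem_ext_concept_succ ρ).1 hmem).2.2 r y hp (by omega)
          refine ⟨e, fun _ _ => ⟨hC, fun p hp' => ⟨fun h => ?_, fun h => ?_⟩⟩⟩
          · obtain rfl := huniq p hp' (Or.inl h)
            exact he
          · obtain rfl := huniq p hp' (Or.inr h)
            have := h.2
            dsimp only at this
            omega
        · dsimp only at hy hvk hKk ⊢
          have hmem := hπ y (q.role_mem _ hp).1 hy.le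
          rw [hy, hKk] at hmem
          obtain ⟨e, he, hC⟩ := ((q.mem_ext_concept_succ ρ).1 hmem).2.1 r z hp (by omega)
          refine ⟨e, fun _ _ => ⟨hC, fun p hp' => ⟨fun h => ?_, fun h => ?_⟩⟩⟩
          · obtain rfl := huniq p hp' (Or.inl h)
            have := h.2
            dsimp only at this
            omega
          · obtain rfl := huniq p hp' (Or.inr h)
            exact he
      choose e he using hex
      let π' : ℕ → I.Dom := fun v => if ρ v = k + 1 then e v else π v
      have h₁ : ∀ v, ρ v = k + 1 → π' v = e v := fun v h => if_pos h
      have h₂ : ∀ v, ρ v ≤ k → π' v = π v := fun v h => if_neg (by omega)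
      refine ⟨π', by rw [h₂ x (by omega), hπx], fun v hv hle => ?_, fun r y z h hy hz => ?_⟩
      · rcases Nat.le_succ_iff.1 hle with hle | heq
        · rw [h₂ v hle]
          exact hπ v hv hle
        · rw [h₁ v heq]
          exact (he v hv heq).1
      · rcases hatom r y z h with hyz | hyz
        · rcases Nat.le_succ_iff.1 hy with hy | hy
          · rw [h₂ y hy, h₂ z (by omega)]
            exact hr r y z h hy (by omega)
          · rw [h₁ y hy, h₂ z (by omega)]
            exact ((he y (q.role_mem _ h).1 hy).2 _ h).1 ⟨rfl, by dsimp only; omega⟩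
        · rcases Nat.le_succ_iff.1 hz with hz | hz
          · rw [h₂ z hz, h₂ y (by omega)]
            exact hr r y z h (by omega) hz
          · rw [h₁ z hz, h₂ y (by omega)]
            exact ((he z (q.role_mem _ h).2 hz).2 _ h).2 ⟨rfl, by dsimp only; omega⟩
  by_cases hK0 : K = 0
  · have hempty : ∀ v, v ∉ q.vars := fun v hv => by
      have := hK v hv
      omega
    exact ⟨fun _ => d, ⟨fun A z h => absurd (q.concept_mem _ h) (hempty _),
      fun r y z h => absurd (q.role_mem _ h).1 (hempty _)⟩, rfl⟩
  obtain ⟨π, hπx, hπ, hr⟩ := key (K - 1) (by omega)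
  refine ⟨π, ⟨fun A v hA => ?_, fun r y z h => ?_⟩, hπx⟩
  · have hv := q.concept_mem _ hA
    have := hK v hv
    have hmem := hπ v hv (by omega)
    obtain ⟨m, hm⟩ : ∃ m, K - ρ v = m + 1 := ⟨K - ρ v - 1, by omega⟩
    rw [hm] at hmem
    exact ((q.mem_ext_concept_succ ρ).1 hmem).1 A hA
  · have h₁ := hK y (q.role_mem _ h).1
    have h₂ := hK z (q.role_mem _ h).2
    exact hr r y z h (by omega) (by omega)

/-- Every tree-shaped query with one answer variable is equivalent to an ELI concept. -/
theorem IsOneTCQ.exists_concept (NI : Type u) {Sg : Sig NC NR} (hq : q.IsOneTCQ)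
    (hSg : q.Over Sg) : ∃ C : ELI NC NR, C.Over Sg ∧ ∀ (I : Interp NC NR NI) (a : NI),
      q.HoldsIn I [a] ↔ ∃ d, I.name a = some d ∧ d ∈ C.ext I := by
  classical
  obtain ⟨⟨hloop, htree, hmulti⟩, x, hx⟩ := hq
  have hxv : x ∈ q.vars := q.ans_mem x (by simp [hx])
  let ρ : ℕ → ℕ := fun v => if h : v ∈ q.vars then q.graph.dist ⟨x, hxv⟩ ⟨v, h⟩ else 0
  have hρ : ∀ v (h : v ∈ q.vars), ρ v = q.graph.dist ⟨x, hxv⟩ ⟨v, h⟩ := fun v h => dif_pos h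
  have hadj : ∀ r y z (h : (r, y, z) ∈ q.roleAtoms),
      q.graph.Adj ⟨y, (q.role_mem _ h).1⟩ ⟨z, (q.role_mem _ h).2⟩ := by
    intro r y z h
    refine (SimpleGraph.fromRel_adj _ _ _).2 ⟨fun heq => ?_, Or.inl ⟨r, h⟩⟩
    obtain rfl : y = z := congrArg Subtype.val heq
    exact hloop r y h
  -- One more than the largest rank, so that the concept still checks the concept atoms of the
  -- deepest variables.
  let K := q.vars.sup ρ + 1
  have hmatch : ∀ (I : Interp NC NR NI) (d : I.Dom),
      d ∈ (q.concept ρ K x).ext I ↔ ∃ π, q.IsMatch I π ∧ π x = d := by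
    refine fun I d => ⟨fun hd => ?_, ?_⟩
    swap
    · rintro ⟨π, hπ, rfl⟩
      exact hπ.mem_ext_concept K x
    refine exists_isMatch ?_ ?_ ?_ ?_ hd (by rw [hρ x hxv, SimpleGraph.dist_self])
    · intro v hv h
      rw [hρ v hv, htree.connected.dist_eq_zero_iff] at h
      exact (congrArg Subtype.val h).symm
    · exact fun v hv => Nat.lt_succ_of_le (Finset.le_sup (f := ρ) hv)
    · intro r y z h
      rw [hρ y (q.role_mem _ h).1, hρ z (q.role_mem _ h).2]
      exact htree.dist_eq_dist_add_one_of_adj _ (hadj r y z h)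
    · intro v hv k hk
      rw [hρ v hv] at hk
      obtain ⟨⟨u, hu⟩, huv, hd⟩ := exists_adj_dist_eq_of_connected htree.connected hk
      have hlink : ∀ p ∈ q.roleAtoms, (p.2.1 = v ∧ ρ p.2.2 = k ∨ p.2.2 = v ∧ ρ p.2.1 = k) →
          s(p.2.1, p.2.2) = s(u, v) := by
        rintro ⟨r, y, z⟩ hp (⟨rfl, h⟩ | ⟨rfl, h⟩)
        · dsimp only at h hk ⊢
          rw [hρ z (q.role_mem _ hp).2] at h
          have := eq_of_adj_of_dist_of_isTree htree huv (hadj r y z hp).symm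
            (by rw [hk, hd]) (by rw [hk, h])
          rw [Subtype.mk.injEq] at this
          rw [this, Sym2.eq_swap]
        · dsimp only at h hk ⊢
          rw [hρ y (q.role_mem _ hp).1] at h
          have := eq_of_adj_of_dist_of_isTree htree huv (hadj r y z hp)
            (by rw [hk, hd]) (by rw [hk, h])
          rw [Subtype.mk.injEq] at this
          rw [this]
      have hρu : ρ u = k := by rw [hρ u hu, hd]
      obtain ⟨r, hr | hr⟩ := ((SimpleGraph.fromRel_adj _ _ _).1 huv).2.elim
        (fun ⟨r, h⟩ => (⟨r, Or.inl h⟩ : ∃ r, (r, u, v) ∈ q.roleAtoms ∨ (r, v, u) ∈ q.roleAtoms))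
        (fun ⟨r, h⟩ => ⟨r, Or.inr h⟩)
      · have h := Or.inr (a := (u = v ∧ ρ v = k)) (And.intro (rfl : v = v) hρu)
        exact ⟨_, hr, h, fun p' hp' h' => hmulti _ hp' _ hr ((hlink _ hp' h').trans rfl)⟩
      · have h := Or.inl (b := (u = v ∧ ρ v = k)) (And.intro (rfl : v = v) hρu)
        exact ⟨_, hr, h, fun p' hp' h' => hmulti _ hp' _ hr ((hlink _ hp' h').trans Sym2.eq_swap)⟩
  refine ⟨q.concept ρ K x, over_concept hSg _ _, fun I a => ⟨?_, ?_⟩⟩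
  · rintro ⟨π, hπ, hans⟩
    have : some (π x) = I.name a := by simpa [hx] using hans
    exact ⟨π x, this.symm, (hmatch I _).2 ⟨π, hπ, rfl⟩⟩
  · rintro ⟨d, hd, hC⟩
    obtain ⟨π, hπ, rfl⟩ := (hmatch I d).1 hC
    exact ⟨π, hπ, by simp [hx, hd]⟩

end CQ

/-! ### The characterization of query entailment -/

/-- There are only countably many walks, so individual names suffice to name the individuals of
unravelled ABoxes. -/
theorem exists_injective_walkNames (NR NI : Type*) [Countable NR] [Countable NI] [Infinite NI] :
    ∃ ν : List (Role NR × NI) → NI, Function.Injective ν := by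
  obtain ⟨f, hf⟩ := exists_injective_nat (List (Role NR × NI))
  exact ⟨Infinite.natEmbedding NI ∘ f, (Infinite.natEmbedding NI).injective.comp hf⟩

theorem simulates_of_oneTCQEntails [Nonempty NR] {SA SQ : Sig NC NR} {T₁ T₂ : TBox NC NR}
    (h : TBox.OneTCQEntails NI SA SQ T₁ T₂) {𝒜 : ABox NC NR NI} (hne : 𝒜.ind.Nonempty)
    (hA : 𝒜.Over SA) (hc₁ : T₁.Consistent 𝒜) (hc₂ : T₂.Consistent 𝒜) {I : Interp NC NR NI}
    (hfin : I.FinitelyBranching) (hIA : I.ModelsA 𝒜) (hIT : I.ModelsT T₁) :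
    Interp.Simulates SQ (T₂.universalModel 𝒜 hne) I := by
  refine ⟨_, Interp.isSimulation_of_finitelyBranching hfin fun a p hp => ?_⟩
  have ha : a ∈ 𝒜.ind := by
    by_contra ha
    exact absurd ((dif_neg ha : (T₂.universalModel 𝒜 hne).name a = none).symm.trans hp) (by simp)
  obtain ⟨e, he⟩ := hIA.name_of_mem_ind ha
  refine ⟨e, he, fun C hC hpC => ?_⟩
  obtain ⟨q, hq, hq₁, hqC⟩ := C.exists_query NI hC
  have hcert : T₂.CertainAnswer 𝒜 q [a] := by
    intro J hJ hJA
    have hσ := TBox.isSimulation_realizes hne hJ hJA SQ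
    obtain ⟨d, hd, hpd⟩ := hσ.1 a p hp
    exact (hqC J a).2 ⟨d, hd, ELI.mem_ext_of_simulation hσ hC hpd hpC⟩
  obtain ⟨d, hd, hdC⟩ := (hqC I a).1 (h 𝒜 hA hc₁ hc₂ q hq hq₁ a ha hcert I hIT hIA)
  obtain rfl := Option.some.inj (he.symm.trans hd)
  exact hdC

theorem oneTCQEntails_of_simulates [Infinite NC] [Countable NR] [Countable NI] [Infinite NI]
    {SA SQ : Sig NC NR} {T₁ T₂ : TBox NC NR} (hT₁ : T₁.FunctionalNoSubroles)
    (hT₂ : T₂.FunctionalNoSubroles)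
    (h : ∀ (𝒜 : ABox NC NR NI) (h𝒜 : 𝒜.TreeShaped), 𝒜.Over SA →
      T₁.Consistent 𝒜 → T₂.Consistent 𝒜 →
      ∀ I₁ : Interp NC NR NI, I₁.WeaklyTreeShaped → I₁.FinitelyBranching →
        I₁.ModelsA 𝒜 → I₁.ModelsT T₁ →
        Interp.Simulates SQ (T₂.universalModel 𝒜 h𝒜.ind_nonempty) I₁) :
    TBox.OneTCQEntails NI SA SQ T₁ T₂ := by
  intro 𝒜 hA hc₁ hc₂ q hq hq₁ a ha hcert I hI hIA
  obtain ⟨C, hC, hqC⟩ := hq₁.exists_concept NI hq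
  obtain ⟨ν, hν⟩ := exists_injective_walkNames NR NI
  have hent : T₂.EntailsELIAt 𝒜 C a := fun J hJ hJA => (hqC J a).1 (hcert J hJ hJA)
  obtain ⟨n, hn⟩ := hent.exists_unravel hT₂ hc₂ hν ha
  -- Depth `n + 1` instead of `n`, as the unravelled ABox needs positive depth.
  have htree := 𝒜.treeShaped_unravel (N := n + 1) hν ha (by omega)
  obtain ⟨J, hJ, hJw, hJf, hJA, f, hf, hfw⟩ := exists_unravelling hT₁ hI hIA hν ha
  -- Unravelling a common model of `T₂` and `𝒜` shows that the unravelled ABox is consistent with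
  -- `T₂`.
  obtain ⟨I₂, hI₂, hIA₂⟩ := hc₂
  obtain ⟨J₂, hJ₂, -, -, hJA₂, -⟩ := exists_unravelling hT₂ hI₂ hIA₂ hν ha
  have hc₂' : T₂.Consistent (𝒜.unravel ν a (n + 1)) := ⟨J₂, hJ₂, hJA₂ _⟩
  obtain ⟨σ, hσ⟩ := h _ htree (ABox.over_unravel hA) ⟨J, hJ, hJA _⟩ hc₂' J hJw hJf (hJA _) hJ
  -- `C` is entailed at the root, so it holds there in the universal model; the simulation takes it
  -- to `J`, and the homomorphism `f` to `a` in `I`.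
  obtain ⟨p, hp, hpC⟩ := hn (n + 1) (Nat.le_succ n) _
    (TBox.modelsT_universalModel hT₂ hc₂' htree.ind_nonempty)
    (TBox.modelsA_universalModel htree.ind_nonempty)
  obtain ⟨e, he, hpe⟩ := hσ.1 _ p hp
  obtain ⟨d, hd, hfd⟩ := hfw [] .nil
  obtain rfl := Option.some.inj (he.symm.trans hd)
  exact (hqC I a).2 ⟨f e, hfd, hf C e (ELI.mem_ext_of_simulation hσ hC hpe hpC)⟩

end HornALCHIF

theorem mainTheorem6 {NC NR NI : Type u}
    [Countable NC] [Infinite NC] [Countable NR] [Infinite NR] [Countable NI] [Infinite NI]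
    (SA SQ : HornALCHIF.Sig NC NR) (T₁ T₂ : HornALCHIF.TBox NC NR)
    (hT₁ : T₁.FunctionalNoSubroles) (hT₂ : T₂.FunctionalNoSubroles)
    (hRI : HornALCHIF.TBox.RIEntails NI SA SQ T₁ T₂) :
    HornALCHIF.TBox.OneTCQEntails NI SA SQ T₁ T₂ ↔
      ∀ (𝒜 : HornALCHIF.ABox NC NR NI) (h𝒜 : 𝒜.TreeShaped), 𝒜.Over SA →
        T₁.Consistent 𝒜 → T₂.Consistent 𝒜 →
        ∀ I₁ : HornALCHIF.Interp NC NR NI, I₁.WeaklyTreeShaped → I₁.FinitelyBranching →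
          I₁.ModelsA 𝒜 → I₁.ModelsT T₁ →
          HornALCHIF.Interp.Simulates SQ (T₂.universalModel 𝒜 h𝒜.ind_nonempty) I₁ := by
  constructor
  · intro h 𝒜 h𝒜 hA hc₁ hc₂ I₁ _ hfin hIA hIT
    exact HornALCHIF.simulates_of_oneTCQEntails h h𝒜.ind_nonempty hA hc₁ hc₂ hfin hIA hIT
  · exact HornALCHIF.oneTCQEntails_of_simulates hT₁ hT₂
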